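/- Let $p$ be a prime and let $K/\mathbb{Q}_p$ be a finite extension with ramification index $e=1$, with ring of integers $\mathcal{O}_K$, residue field $k$ and normalized valuation $v$. Let $G/K$ be a split, almost-simple, simply connected group with a split maximal torus $T$, a Borel subgroup $B\supset T$, root system $\Phi$, and a Chevalley system $(X_\alpha)_{\alpha\in\Phi}$, with corresponding root subgroups $u_\alpha:\mathbb{G}_a\to U_\alpha$, $du_\alpha(1)=X_\alpha$. Let $\mathrm{ht}$ be the height function on $\Phi$ determined by $B$ and let $h$ be the Coxeter number of $\Phi$. Let $\mathfrak{g}_{\mathbb{Z}}$ be the $\mathbb{Z}$-span of the Chevalley basis (the $X_\alpha$ and the coroot vectors $H_\alpha$) and $\mathfrak{n}_{\mathbb{Z}}\subset\mathfrak{g}_{\mathbb{Z}}$ the $\mathbb{Z}$-span of the $X_\alpha$ with $\alpha>0$; put $\mathfrak{g}=\mathfrak{g}_{\mathbb{Z}}\otimes k$ and $\mathfrak{n}=\mathfrak{n}_{\mathbb{Z}}\otimes k$. For $i\ge 1$ let $G_{x,i/h}\subset G(K)$ be the subgroup generated by $\{t\in T(K): v(\chi(t)-1)\ge i/h \text{ for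 all } \chi\in X^*(T)\}$ and by the elements $u_\alpha(z)$ with $\alpha\in\Phi$, $z\in K$, $v(z)+\mathrm{ht}(\alpha)/h\ge i/h$ (the Moy--Prasad filtration at the barycentre $x$ of the base alcove). Let $I_1=G_{x,1/h}$, the pro-$p$ Iwahori subgroup. Assume that $h<p-1$. Then the filtration $\mathrm{Fil}^{i/h}(I_1)=G_{x,i/h}$, $i\ge1$, is the filtration of a $p$-valuation on $I_1$, so that $$\mathrm{gr}(I_1)=\bigoplus_{i\ge 1}G_{x,i/h}/G_{x,(i+1)/h}$$ is a Lie algebra over $\mathbb{F}_p[\epsilon]$, with bracket induced by group commutators and with $\epsilon$ induced by $y\mapsto y^p$; and there is an isomorphism of $\mathbb{F}_p$-Lie algebras $$\mathrm{gr}(I_1)\otimes_{\mathbb{F}_p[\epsilon]}\mathbb{F}_p\;\cong\;\mathfrak{n}\ltimes(\mathfrak{g}/\mathfrak{n}),$$ where $\epsilon$ acts by $0$ on $\mathbb{F}_p$, and where the right-hand side is the semidirect product in which $\mathfrak{g}/\mathfrak{n}$ is an abelian ideal and $[X,w]=X\cdot w$ for $X\in\mathfrak{n}$, $w\in\mathfrak{g}/\mathfrak{n}$,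 through the adjoint action. -/

import Mathlib

open scoped DirectSum TensorProduct
open Polynomial

/-! ## Graded Lie algebras of filtered groups -/

section Filtered

open scoped commutatorElement

variable {Γ : Type*} [Group Γ]

/-- `F` is the filtration of a `p`-valuation `ω` with values in `(1/h)ℤ`, where
`F i = {x | ω x ≥ i / h}` and the valued group is `F 1`.  The fields `lie_mem`, `eq_one_of_forall`,
`pow_mem`, `mem_of_pow_mem`, `lt` are the axioms of a `p`-valuation
(`ω [x,y] ≥ ω x + ω y`, `ω x = ∞ → x = 1`, `ω (x ^ p) = ω x + 1`, `ω x > 1 / (p - 1)`);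
the last two fields are the congruences (valid for every `p`-valuation, by Lazard) which say that
`x ↦ x ^ p` induces an additive operator of degree one on the associated graded, over which the
bracket is bilinear. -/
structure IsPValuedFiltration (p h : ℕ) (F : ℕ → Subgroup Γ) : Prop where
  pos : 0 < h
  lt : h < p - 1
  anti : Antitone F
  eq_one_of_forall : ∀ x : Γ, (∀ i, x ∈ F i) → x = 1
  lie_mem : ∀ {i j : ℕ}, 1 ≤ i → 1 ≤ j → ∀ {x y : Γ}, x ∈ F i → y ∈ F j → ⁅x, y⁆ ∈ F (i + j)
  pow_mem : ∀ {i : ℕ}, 1 ≤ i → ∀ {x : Γ}, x ∈ F i → x ^ p ∈ F (i + h)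
  mem_of_pow_mem : ∀ {i : ℕ}, 1 ≤ i → ∀ {x : Γ}, x ∈ F i → x ^ p ∈ F (i + h + 1) → x ∈ F (i + 1)
  mul_pow : ∀ {i : ℕ}, 1 ≤ i → ∀ {x y : Γ}, x ∈ F i → y ∈ F i →
    (x ^ p * y ^ p)⁻¹ * (x * y) ^ p ∈ F (i + h + 1)
  pow_lie : ∀ {i j : ℕ}, 1 ≤ i → 1 ≤ j → ∀ {x y : Γ}, x ∈ F i → y ∈ F j →
    (⁅x, y⁆ ^ p)⁻¹ * ⁅x ^ p, y⁆ ∈ F (i + j + h + 1)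

namespace IsPValuedFiltration

variable {p h : ℕ} {F : ℕ → Subgroup Γ} (hF : IsPValuedFiltration p h F)

lemma conj_mem (hF : IsPValuedFiltration p h F) {i : ℕ} (hi : 1 ≤ i) {x y : Γ} (hx : x ∈ F i) (hy : y ∈ F 1) :
    y * x * y⁻¹ ∈ F i := by
  have h1 := hF.anti (Nat.le_add_left i 1) (hF.lie_mem le_rfl hi hy hx)
  have : y * x * y⁻¹ = ⁅y, x⁆ * x := by simp [commutatorElement_def]
  rw [this]
  exact mul_mem h1 hx

lemma mem_one (hF : IsPValuedFiltration p h F) (i : ℕ+) {x : Γ} (hx : x ∈ F i) : x ∈ F 1 := hF.anti i.pos hx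

lemma normal (hF : IsPValuedFiltration p h F) (i : ℕ+) : ((F (i + 1)).subgroupOf (F i)).Normal where
  conj_mem := by
    rintro ⟨n, hn⟩ hn' ⟨g, hg⟩
    rw [Subgroup.mem_subgroupOf] at hn' ⊢
    exact hF.conj_mem (by omega) hn' (hF.mem_one i hg)

/-- The graded piece `F i / F (i + 1)`, written additively. -/
def Piece (_ : IsPValuedFiltration p h F) (i : ℕ+) : Type _ :=
  Additive (F i ⧸ (F (i + 1)).subgroupOf (F i))

noncomputable instance (i : ℕ+) : AddCommGroup (hF.Piece i) :=
  haveI := hF.normal i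
  letI : CommGroup (F i ⧸ (F (i + 1)).subgroupOf (F i)) :=
    { QuotientGroup.Quotient.group _ with
      mul_comm := by
        intro a b
        induction a using QuotientGroup.induction_on with | _ x
        induction b using QuotientGroup.induction_on with | _ y
        rw [← QuotientGroup.mk_mul, ← QuotientGroup.mk_mul, QuotientGroup.eq,
          Subgroup.mem_subgroupOf]
        have h1 := hF.lie_mem i.pos i.pos (inv_mem y.2) (inv_mem x.2)
        have h2 : (((x * y)⁻¹ * (y * x) : F i) : Γ) = ⁅(y : Γ)⁻¹, (x : Γ)⁻¹⁆ := by
          simp [commutatorElement_def, mul_assoc]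
        rw [h2]
        exact hF.anti (by have := i.pos; omega) h1 }
  inferInstanceAs (AddCommGroup (Additive (F i ⧸ (F (i + 1)).subgroupOf (F i))))

/-- The class of an element of `F i` in the graded piece. -/
def toPiece (i : ℕ+) : F i →* Multiplicative (hF.Piece i) where
  toFun x := Multiplicative.ofAdd
    (Additive.ofMul (QuotientGroup.mk x : F i ⧸ (F (i + 1)).subgroupOf (F i)))
  map_one' := rfl
  map_mul' _ _ := rfl

/-- The associated graded `gr = ⨁ F i / F (i + 1)`, over `i ≥ 1`. -/
def Gr : Type _ := ⨁ i : ℕ+, hF.Piece i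

noncomputable instance : AddCommGroup hF.Gr :=
  inferInstanceAs (AddCommGroup (⨁ i : ℕ+, hF.Piece i))

/-- The symbol in `gr` of an element `x` of `F i`. -/
noncomputable def symb (i : ℕ+) (x : F i) : hF.Gr :=
  DirectSum.of hF.Piece i (Multiplicative.toAdd (hF.toPiece i x))

lemma symb_mul (i : ℕ+) (x y : F i) : hF.symb i (x * y) = hF.symb i x + hF.symb i y := by
  unfold symb
  rw [map_mul, toAdd_mul]
  exact (DirectSum.of hF.Piece i).map_add _ _

lemma symb_one (i : ℕ+) : hF.symb i 1 = 0 := by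
  have := hF.symb_mul i 1 1
  simpa using this

lemma symb_inv (i : ℕ+) (x : F i) : hF.symb i x⁻¹ = - hF.symb i x := by
  rw [eq_neg_iff_add_eq_zero, ← symb_mul, inv_mul_cancel, symb_one]

lemma symb_pow (i : ℕ+) (x : F i) (n : ℕ) : hF.symb i (x ^ n) = n • hF.symb i x := by
  induction n with
  | zero => simp [symb_one]
  | succ n ih => rw [pow_succ, symb_mul, ih, succ_nsmul]

lemma symb_congr {i j : ℕ+} (hij : i = j) {x : F i} {y : F j} (hxy : (x : Γ) = y) :
    hF.symb i x = hF.symb j y := by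
  subst hij
  rw [Subtype.ext hxy]

lemma symb_eq_of_mem (i : ℕ+) {x y : F i} (hxy : (x : Γ)⁻¹ * y ∈ F (i + 1)) :
    hF.symb i x = hF.symb i y := by
  have : (QuotientGroup.mk x : F i ⧸ (F (i + 1)).subgroupOf (F i)) = QuotientGroup.mk y := by
    rw [QuotientGroup.eq, Subgroup.mem_subgroupOf]
    exact hxy
  have h2 : hF.toPiece i x = hF.toPiece i y :=
    congrArg (fun z => Multiplicative.ofAdd (Additive.ofMul z)) this
  rw [symb, symb, h2]

lemma symb_eq_zero (i : ℕ+) {x : F i} (hx : (x : Γ) ∈ F (i + 1)) : hF.symb i x = 0 := by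
  rw [← hF.symb_one i]
  refine hF.symb_eq_of_mem i ?_
  simpa using hx

lemma symb_conj (i : ℕ+) {x y : F i} {z : Γ} (hz : z ∈ F 1) (hy : (y : Γ) = z * x * z⁻¹) :
    hF.symb i y = hF.symb i x := by
  symm
  refine hF.symb_eq_of_mem i ?_
  have h1 := hF.lie_mem i.pos le_rfl (inv_mem x.2) hz
  have h2 : (x : Γ)⁻¹ * y = ⁅(x : Γ)⁻¹, z⁆ := by
    rw [hy, commutatorElement_def]; group
  rwa [h2]

@[elab_as_elim]
lemma Gr.induction {P : hF.Gr → Prop} (a : hF.Gr) (zero : P 0)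
    (symb : ∀ i x, P (hF.symb i x)) (add : ∀ a b, P a → P b → P (a + b)) : P a := by
  refine DirectSum.induction_on a zero (fun i x => ?_) add
  obtain ⟨y, rfl⟩ := QuotientGroup.mk_surjective (Additive.toMul x)
  exact symb i y

/-- A homomorphism on `F i` that kills `F (i + 1)` factors through the graded piece. -/
noncomputable def liftPiece {A : Type*} [AddCommGroup A] (i : ℕ+) (f : F i → A)
    (hmul : ∀ x y, f (x * y) = f x + f y) (hf : ∀ x : F i, (x : Γ) ∈ F (i + 1) → f x = 0) :
    hF.Piece i →+ A :=
  haveI := hF.normal i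
  AddMonoidHom.mk'
    (fun a => Multiplicative.toAdd (QuotientGroup.lift ((F (i + 1)).subgroupOf (F i))
      (MonoidHom.mk' (fun x => Multiplicative.ofAdd (f x))
        (fun x y => congrArg Multiplicative.ofAdd (hmul x y)))
      (fun x hx => congrArg Multiplicative.ofAdd (hf x hx)) (Additive.toMul a)))
    (fun a b => congrArg Multiplicative.toAdd
      ((QuotientGroup.lift ((F (i + 1)).subgroupOf (F i)) _ _).map_mul
        (Additive.toMul a) (Additive.toMul b)))

/-- Additive maps out of `gr`. -/
noncomputable def liftGr {A : Type*} [AddCommGroup A] (f : ∀ i : ℕ+, F i → A)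
    (hmul : ∀ i x y, f i (x * y) = f i x + f i y)
    (hf : ∀ (i : ℕ+) (x : F i), (x : Γ) ∈ F (i + 1) → f i x = 0) :
    hF.Gr →+ A :=
  DirectSum.toAddMonoid (fun i => hF.liftPiece i (f i) (hmul i) (hf i))

@[simp]
lemma liftGr_symb {A : Type*} [AddCommGroup A] (f : ∀ i : ℕ+, F i → A)
    (hmul : ∀ i x y, f i (x * y) = f i x + f i y)
    (hf : ∀ (i : ℕ+) (x : F i), (x : Γ) ∈ F (i + 1) → f i x = 0) (i : ℕ+) (x : F i) :
    hF.liftGr f hmul hf (hF.symb i x) = f i x := by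
  unfold liftGr symb
  exact DirectSum.toAddMonoid_of _ _ _

/-- The group commutator of `x ∈ F i` and `y ∈ F j`, as an element of `F (i + j)`. -/
def comm {i j : ℕ+} (x : F i) (y : F j) : F (i + j : ℕ+) :=
  ⟨⁅(x : Γ), (y : Γ)⁆, by simpa using hF.lie_mem i.pos j.pos x.2 y.2⟩

/-- The degree of the operator `ε`. -/
def step (hF : IsPValuedFiltration p h F) : ℕ+ := ⟨h, hF.pos⟩

@[simp] lemma step_coe : (hF.step : ℕ) = h := rfl

/-- The `p`-th power of `x ∈ F i`, as an element of `F (i + h)`. -/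
def ppow {i : ℕ+} (x : F i) : F (i + hF.step : ℕ+) :=
  ⟨(x : Γ) ^ p, by simpa using hF.pow_mem i.pos x.2⟩

lemma symb_comm_mul_right {i j : ℕ+} (x : F i) (y z : F j) :
    hF.symb _ (hF.comm x (y * z)) = hF.symb _ (hF.comm x y) + hF.symb _ (hF.comm x z) := by
  have hy := hF.mem_one j y.2
  have hm := hF.conj_mem (i + j).pos (hF.comm x z).2 hy
  rw [← hF.symb_conj (i + j) (x := hF.comm x z) (y := ⟨_, hm⟩) hy rfl, ← symb_mul]
  refine hF.symb_congr rfl ?_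
  simp only [comm, Subgroup.coe_mul, commutatorElement_def]
  group

lemma symb_comm_mul_left {i j : ℕ+} (x y : F i) (z : F j) :
    hF.symb _ (hF.comm (x * y) z) = hF.symb _ (hF.comm x z) + hF.symb _ (hF.comm y z) := by
  have hx := hF.mem_one i x.2
  have hm := hF.conj_mem (i + j).pos (hF.comm y z).2 hx
  rw [add_comm (hF.symb _ (hF.comm x z)),
    ← hF.symb_conj (i + j) (x := hF.comm y z) (y := ⟨_, hm⟩) hx rfl, ← symb_mul]
  refine hF.symb_congr rfl ?_
  simp only [comm, Subgroup.coe_mul, commutatorElement_def]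
  group

/-- The Lie bracket of `gr`: on symbols it is the symbol of the group commutator. -/
noncomputable def grBracket : hF.Gr →+ hF.Gr →+ hF.Gr :=
  hF.liftGr
    (fun i x => hF.liftGr (fun j y => hF.symb (i + j) (hF.comm x y))
      (fun _ _ _ => hF.symb_comm_mul_right _ _ _)
      (fun j y hy => hF.symb_eq_zero _ (by
        have := hF.lie_mem i.pos (by omega) x.2 hy
        simpa [comm, add_assoc] using this)))
    (fun i x y => by
      ext a
      induction a using Gr.induction with
      | zero => simp
      | symb j z => simpa using hF.symb_comm_mul_left x y z
      | add a b ha hb => rw [map_add, ha, hb, map_add])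
    (fun i x hx => by
      ext a
      induction a using Gr.induction with
      | zero => simp
      | symb j z =>
        simp only [liftGr_symb, AddMonoidHom.zero_apply]
        refine hF.symb_eq_zero _ ?_
        have := hF.lie_mem (by omega) j.pos hx z.2
        simp only [comm, PNat.add_coe]
        convert this using 2
        omega
      | add a b ha hb => rw [map_add, ha, hb, map_add])

noncomputable instance : Bracket hF.Gr hF.Gr where
  bracket a b := hF.grBracket a b

lemma bracket_symb {i j : ℕ+} (x : F i) (y : F j) :
    ⁅hF.symb i x, hF.symb j y⁆ = hF.symb (i + j) (hF.comm x y) := by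
  change hF.grBracket _ _ = _
  simp [grBracket]

lemma gr_add_lie (a b c : hF.Gr) : ⁅a + b, c⁆ = ⁅a, c⁆ + ⁅b, c⁆ := by
  change hF.grBracket _ _ = hF.grBracket _ _ + hF.grBracket _ _
  simp

lemma gr_lie_add (a b c : hF.Gr) : ⁅a, b + c⁆ = ⁅a, b⁆ + ⁅a, c⁆ := by
  change hF.grBracket _ _ = hF.grBracket _ _ + hF.grBracket _ _
  simp

lemma gr_lie_zero (a : hF.Gr) : ⁅a, (0 : hF.Gr)⁆ = 0 :=
  map_zero (hF.grBracket a)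

lemma gr_zero_lie (a : hF.Gr) : ⁅(0 : hF.Gr), a⁆ = 0 := by
  change hF.grBracket 0 a = 0
  simp

lemma gr_lie_neg (a b : hF.Gr) : ⁅a, -b⁆ = -⁅a, b⁆ :=
  map_neg (hF.grBracket a) b

lemma gr_neg_lie (a b : hF.Gr) : ⁅-a, b⁆ = -⁅a, b⁆ := by
  change hF.grBracket (-a) b = -hF.grBracket a b
  simp

lemma gr_skew (a b : hF.Gr) : ⁅a, b⁆ = -⁅b, a⁆ := by
  induction a using Gr.induction with
  | zero => rw [gr_zero_lie, gr_lie_zero, neg_zero]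
  | add a a' ha ha' => rw [gr_add_lie, gr_lie_add, ha, ha', neg_add]
  | symb i x =>
    induction b using Gr.induction with
    | zero => rw [gr_zero_lie, gr_lie_zero, neg_zero]
    | add b b' hb hb' => rw [gr_add_lie, gr_lie_add, hb, hb', neg_add]
    | symb j y =>
      rw [bracket_symb, bracket_symb, ← symb_inv]
      refine hF.symb_congr (add_comm _ _) ?_
      exact (commutatorElement_inv (y : Γ) (x : Γ)).symm

lemma gr_lie_self (a : hF.Gr) : ⁅a, a⁆ = 0 := by
  induction a using Gr.induction with
  | zero => rw [gr_zero_lie]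
  | add a b ha hb =>
    rw [gr_add_lie, gr_lie_add, gr_lie_add, ha, hb, hF.gr_skew b a]
    simp
  | symb i x =>
    rw [bracket_symb, ← hF.symb_one (i + i)]
    refine hF.symb_congr rfl ?_
    simp [comm, commutatorElement_self]

lemma gr_jacobi_symb {i j k : ℕ+} (x : F i) (y : F j) (z : F k) :
    ⁅⁅hF.symb i x, hF.symb j y⁆, hF.symb k z⁆ + ⁅⁅hF.symb j y, hF.symb k z⁆, hF.symb i x⁆
      + ⁅⁅hF.symb k z, hF.symb i x⁆, hF.symb j y⁆ = 0 := by
  have key : ∀ {i j k : ℕ+} (x : F i) (y : F j) (z : F k)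
      (w : F (i + j + k : ℕ+)), (w : Γ) = (y : Γ) * ⁅⁅(y : Γ)⁻¹, (x : Γ)⁆, (z : Γ)⁆ * (y : Γ)⁻¹ →
      hF.symb _ w = ⁅⁅hF.symb i x, hF.symb j y⁆, hF.symb k z⁆ := by
    intro i j k x y z w hw
    have e1 : hF.symb _ w = hF.symb _ (hF.comm (hF.comm y⁻¹ x) z) := by
      have hm : i + j + k = j + i + k := by rw [add_comm i j]
      have hw' : (w : Γ) ∈ F (j + i + k : ℕ+) := hm ▸ w.2
      rw [hF.symb_congr hm (y := ⟨w, hw'⟩) rfl]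
      exact hF.symb_conj _ (z := (y : Γ)) (hF.mem_one j y.2) hw
    rw [e1, ← bracket_symb, ← bracket_symb, symb_inv, gr_neg_lie, hF.gr_skew (hF.symb i x)]
  have hs1 : j + k + i = i + j + k := by rw [add_comm (j + k) i, add_assoc]
  have hs2 : k + i + j = i + j + k := by rw [add_assoc, add_comm]
  have mk : ∀ {i j k : ℕ+} (x : F i) (y : F j) (z : F k),
      (y : Γ) * ⁅⁅(y : Γ)⁻¹, (x : Γ)⁆, (z : Γ)⁆ * (y : Γ)⁻¹ ∈ F (i + j + k : ℕ+) := by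
    intro i j k x y z
    have hm : j + i + k = i + j + k := by rw [add_comm i j]
    exact hF.conj_mem (i + j + k).pos (hm ▸ (hF.comm (hF.comm y⁻¹ x) z).2) (hF.mem_one j y.2)
  rw [← key x y z ⟨_, mk x y z⟩ rfl, ← key y z x ⟨_, mk y z x⟩ rfl, ← key z x y ⟨_, mk z x y⟩ rfl]
  rw [hF.symb_congr hs1 (y := ⟨_, hs1 ▸ mk y z x⟩) rfl,
    hF.symb_congr hs2 (y := ⟨_, hs2 ▸ mk z x y⟩) rfl]
  rw [← symb_mul, ← symb_mul, ← hF.symb_one (i + j + k)]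
  refine hF.symb_congr rfl ?_
  have := conj_commutatorElement_left_commutatorElement_mul (y : Γ) (x : Γ) (z : Γ)
  simpa only [Subgroup.coe_mul, Subgroup.coe_one, mul_assoc] using this

noncomputable instance : LieRing hF.Gr where
  add_lie := hF.gr_add_lie
  lie_add := hF.gr_lie_add
  lie_self := hF.gr_lie_self
  leibniz_lie a b c := by
    have key : ⁅⁅a, b⁆, c⁆ + ⁅⁅b, c⁆, a⁆ + ⁅⁅c, a⁆, b⁆ = 0 := by
      induction a using Gr.induction with
      | zero => simp [gr_lie_zero, gr_zero_lie]
      | add a a' ha ha' =>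
        simp only [gr_add_lie, gr_lie_add]
        calc _ = (⁅⁅a, b⁆, c⁆ + ⁅⁅b, c⁆, a⁆ + ⁅⁅c, a⁆, b⁆)
              + (⁅⁅a', b⁆, c⁆ + ⁅⁅b, c⁆, a'⁆ + ⁅⁅c, a'⁆, b⁆) := by abel
          _ = 0 := by rw [ha, ha', add_zero]
      | symb i x =>
        induction b using Gr.induction with
        | zero => simp [gr_lie_zero, gr_zero_lie]
        | add b b' hb hb' =>
          simp only [gr_add_lie, gr_lie_add]
          generalize hF.symb i x = a at *
          calc _ = (⁅⁅a, b⁆, c⁆ + ⁅⁅b, c⁆, a⁆ + ⁅⁅c, a⁆, b⁆)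
                + (⁅⁅a, b'⁆, c⁆ + ⁅⁅b', c⁆, a⁆ + ⁅⁅c, a⁆, b'⁆) := by abel
            _ = 0 := by rw [hb, hb', add_zero]
        | symb j y =>
          induction c using Gr.induction with
          | zero => simp [gr_lie_zero, gr_zero_lie]
          | add c c' hc hc' =>
            simp only [gr_add_lie, gr_lie_add]
            generalize hF.symb i x = a at *
            generalize hF.symb j y = b at *
            calc _ = (⁅⁅a, b⁆, c⁆ + ⁅⁅b, c⁆, a⁆ + ⁅⁅c, a⁆, b⁆)
                  + (⁅⁅a, b⁆, c'⁆ + ⁅⁅b, c'⁆, a⁆ + ⁅⁅c', a⁆, b⁆) := by abel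
              _ = 0 := by rw [hc, hc', add_zero]
          | symb k z => exact hF.gr_jacobi_symb x y z
    rw [hF.gr_skew a ⁅b, c⁆, hF.gr_skew b ⁅a, c⁆, hF.gr_skew a c, hF.gr_neg_lie, neg_neg]
    rw [← sub_eq_zero, ← neg_eq_zero, ← key]
    abel

/-- The operator `ε` of `gr`: on symbols it is the symbol of the `p`-th power. -/
noncomputable def grEps : hF.Gr →+ hF.Gr :=
  hF.liftGr (fun i x => hF.symb (i + hF.step) (hF.ppow x))
    (fun i x y => by
      rw [← symb_mul]
      symm
      exact hF.symb_eq_of_mem _ (hF.mul_pow i.pos x.2 y.2))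
    (fun i x hx => by
      refine hF.symb_eq_zero _ ?_
      have := hF.pow_mem (by omega) hx
      simp only [ppow, PNat.add_coe, step_coe]
      convert this using 2
      omega)

lemma grEps_symb {i : ℕ+} (x : F i) :
    hF.grEps (hF.symb i x) = hF.symb (i + hF.step) (hF.ppow x) := by
  simp [grEps]

lemma grEps_lie (a b : hF.Gr) : ⁅hF.grEps a, b⁆ = hF.grEps ⁅a, b⁆ := by
  induction a using Gr.induction with
  | zero => simp
  | add a a' ha ha' => rw [map_add, add_lie, ha, ha', add_lie, map_add]
  | symb i x =>
    induction b using Gr.induction with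
    | zero => simp
    | add b b' hb hb' => rw [lie_add, hb, hb', lie_add, map_add]
    | symb j y =>
      rw [grEps_symb, bracket_symb, bracket_symb, grEps_symb]
      have hm : i + j + hF.step = i + hF.step + j := add_right_comm _ _ _
      rw [hF.symb_congr hm (y := ⟨_, hm ▸ (hF.ppow (hF.comm x y)).2⟩) rfl]
      symm
      refine hF.symb_eq_of_mem _ ?_
      have h1 : ((i + hF.step + j : ℕ+) : ℕ) + 1 = i + j + h + 1 := by
        simp only [PNat.add_coe, step_coe]
        omega
      have h2 := hF.pow_lie i.pos j.pos x.2 y.2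
      rw [← h1] at h2
      exact h2

lemma nsmul_gr (a : hF.Gr) : p • a = 0 := by
  induction a using Gr.induction with
  | zero => simp
  | add a b ha hb => rw [smul_add, ha, hb, add_zero]
  | symb i x =>
    rw [← symb_pow]
    refine hF.symb_eq_zero _ ?_
    have := hF.pos
    exact hF.anti (by omega) (hF.pow_mem i.pos x.2)

noncomputable instance : Module (ZMod p) hF.Gr := AddCommGroup.zmodModule hF.nsmul_gr

/-- `ε` as an `𝔽_p`-linear endomorphism of `gr`. -/
noncomputable def eps : Module.End (ZMod p) hF.Gr := hF.grEps.toZModLinearMap p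

/-- `gr` is a module over `𝔽_p[ε]`; the indeterminate acts as the operator `ε`. -/
noncomputable instance : Module (ZMod p)[X] hF.Gr :=
  Module.compHom hF.Gr (aeval (R := ZMod p) hF.eps).toRingHom

lemma poly_smul_def (f : (ZMod p)[X]) (a : hF.Gr) : f • a = aeval hF.eps f a := rfl

noncomputable instance : LieAlgebra (ZMod p)[X] hF.Gr where
  lie_smul f a b := by
    have hz : ∀ (c : ZMod p) (a b : hF.Gr), ⁅a, c • b⁆ = c • ⁅a, b⁆ := fun c a b =>
      (AddMonoidHom.toZModLinearMap p (hF.grBracket a)).map_smul c b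
    have he : ∀ a b : hF.Gr, ⁅a, hF.eps b⁆ = hF.eps ⁅a, b⁆ := by
      intro a b
      have := hF.grEps_lie b a
      change ⁅a, hF.grEps b⁆ = hF.grEps ⁅a, b⁆
      rw [← lie_skew, this, ← lie_skew a b, map_neg]
    simp only [poly_smul_def]
    induction f using Polynomial.induction_on' with
    | add f g hf hg => simp [hf, hg]
    | monomial n c =>
      have hn : ∀ (n : ℕ) (b : hF.Gr), ⁅a, (hF.eps ^ n) b⁆ = (hF.eps ^ n) ⁅a, b⁆ := by
        intro n
        induction n with
        | zero => simp
        | succ n ih => intro b; rw [pow_succ, Module.End.mul_apply, ih, he, Module.End.mul_apply]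
      simp [aeval_monomial, Module.algebraMap_end_apply, hz, hn]

end IsPValuedFiltration

section ModEps

/-- `𝔽_p` as an `𝔽_p[ε]`-algebra, via `ε ↦ 0`. -/
noncomputable abbrev evalZeroAlgebra (p : ℕ) : Algebra (ZMod p)[X] (ZMod p) :=
  (evalRingHom (0 : ZMod p)).toAlgebra

attribute [local instance] evalZeroAlgebra

namespace IsPValuedFiltration

variable {p h : ℕ} {F : ℕ → Subgroup Γ} (hF : IsPValuedFiltration p h F)

/-- The `𝔽_p`-Lie algebra `gr ⊗_{𝔽_p[ε]} 𝔽_p`, where `ε` acts by zero on `𝔽_p`. -/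
def GrModEps : Type _ := ZMod p ⊗[(ZMod p)[X]] hF.Gr

noncomputable instance : LieRing hF.GrModEps :=
  inferInstanceAs (LieRing (ZMod p ⊗[(ZMod p)[X]] hF.Gr))

noncomputable instance : LieAlgebra (ZMod p) hF.GrModEps :=
  inferInstanceAs (LieAlgebra (ZMod p) (ZMod p ⊗[(ZMod p)[X]] hF.Gr))

end IsPValuedFiltration

end ModEps

end Filtered

/-! ## Semidirect products with an abelian ideal -/

section Semidirect

/-- A module `M`, regarded as an abelian Lie algebra. -/
def AbelianLie (M : Type*) : Type _ := M

variable (R L M : Type*) [CommRing R] [LieRing L] [LieAlgebra R L]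
  [AddCommGroup M] [Module R M] [LieRingModule L M] [LieModule R L M]

noncomputable instance : AddCommGroup (AbelianLie M) := inferInstanceAs (AddCommGroup M)

noncomputable instance : Module R (AbelianLie M) := inferInstanceAs (Module R M)

noncomputable instance : LieRing (AbelianLie M) where
  bracket _ _ := 0
  add_lie _ _ _ := (add_zero _).symm
  lie_add _ _ _ := (add_zero _).symm
  lie_self _ := rfl
  leibniz_lie _ _ _ := (add_zero _).symm

noncomputable instance : LieAlgebra R (AbelianLie M) where
  lie_smul _ _ _ := (smul_zero _).symm

/-- The representation `L → End M`, as a homomorphism to the derivations of the abelian Lie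
algebra `M`. -/
noncomputable def derivationHom :
    L →ₗ⁅R⁆ LieDerivation R (AbelianLie M) (AbelianLie M) where
  toFun x :=
    { toLinearMap := (LieModule.toEnd R L M x : M →ₗ[R] M)
      leibniz' := fun _ _ => by
        change LieModule.toEnd R L M x (0 : M) = (0 : M) - 0
        simp }
  map_add' x y := LieDerivation.ext fun m : M => add_lie x y m
  map_smul' c x := LieDerivation.ext fun m : M => smul_lie c x m
  map_lie' {x y} := LieDerivation.ext fun m : M => lie_lie x y m

/-- The semidirect product `L ⋉ M`, in which `[x, m] = x.m` for `x ∈ L` and `m ∈ M`. -/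
abbrev LieSemidirect : Type _ :=
  LieAlgebra.SemiDirectSum (AbelianLie M) L (derivationHom R L M)

end Semidirect

/-! ## Unramified `p`-adic fields -/

section LocalField

variable (p : ℕ) [Fact p.Prime] (K : Type*) [Field K] [Algebra ℤ_[p] K]

/-- The ramification index of `K / ℚ_p` is one: the maximal ideal of `𝒪_K` is generated by `p`.
Here `𝒪_K = integralClosure ℤ_[p] K`. -/
def IsUnramifiedOverQp : Prop :=
  (Ideal.span {(p : integralClosure ℤ_[p] K)}).IsMaximal

/-- The residue field `k = 𝒪_K / (p)` (when `e = 1`). -/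
abbrev ResField : Type _ :=
  integralClosure ℤ_[p] K ⧸ Ideal.span {(p : integralClosure ℤ_[p] K)}

noncomputable instance : Algebra (ZMod p) (ResField p K) :=
  ((Ideal.Quotient.lift (Ideal.span {(p : ℤ)}) (Int.castRingHom (ResField p K)) (by
      intro a ha
      obtain ⟨b, rfl⟩ := Ideal.mem_span_singleton'.mp ha
      have : (p : ResField p K) = 0 := by
        have h := Ideal.Quotient.eq_zero_iff_mem.mpr
          (Ideal.mem_span_singleton_self (p : integralClosure ℤ_[p] K))
        rwa [map_natCast] at h
      simp [this])).comp
    (Int.quotientSpanNatEquivZMod p).symm.toRingHom).toAlgebra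

variable {K} in
/-- `v x ≥ q`, where `v` is the normalized valuation of `K` (so `v p = 1` when `e = 1`, and
`v 0 = ∞`), for rational `q`. -/
def ValGE (x : K) (q : ℚ) : Prop :=
  ∃ n : ℤ, q ≤ n ∧ ∃ a ∈ integralClosure ℤ_[p] K, x = (p : K) ^ n * a

end LocalField

/-! ## Chevalley systems and Chevalley groups -/

section Chevalley

open LieAlgebra LieAlgebra.IsKilling LieModule

variable {K : Type*} [Field K] [CharZero K]
  {g : Type*} [LieRing g] [LieAlgebra K g] [FiniteDimensional K g] [LieAlgebra.IsSimple K g]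
  {H : LieSubalgebra K g} [H.IsCartanSubalgebra] [IsTriangularizable K H g]

/-- `(X_α)` is a Chevalley system of the split simple Lie algebra `g` with respect to the splitting
Cartan subalgebra `H`: `X_α` is a root vector, `[X_α, X_{-α}] = H_α` is the coroot, and
`[X_α, X_β] = ± (r + 1) X_{α + β}` if `α`, `β`, `α + β` are roots, `r` being the largest
integer such that `β - r α` is a root. -/
structure IsChevalleySystem (X : H.root → g) : Prop where
  mem_rootSpace : ∀ α : H.root, X α ∈ rootSpace H (α : Weight K H g)
  lie_neg : ∀ α β : H.root, (rootSystem H).root β = - (rootSystem H).root α →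
    ⁅X α, X β⁆ = ((rootSystem H).coroot α : g)
  lie_add : ∀ α β γ : H.root,
    (rootSystem H).root γ = (rootSystem H).root α + (rootSystem H).root β →
    ∃ N : ℤ, |N| = (rootSystem H).chainBotCoeff α β + 1 ∧ ⁅X α, X β⁆ = N • X γ

/-- The Coxeter number `h = ht(α_max) + 1`. -/
noncomputable def coxeterNumber (b : (rootSystem H).Base) : ℕ :=
  (Finset.univ.sup fun α : H.root => (b.height α).toNat) + 1

lemma lie_mem_span_of_forall {R L : Type*} [CommRing R] [LieRing L] [LieAlgebra R L] {S : Set L}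
    (h : ∀ x ∈ S, ∀ y ∈ S, ⁅x, y⁆ ∈ Submodule.span R S) {x y : L}
    (hx : x ∈ Submodule.span R S) (hy : y ∈ Submodule.span R S) :
    ⁅x, y⁆ ∈ Submodule.span R S := by
  refine Submodule.span_induction₂ (p := fun x y _ _ => ⁅x, y⁆ ∈ Submodule.span R S)
    ?_ ?_ ?_ ?_ ?_ ?_ ?_ hx hy
  · intro x y hx hy; exact h x hx y hy
  · intro y _; rw [zero_lie]; exact zero_mem _
  · intro x _; rw [lie_zero]; exact zero_mem _
  · intro x y z _ _ _ h1 h2; rw [add_lie]; exact add_mem h1 h2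
  · intro x y z _ _ _ h1 h2; rw [lie_add]; exact add_mem h1 h2
  · intro c x y _ _ h; rw [smul_lie]; exact Submodule.smul_mem _ _ h
  · intro c x y _ _ h; rw [lie_smul]; exact Submodule.smul_mem _ _ h

namespace IsChevalleySystem

variable {X : H.root → g} (hX : IsChevalleySystem X)

lemma lie_eq_zero (hX : IsChevalleySystem X) {α β : H.root} (h0 : (rootSystem H).root β ≠ - (rootSystem H).root α)
    (h1 : ∀ γ, (rootSystem H).root γ ≠ (rootSystem H).root α + (rootSystem H).root β) :
    ⁅X α, X β⁆ = 0 := by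
  have hmem := lie_mem_genWeightSpace_of_mem_genWeightSpace (hX.mem_rootSpace α)
    (hX.mem_rootSpace β)
  by_contra hne
  let χ : Weight K H g := ⟨((α : Weight K H g) : H → K) + (β : Weight K H g), fun hbot => hne (by
    rw [hbot] at hmem
    simpa using hmem)⟩
  have hχ : χ.IsNonZero := by
    intro hz
    apply h0
    rw [eq_neg_iff_add_eq_zero, add_comm]
    ext x
    exact congrFun hz x
  exact h1 ⟨χ, by simpa using hχ⟩ (by ext x; rfl)

lemma lie_mem_span (hX : IsChevalleySystem X) (α β : H.root) :
    ⁅X α, X β⁆ ∈ Submodule.span ℤ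
      (Set.range X ∪ Set.range fun α => ((rootSystem H).coroot α : g)) := by
  by_cases h0 : (rootSystem H).root β = - (rootSystem H).root α
  · rw [hX.lie_neg α β h0]
    exact Submodule.subset_span (Or.inr ⟨α, rfl⟩)
  by_cases h1 : ∃ γ, (rootSystem H).root γ = (rootSystem H).root α + (rootSystem H).root β
  · obtain ⟨γ, hγ⟩ := h1
    obtain ⟨N, -, hN⟩ := hX.lie_add α β γ hγ
    rw [hN]
    exact Submodule.smul_mem _ _ (Submodule.subset_span (Or.inl ⟨γ, rfl⟩))
  · push Not at h1
    rw [hX.lie_eq_zero h0 h1]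
    exact zero_mem _

lemma coroot_lie (hX : IsChevalleySystem X) (α β : H.root) :
    ⁅((rootSystem H).coroot α : g), X β⁆ = (rootSystem H).pairingIn ℤ β α • X β := by
  have h1 : ⁅(rootSystem H).coroot α, X β⁆
      = (β : Weight K H g) ((rootSystem H).coroot α) • X β :=
    lie_eq_smul_of_mem_rootSpace (hX.mem_rootSpace β) _
  have h2 : (((rootSystem H).pairingIn ℤ β α : ℤ) : K)
      = (β : Weight K H g) ((rootSystem H).coroot α) :=
    (rootSystem H).algebraMap_pairingIn ℤ β α
  rw [← Int.cast_smul_eq_zsmul K, h2]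
  exact h1

/-- The integral form `g_ℤ`: the `ℤ`-span of the Chevalley basis, i.e. of the `X_α` and the
`H_α`. -/
def intForm (hX : IsChevalleySystem X) : LieSubalgebra ℤ g where
  __ := Submodule.span ℤ (Set.range X ∪ Set.range fun α => ((rootSystem H).coroot α : g))
  lie_mem' {x y} hx hy := by
    refine lie_mem_span_of_forall ?_ hx hy
    rintro _ (⟨α, rfl⟩ | ⟨α, rfl⟩) _ (⟨β, rfl⟩ | ⟨β, rfl⟩)
    · exact hX.lie_mem_span α β
    · rw [← lie_skew]
      dsimp only
      rw [hX.coroot_lie]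
      exact neg_mem (Submodule.smul_mem _ _ (Submodule.subset_span (Or.inl ⟨α, rfl⟩)))
    · dsimp only
      rw [hX.coroot_lie]
      exact Submodule.smul_mem _ _ (Submodule.subset_span (Or.inl ⟨β, rfl⟩))
    · have : ⁅(rootSystem H).coroot α, (rootSystem H).coroot β⁆ = 0 := trivial_lie_zero _ _ _ _
      dsimp only
      rw [← LieSubalgebra.coe_bracket, this]
      exact zero_mem _

/-- The integral form `n_ℤ ⊆ g_ℤ` of the nilpotent radical of the Borel subalgebra given by the
base `b`: the `ℤ`-span of the `X_α` with `α` positive. -/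
def intNilradical (hX : IsChevalleySystem X) (b : (rootSystem H).Base) :
    LieSubalgebra ℤ hX.intForm where
  __ := (Submodule.span ℤ (X '' {α | 0 < b.height α})).comap hX.intForm.toSubmodule.subtype
  lie_mem' {x y} hx hy := by
    change ⁅(x : g), (y : g)⁆ ∈ Submodule.span ℤ (X '' {α | 0 < b.height α})
    refine lie_mem_span_of_forall ?_ hx hy
    rintro _ ⟨α, hα, rfl⟩ _ ⟨β, hβ, rfl⟩
    by_cases h0 : (rootSystem H).root β = - (rootSystem H).root α
    · exfalso
      have h2 : (rootSystem H).root β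
          = (rootSystem H).root α + (-2 : ℤ) • (rootSystem H).root α := by
        rw [h0]
        module
      have := b.height_add_zsmul h2
      simp only [Set.mem_ofPred_eq, smul_eq_mul] at hα hβ this
      omega
    by_cases h1 : ∃ γ, (rootSystem H).root γ = (rootSystem H).root α + (rootSystem H).root β
    · obtain ⟨γ, hγ⟩ := h1
      obtain ⟨N, -, hN⟩ := hX.lie_add α β γ hγ
      rw [hN]
      refine Submodule.smul_mem _ _ (Submodule.subset_span ⟨γ, ?_, rfl⟩)
      have := b.height_add hγ
      simp only [Set.mem_ofPred_eq] at hα hβ ⊢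
      omega
    · push Not at h1
      rw [hX.lie_eq_zero h0 h1]
      exact zero_mem _

/-- `g_k = k ⊗ g_ℤ`. -/
abbrev overRing (hX : IsChevalleySystem X) (k : Type*) [CommRing k] : Type _ :=
  k ⊗[ℤ] hX.intForm

/-- `n_k ⊆ g_k`, the image of `k ⊗ n_ℤ`. -/
noncomputable def nilradical (hX : IsChevalleySystem X) (b : (rootSystem H).Base)
    (k : Type*) [CommRing k] : LieSubalgebra k (hX.overRing k) :=
  { (hX.intNilradical b).toSubmodule.baseChange k with
    lie_mem' := by
      intro x y hx hy
      change x ∈ (hX.intNilradical b).toSubmodule.baseChange k at hx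
      change y ∈ (hX.intNilradical b).toSubmodule.baseChange k at hy
      change ⁅x, y⁆ ∈ (hX.intNilradical b).toSubmodule.baseChange k
      rw [Submodule.baseChange_eq_span] at hx hy ⊢
      refine lie_mem_span_of_forall ?_ hx hy
      rintro _ ⟨x, hx, rfl⟩ _ ⟨y, hy, rfl⟩
      refine Submodule.subset_span ⟨⁅x, y⁆, (hX.intNilradical b).lie_mem hx hy, ?_⟩
      simp }

/-- The `k`-Lie algebra `n_k ⋉ (g_k / n_k)`, where `n_k` acts on `g_k / n_k` through the adjoint
representation. -/
abbrev nilSemidirect (hX : IsChevalleySystem X) (b : (rootSystem H).Base)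
    (k : Type*) [CommRing k] : Type _ :=
  LieSemidirect k (hX.nilradical b k) (hX.overRing k ⧸ (hX.nilradical b k).toLieSubmodule)

end IsChevalleySystem

/-! ### The group -/

section Group

variable (H) (V : Type*) [AddCommGroup V] [Module K V] [LieRingModule g V] [LieModule K g V]

/-- The character lattice `X^*(T)` of the maximal torus `T` (with Lie algebra `H`) of the Chevalley
group acting on `V`: the group generated by the weights of `V`. -/
def charLattice : AddSubgroup (Module.Dual K H) :=
  AddSubgroup.closure {μ | weightSpace V (μ : H → K) ≠ ⊥}

/-- The weight lattice, i.e. the dual of the coroot lattice. -/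
def weightLattice : AddSubgroup (Module.Dual K H) where
  carrier := {μ | ∀ α : H.root, ∃ n : ℤ, μ ((rootSystem H).coroot α) = n}
  zero_mem' _ := ⟨0, by simp⟩
  add_mem' {μ ν} hμ hν α := by
    obtain ⟨m, hm⟩ := hμ α
    obtain ⟨n, hn⟩ := hν α
    exact ⟨m + n, by rw [LinearMap.add_apply, hm, hn, Int.cast_add]⟩
  neg_mem' {μ} hμ α := by
    obtain ⟨m, hm⟩ := hμ α
    exact ⟨-m, by rw [LinearMap.neg_apply, hm, Int.cast_neg]⟩

/-- The Chevalley group acting on `V` is simply connected: `X^*(T)` is the whole weight lattice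
(equivalently, the coroots generate `X_*(T)`). -/
def IsOfSimplyConnectedType : Prop := charLattice H V = weightLattice H

variable {H}

/-- The element `t ∈ T(K) = Hom(X^*(T), Kˣ)` acts on `V` as `s`: it acts on the weight space of
weight `μ` as the scalar `μ(t)`. -/
def IsTorusElement (t : Multiplicative (charLattice H V) →* Kˣ)
    (s : LinearMap.GeneralLinearGroup K V) : Prop :=
  ∀ (μ : charLattice H V), ∀ v ∈ weightSpace V ((μ : Module.Dual K H) : H → K),
    (s : Module.End K V) v = (t (Multiplicative.ofAdd μ) : K) • v

/-- The action of `u_α(z)` on `V`, where `u_α : 𝔾_a → U_α` is the root subgroup with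
`du_α(1) = X_α`: it is `exp(z X_α)`, a finite sum because `X_α` acts nilpotently. -/
noncomputable def rootElement (X : H.root → g) (α : H.root) (z : K) : Module.End K V :=
  ∑ n ∈ Finset.range (Module.finrank K V + 1),
    (n.factorial : K)⁻¹ • (LieModule.toEnd K g V (z • X α)) ^ n

/-- The group `G(K)` of `K`-points of the Chevalley group acting on `V`, generated by the points of
the torus `T` and of the root subgroups `U_α`. Every split almost-simple simply connected group `G`
over `K` is of this form, with `g = Lie(G)` and `V` any faithful representation of `G`; `V` is of
simply connected type in the sense above, since the weights of a faithful representation generate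
`X^*(T)`. -/
def chevalleyGroup (X : H.root → g) : Subgroup (LinearMap.GeneralLinearGroup K V) :=
  Subgroup.closure ({s | ∃ t : Multiplicative (charLattice H V) →* Kˣ, IsTorusElement V t s} ∪
    {s | ∃ (α : H.root) (z : K), (s : Module.End K V) = rootElement V X α z})

/-- The Moy-Prasad group `G_{x, i/h}` attached to the barycentre `x` of the base alcove, so that
`α(x) = ht(α) / h`. It is generated by
`T(K)_{i/h} = {t | v (χ(t) - 1) ≥ i/h for all χ ∈ X^*(T)}` and by
`U_{α, x, i/h} = {u_α(z) | v z + ht(α) / h ≥ i/h}` for all roots `α`. -/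
def moyPrasad (p : ℕ) [Fact p.Prime] [Algebra ℤ_[p] K] (X : H.root → g)
    (b : (rootSystem H).Base) (i : ℕ) : Subgroup (chevalleyGroup V X) :=
  Subgroup.closure
    ({s | ∃ t : Multiplicative (charLattice H V) →* Kˣ, IsTorusElement V t s.1 ∧
        ∀ χ, ValGE p ((t χ : K) - 1) ((i : ℚ) / coxeterNumber b)} ∪
      {s | ∃ (α : H.root) (z : K), (s.1 : Module.End K V) = rootElement V X α z ∧
        ValGE p z ((i : ℚ) / coxeterNumber b - (b.height α : ℚ) / coxeterNumber b)})

end Group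

end Chevalley

set_option linter.unusedSectionVars false

/-! The whole computation takes place inside `End V`. Because e = 1, the ring of integers is a
principal ideal domain whose only maximal ideal is (p), and V has a basis of weight vectors in which
all root vectors have integral entries (`exists_integral_weightBasis`). Scale the valuation of K so
that p has degree h, and give the weight vectors degrees that change by ht(α) along a root α. The
resulting filtration `endFil` of End V, written A_m in the comments below, is multiplicative,
separated and complete, and multiplication by p raises degrees by exactly h. On the image of g it
induces the expected filtration: a combination of the Chevalley basis lies in A_m exactly when each
of its terms does (`mem_coordFil_of_actionMap_mem`). This is where simple connectedness and p > 2
are used.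

The central claim is that G_{x,N/h} consists of the s in I_1 with s - 1 in A_N (`mem_closure_iff`).
The generators are exponentials of elements of g of positive degree, which converge because h < p -
1. The point is that the leading term of any element of I_1 lies in g
(`exists_sub_mem_of_mem_expGroup`). In place of the Baker-Campbell-Hausdorff series one uses
products f of formal exponentials exp(w X^n) with w in g: the logarithmic derivative X f' f⁻¹ has
coefficients in g (`exists_euler_formalCurves_eq`), hence so is the first nonvanishing coefficient
of f in positive degree. Ordered products of one-parameter elements realize every leading term, and
successive approximation proves the claim. For a congruence filtration the axioms of a p-valuation
are the binomial expansion of (1 + a)^p and the identity [s,t] - 1 = (st - ts) s⁻¹t⁻¹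
(`IsPadicFiltration.isPValuedFiltration`).

It follows that gr(I_1) in degree i is the quotient of g ∩ A_i by g ∩ A_{i+1}, with the bracket of
g, and that ε is multiplication by p. A Chevalley basis vector of degree d, where -h < d < h,
contributes a copy of k in each degree d + nh ≥ 1. Modulo ε only the copy with 1 ≤ d + nh ≤ h
survives: n = 0 if d > 0, which gives the part 𝔫, and n = 1 otherwise, which gives 𝔤/𝔫. A bracket
survives exactly when the exponents n add up, so two elements of the second part commute and the
first part acts by the adjoint action (`leadCoord_bracket`, `lie_semidirectOfCoord`). -/

/-! ## Fractional filtrations of a field -/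

/-- The properties of the filtration `P m = {x | h * v x ≥ m}` of a complete discretely valued
field with uniformizer `p`. -/
structure IsFracFiltration {K : Type*} [Field K] (p h : ℕ) (P : ℤ → AddSubgroup K) : Prop where
  anti : Antitone P
  one_mem : (1 : K) ∈ P 0
  mul_mem : ∀ {m n : ℤ} {x y : K}, x ∈ P m → y ∈ P n → x * y ∈ P (m + n)
  prime_mul_mem_iff : ∀ {m : ℤ} {x : K}, (p : K) * x ∈ P (m + h) ↔ x ∈ P m
  eq_zero_of_forall : ∀ x : K, (∀ m, x ∈ P m) → x = 0
  complete : ∀ (d : ℤ) (x : ℕ → K), (∀ n : ℕ, x (n + 1) - x n ∈ P (n - d)) →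
    ∃ y, ∀ n : ℕ, y - x n ∈ P (n - d)
  mem_of_coprime : ∀ {u : ℕ}, u.Coprime p → ∀ {m : ℤ} {x : K}, (u : K) * x ∈ P m → x ∈ P m

/-! ### The ring of integers of K and the filtration of K by fractional powers of p. -/

section Valuation

variable (p : ℕ) [Fact p.Prime] (K : Type*) [Field K] [CharZero K] [Algebra ℚ_[p] K]
  [FiniteDimensional ℚ_[p] K] [Algebra ℤ_[p] K] [IsScalarTower ℤ_[p] ℚ_[p] K]

instance finite_integralClosure : Module.Finite ℤ_[p] (integralClosure ℤ_[p] K) :=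
  IsIntegralClosure.finite ℤ_[p] ℚ_[p] K (integralClosure ℤ_[p] K)

instance isFractionRing_integralClosure : IsFractionRing (integralClosure ℤ_[p] K) K :=
  IsIntegralClosure.isFractionRing_of_finite_extension ℤ_[p] ℚ_[p] K (integralClosure ℤ_[p] K)

instance isNoetherianRing_integralClosure : IsNoetherianRing (integralClosure ℤ_[p] K) :=
  IsNoetherianRing.of_finite ℤ_[p] (integralClosure ℤ_[p] K)

variable {K}

/-- By integrality a maximal ideal of 𝒪_K contracts to a maximal ideal of the local ring ℤ_p, whose
maximal ideal is generated by p. -/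
lemma natCast_prime_mem_of_isMaximal (I : Ideal (integralClosure ℤ_[p] K)) (hI : I.IsMaximal) :
    (p : integralClosure ℤ_[p] K) ∈ I := by
  have := Ideal.isMaximal_comap_of_isIntegral_of_isMaximal (R := ℤ_[p]) I
  have h1 := IsLocalRing.eq_maximalIdeal this
  have h2 : (p : ℤ_[p]) ∈ I.comap (algebraMap ℤ_[p] (integralClosure ℤ_[p] K)) := by
    rw [h1, PadicInt.maximalIdeal_eq_span_p]
    exact Ideal.mem_span_singleton_self _
  simpa using h2

lemma exists_limit_integralClosure (x : ℕ → integralClosure ℤ_[p] K)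
    (hx : ∀ n, ∃ a, x (n + 1) - x n = p ^ n * a) :
    ∃ y, ∀ n, ∃ a, y - x n = p ^ n * a := by
  -- 𝒪_K is finite and torsion-free over ℤ_p, hence free, so p-adic completeness can be checked on
  -- coordinates in ℤ_p.
  have : Module.Free ℤ_[p] (integralClosure ℤ_[p] K) := by
    have : Module.IsTorsionFree ℤ_[p] K := Module.IsTorsionFree.trans_faithfulSMul ℤ_[p] ℚ_[p] K
    exact IsIntegralClosure.module_free ℤ_[p] ℚ_[p] K (integralClosure ℤ_[p] K)
  let b := Module.Free.chooseBasis ℤ_[p] (integralClosure ℤ_[p] K)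
  have hsmul : ∀ (n : ℕ) (a : integralClosure ℤ_[p] K),
      (p : integralClosure ℤ_[p] K) ^ n * a = ((p : ℤ_[p]) ^ n) • a := by
    intro n a
    rw [Algebra.smul_def]
    simp
  have hc : ∀ i, ∃ L : ℤ_[p], ∀ n, ∃ c, L - b.repr (x n) i = p ^ n * c := by
    intro i
    have hmod : ∀ {m n : ℕ}, m ≤ n → b.repr (x m) i ≡ b.repr (x n) i
        [SMOD (Ideal.span {(p : ℤ_[p])}) ^ m • (⊤ : Submodule ℤ_[p] ℤ_[p])] := by
      intro m n hmn
      rw [SModEq.comm, SModEq.sub_mem, smul_eq_mul, Ideal.mul_top, Ideal.span_singleton_pow,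
        Ideal.mem_span_singleton]
      induction n, hmn using Nat.le_induction with
      | base => simp
      | succ n hmn ih =>
        obtain ⟨a, ha⟩ := hx n
        have : b.repr (x (n + 1)) i - b.repr (x m) i
            = p ^ n * b.repr a i + (b.repr (x n) i - b.repr (x m) i) := by
          have := congrArg (fun z => b.repr z i) ha
          simp only [map_sub, Finsupp.sub_apply, hsmul, map_smul, Finsupp.smul_apply,
            smul_eq_mul] at this
          rw [← this]; ring
        rw [this]
        exact dvd_add (Dvd.dvd.mul_right (pow_dvd_pow _ hmn) _) ih
    have hI : IsAdicComplete (Ideal.span {(p : ℤ_[p])}) ℤ_[p] := by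
      rw [← PadicInt.maximalIdeal_eq_span_p]; infer_instance
    obtain ⟨L, hL⟩ := IsPrecomplete.prec hI.toIsPrecomplete hmod
    refine ⟨L, fun n => ?_⟩
    have := (hL n).symm
    rw [SModEq.sub_mem, smul_eq_mul, Ideal.mul_top, Ideal.span_singleton_pow,
        Ideal.mem_span_singleton] at this
    exact this
  choose L hL using hc
  choose c hc using hL
  refine ⟨∑ i, L i • b i, fun n => ⟨∑ i, c i n • b i, ?_⟩⟩
  rw [hsmul, Finset.smul_sum]
  nth_rw 1 [← b.sum_repr (x n)]
  rw [← Finset.sum_sub_distrib]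
  refine Finset.sum_congr rfl fun i _ => ?_
  rw [← sub_smul, hc, mul_smul]

variable (K) in
/-- The subgroup `{x | h * v x ≥ m}` of `K`. -/
def fracPow (h : ℕ) (m : ℤ) : AddSubgroup K where
  -- Integer division rounds down when h > 0, so the exponent is the ceiling of m/h.
  carrier := {x | ∃ a ∈ integralClosure ℤ_[p] K, x = (p : K) ^ (-((-m) / (h : ℤ))) * a}
  zero_mem' := ⟨0, zero_mem _, by simp⟩
  add_mem' := by
    rintro x y ⟨a, ha, rfl⟩ ⟨a', ha', rfl⟩
    exact ⟨a + a', add_mem ha ha', by ring⟩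
  neg_mem' := by
    rintro x ⟨a, ha, rfl⟩
    exact ⟨-a, neg_mem ha, by ring⟩

lemma mem_fracPow {h : ℕ} {m : ℤ} {x : K} : x ∈ fracPow p K h m ↔
    ∃ a ∈ integralClosure ℤ_[p] K, x = (p : K) ^ (-((-m) / (h : ℤ))) * a := Iff.rfl

lemma natCast_prime_ne_zero : (p : K) ≠ 0 := Nat.cast_ne_zero.mpr (Fact.out : p.Prime).ne_zero

lemma mem_fracPow_iff {h : ℕ} (hh : 0 < h) {m : ℤ} {x : K} : x ∈ fracPow p K h m ↔
    ∃ n : ℤ, m ≤ n * h ∧ ∃ a ∈ integralClosure ℤ_[p] K, x = (p : K) ^ n * a := by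
  have hh' : (0 : ℤ) < h := by exact_mod_cast hh
  constructor
  · rintro ⟨a, ha, rfl⟩
    refine ⟨_, ?_, a, ha, rfl⟩
    have := Int.ediv_mul_le (-m) hh'.ne'
    linarith
  · rintro ⟨n, hn, a, ha, rfl⟩
    have h1 : -n ≤ (-m) / (h : ℤ) := (Int.le_ediv_iff_mul_le hh').mpr (by linarith)
    obtain ⟨k, hk⟩ := Int.eq_ofNat_of_zero_le (sub_nonneg.mpr h1)
    refine ⟨p ^ k * a, mul_mem (pow_mem (natCast_mem _ p) _) ha, ?_⟩
    rw [← mul_assoc, ← zpow_natCast, ← zpow_add₀ (natCast_prime_ne_zero p), ← hk]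
    congr 2
    ring

lemma mem_fracPow_mul_iff {h : ℕ} (hh : 0 < h) {n : ℤ} {x : K} : x ∈ fracPow p K h (n * h) ↔
    ∃ a ∈ integralClosure ℤ_[p] K, x = (p : K) ^ n * a := by
  have hh' : (h : ℤ) ≠ 0 := by exact_mod_cast hh.ne'
  rw [mem_fracPow, ← neg_mul, Int.mul_ediv_cancel _ hh', neg_neg]

lemma valGE_div_iff {h : ℕ} (hh : 0 < h) {m : ℤ} {x : K} :
    ValGE p x ((m : ℚ) / h) ↔ x ∈ fracPow p K h m := by
  rw [mem_fracPow_iff p hh]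
  have hh' : (0 : ℚ) < h := by exact_mod_cast hh
  refine exists_congr fun n => and_congr_left fun _ => ?_
  rw [div_le_iff₀ hh']
  norm_cast

lemma sub_mem_of_forall_succ {A : Type*} [AddCommGroup A] {P : AddSubgroup A} {x : ℕ → A} {n m : ℕ}
    (hnm : n ≤ m) (hx : ∀ k, n ≤ k → k < m → x (k + 1) - x k ∈ P) : x m - x n ∈ P := by
  induction m, hnm using Nat.le_induction with
  | base => simp
  | succ m hnm ih =>
    rw [← sub_add_sub_cancel _ (x m)]
    exact add_mem (hx m hnm (Nat.lt_succ_self m)) (ih fun k h1 h2 => hx k h1 (by omega))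

lemma exists_limit_fracPow {h : ℕ} (hh : 0 < h) (d : ℤ) {x : ℕ → K}
    (hx : ∀ n : ℕ, x (n + 1) - x n ∈ fracPow p K h (n - d)) :
    ∃ y, ∀ n : ℕ, y - x n ∈ fracPow p K h (n - d) := by
  have hp := natCast_prime_ne_zero (K := K) p
  have hanti : ∀ {m n : ℤ}, m ≤ n → ∀ {x : K}, x ∈ fracPow p K h n → x ∈ fracPow p K h m := by
    intro m n hmn x hx
    rw [mem_fracPow_iff p hh] at hx ⊢
    obtain ⟨k, hk, a⟩ := hx
    exact ⟨k, hmn.trans hk, a⟩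
  have hle : ∀ n m : ℕ, n ≤ m → x m - x n ∈ fracPow p K h (n - d) := fun n m hnm =>
    sub_mem_of_forall_succ hnm fun k hk _ => hanti (by omega) (hx k)
  -- Along the indices h q + D the sequence, shifted by `x 0` and multiplied by p^D, is integral,
  -- and its consecutive differences are divisible by p^q. This reduces the claim to
  -- `exists_limit_integralClosure`.
  obtain ⟨D, hD⟩ : ∃ D : ℕ, D = d.natAbs := ⟨_, rfl⟩
  have hz : ∀ q, ∃ a : integralClosure ℤ_[p] K, x (h * q + D) - x 0 = (p : K) ^ (-D : ℤ) * a := by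
    intro q
    have h1 : -(D : ℤ) * h ≤ (0 : ℕ) - d := by
      have : (1 : ℤ) ≤ h := by exact_mod_cast hh
      push_cast
      have h2 : d ≤ D := by omega
      nlinarith
    obtain ⟨a, ha, h2⟩ := (mem_fracPow_mul_iff p hh).mp (hanti h1 (hle 0 (h * q + D) (by omega)))
    exact ⟨⟨a, ha⟩, h2⟩
  choose z hz using hz
  obtain ⟨y, hy⟩ := exists_limit_integralClosure p z (fun q => by
    have h1 : ((D + q : ℕ) : ℤ) * h ≤ (D : ℤ) * h + (((h * q + D : ℕ) : ℤ) - d) := by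
      push_cast
      have h2 : d ≤ D := by omega
      nlinarith
    have h2 := hle (h * q + D) (h * (q + 1) + D) (by gcongr; omega)
    have h3 : (p : K) ^ (D : ℤ) * (x (h * (q + 1) + D) - x (h * q + D)) ∈
        fracPow p K h ((D : ℤ) * h + (((h * q + D : ℕ) : ℤ) - d)) := by
      rw [mem_fracPow_iff p hh] at h2 ⊢
      obtain ⟨k, hk, a, ha, h4⟩ := h2
      refine ⟨D + k, by linarith, a, ha, ?_⟩
      rw [h4, zpow_add₀ hp, mul_assoc]
    obtain ⟨a, ha, h4⟩ := (mem_fracPow_mul_iff p hh).mp (hanti h1 h3)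
    refine ⟨p ^ D * ⟨a, ha⟩, Subtype.ext ?_⟩
    push_cast
    have h5 : (z (q + 1) : K) - z q = (p : K) ^ (D : ℤ) * (x (h * (q + 1) + D) - x (h * q + D)) := by
      rw [← sub_sub_sub_cancel_right (x _) (x _) (x 0), hz, hz, ← mul_sub, ← mul_assoc, ← zpow_add₀ hp]
      simp
    rw [h5, h4, zpow_natCast, pow_add]
    ring)
  refine ⟨x 0 + (p : K) ^ (-D : ℤ) * y, fun n => ?_⟩
  -- With q = n + 2D the error p^(q - D) of the limit has degree (n + D) h ≥ n - d, and the index h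
  -- q + D is at least n.
  obtain ⟨q, hq⟩ : ∃ q : ℕ, q = n + D + D := ⟨_, rfl⟩
  have hn : n ≤ h * q + D := by nlinarith
  rw [← sub_add_sub_cancel _ (x (h * q + D))]
  refine add_mem (hanti ?_ ((mem_fracPow_mul_iff p hh (n := (q : ℤ) - D)).mpr ?_)) (hle n _ hn)
  · have : (1 : ℤ) ≤ h := by exact_mod_cast hh
    have h2 : -d ≤ D := by omega
    have h3 : (q : ℤ) - D = n + D := by rw [hq]; push_cast; ring
    rw [h3]
    nlinarith
  · obtain ⟨a, ha⟩ := hy q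
    refine ⟨a, a.2, ?_⟩
    have h1 := congrArg Subtype.val ha
    push_cast at h1
    rw [add_sub_right_comm, ← neg_sub, hz, neg_add_eq_sub, ← mul_sub, h1, sub_eq_neg_add (q : ℤ),
      zpow_add₀ hp, zpow_natCast, mul_assoc]

/-! ### Consequences of ramification index one. -/

namespace IsUnramifiedOverQp

variable {p} (he : IsUnramifiedOverQp p K)
include he

lemma eq_span_of_isMaximal (I : Ideal (integralClosure ℤ_[p] K)) (hI : I.IsMaximal) :
    I = Ideal.span {(p : integralClosure ℤ_[p] K)} := by
  refine (Ideal.IsMaximal.eq_of_le he hI.ne_top ?_).symm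
  rw [Ideal.span_singleton_le_iff_mem]
  exact natCast_prime_mem_of_isMaximal p I hI

/-- Nonzero primes are maximal, hence equal to (p), and a ring whose prime ideals are all principal
is a principal ideal ring. This is what makes lattices in the weight spaces free. -/
lemma isPrincipalIdealRing : IsPrincipalIdealRing (integralClosure ℤ_[p] K) := by
  refine IsPrincipalIdealRing.of_prime fun P hP => ?_
  by_cases h : P = ⊥
  · rw [h]; exact bot_isPrincipal
  · rw [he.eq_span_of_isMaximal P (hP.isMaximal h)]
    exact ⟨⟨_, rfl⟩⟩

/-- The filtration by fractional powers of the valuation of `K`. -/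
lemma isFracFiltration {h : ℕ} (hh : 0 < h) : IsFracFiltration p h (fracPow p K h) where
  anti := by
    intro m n hmn x hx
    rw [mem_fracPow_iff p hh] at hx ⊢
    obtain ⟨k, hk, a⟩ := hx
    exact ⟨k, hmn.trans hk, a⟩
  one_mem := (mem_fracPow_iff p hh).mpr ⟨0, by simp, 1, one_mem _, by simp⟩
  mul_mem := by
    intro m n x y hx hy
    rw [mem_fracPow_iff p hh] at hx hy ⊢
    obtain ⟨k, hk, a, ha, rfl⟩ := hx
    obtain ⟨l, hl, a', ha', rfl⟩ := hy
    refine ⟨k + l, by linarith, a * a', mul_mem ha ha', ?_⟩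
    rw [zpow_add₀ (natCast_prime_ne_zero p)]; ring
  prime_mul_mem_iff := by
    intro m x
    have hp := natCast_prime_ne_zero (K := K) p
    rw [mem_fracPow_iff p hh, mem_fracPow_iff p hh]
    constructor
    · rintro ⟨k, hk, a, ha, hx⟩
      refine ⟨k - 1, by linarith, a, ha, ?_⟩
      rw [zpow_sub_one₀ hp]
      field_simp
      rw [mul_comm, hx]
    · rintro ⟨k, hk, a, ha, rfl⟩
      refine ⟨k + 1, by linarith, a, ha, ?_⟩
      rw [zpow_add_one₀ hp]; ring
  eq_zero_of_forall := by
    intro x hx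
    have hp := natCast_prime_ne_zero (K := K) p
    have h1 : ∀ n : ℕ, ∃ a ∈ integralClosure ℤ_[p] K, x = (p : K) ^ n * a := fun n => by
      have := (mem_fracPow_mul_iff p hh (n := n)).mp (hx _)
      simpa using this
    obtain ⟨a, ha, hxa⟩ := h1 0
    rw [pow_zero, one_mul] at hxa
    subst hxa
    have h2 : (⟨x, ha⟩ : integralClosure ℤ_[p] K)
        ∈ ⨅ i, (Ideal.span {(p : integralClosure ℤ_[p] K)}) ^ i := by
      rw [Ideal.mem_iInf]
      intro n
      obtain ⟨a, ha', hxa⟩ := h1 n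
      rw [Ideal.span_singleton_pow, Ideal.mem_span_singleton]
      exact ⟨⟨a, ha'⟩, Subtype.ext (by simpa using hxa)⟩
    rw [Ideal.iInf_pow_eq_bot_of_isDomain _ (Ideal.IsMaximal.ne_top he), Ideal.mem_bot] at h2
    exact congrArg Subtype.val h2
  complete d _ hx := exists_limit_fracPow p hh d hx
  mem_of_coprime := by
    intro u hu m x hx
    rw [mem_fracPow] at hx ⊢
    obtain ⟨a, ha, hxa⟩ := hx
    have hunit : IsUnit (u : integralClosure ℤ_[p] K) := by
      have h1 : IsUnit (u : ℤ_[p]) := by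
        rw [PadicInt.isUnit_iff, PadicInt.norm_natCast_eq_one_iff]
        exact hu.symm
      simpa using h1.map (algebraMap ℤ_[p] (integralClosure ℤ_[p] K))
    obtain ⟨v, hv⟩ := hunit.exists_left_inv
    have hv' : (v : K) * u = 1 := by simpa using congrArg Subtype.val hv
    refine ⟨v * a, mul_mem v.2 ha, ?_⟩
    rw [mul_left_comm, ← hxa, ← mul_assoc, hv', one_mul]

end IsUnramifiedOverQp

end Valuation

/-! ## Representations of `sl₂` -/

section Sl2

open Module

/-- Three endomorphisms of a vector space which satisfy the relations of `sl₂`. -/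
structure IsSl2Action {K V : Type*} [Field K] [AddCommGroup V] [Module K V]
    (e f h : Module.End K V) : Prop where
  h_mul_e : h * e = e * h + 2 • e
  h_mul_f : h * f = f * h - 2 • f
  e_mul_f : e * f = f * e + h

namespace IsSl2Action

variable {K V : Type*} [Field K] [CharZero K] [AddCommGroup V] [Module K V]
  [FiniteDimensional K V] {e f h : Module.End K V}

lemma symm (t : IsSl2Action e f h) : IsSl2Action f e (-h) where
  h_mul_e := by rw [neg_mul, t.h_mul_f]; simp [add_comm, sub_eq_add_neg]
  h_mul_f := by rw [neg_mul, t.h_mul_e]; simp [add_comm, sub_eq_add_neg]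
  e_mul_f := by rw [t.e_mul_f]; simp

lemma h_mul_e_pow (t : IsSl2Action e f h) (n : ℕ) : h * e ^ n = e ^ n * h + (2 * n) • e ^ n := by
  induction n with
  | zero => simp
  | succ n ih =>
    rw [pow_succ, ← mul_assoc, ih, add_mul, mul_assoc, t.h_mul_e, mul_add, ← mul_assoc,
      smul_mul_assoc, mul_smul_comm, add_assoc, ← add_smul]
    congr 2
    ring

lemma e_mul_f_pow (t : IsSl2Action e f h) (n : ℕ) :
    e * f ^ (n + 1) = f ^ (n + 1) * e + (n + 1) • (f ^ n * (h - (n : K) • 1)) := by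
  induction n with
  | zero => simpa using t.e_mul_f
  | succ n ih =>
    have h1 : h * f = f * h - (2 : K) • f := by rw [t.h_mul_f, ← Nat.cast_smul_eq_nsmul K]; simp
    rw [pow_succ f (n + 1), ← mul_assoc, ih, add_mul, mul_assoc, t.e_mul_f, smul_mul_assoc,
      mul_assoc, sub_mul, h1]
    simp only [mul_add, mul_sub, smul_mul_assoc, one_mul, mul_smul_comm, ← mul_assoc, mul_one,
      ← pow_succ, ← Nat.cast_smul_eq_nsmul K]
    push_cast
    module

/-- Each nonzero power e^n is an eigenvector of ad h with eigenvalue 2n, and an operator on a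
finite-dimensional space has finitely many eigenvalues. -/
lemma isNilpotent_e (t : IsSl2Action e f h) : IsNilpotent e := by
  by_contra hne
  have h0 : ∀ n, e ^ n ≠ 0 := fun n hn => hne ⟨n, hn⟩
  let A : Module.End K (Module.End K V) := LinearMap.mulLeft K h - LinearMap.mulRight K h
  have hA : ∀ n : ℕ, A.HasEigenvalue (2 * n : K) := fun n => by
    refine Module.End.hasEigenvalue_of_hasEigenvector (x := e ^ n) ⟨?_, h0 n⟩
    rw [Module.End.mem_eigenspace_iff]
    simp only [A, LinearMap.sub_apply, LinearMap.mulLeft_apply, LinearMap.mulRight_apply]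
    rw [t.h_mul_e_pow, add_sub_cancel_left, ← Nat.cast_smul_eq_nsmul K]
    push_cast
    rfl
  have hfin : Set.Finite {μ | A.HasEigenvalue μ} := Module.End.finite_hasEigenvalue A
  refine Set.infinite_range_of_injective (f := fun n : ℕ => (2 * n : K)) ?_
    (hfin.subset (by rintro _ ⟨n, rfl⟩; exact hA n))
  intro m n hmn
  simpa using hmn

/-- The sum of the eigenspaces of `h` with integral eigenvalues. -/
def intEigen (h : Module.End K V) : Submodule K V := ⨆ n : ℤ, h.eigenspace (n : K)

lemma mem_intEigen {n : ℤ} {v : V} (hv : h v = (n : K) • v) : v ∈ intEigen h :=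
  Submodule.mem_iSup_of_mem n (Module.End.mem_eigenspace_iff.mpr hv)

lemma intEigen_induction {q : V → Prop} {v : V} (hv : v ∈ intEigen h) (zero : q 0)
    (add : ∀ v w, q v → q w → q (v + w)) (mem : ∀ (n : ℤ) (v : V), h v = (n : K) • v → q v) : q v :=
  Submodule.iSup_induction _ (motive := q) hv
    (fun n v hv => mem n v (Module.End.mem_eigenspace_iff.mp hv)) zero add

lemma h_intEigen {v : V} (hv : v ∈ intEigen h) : h v ∈ intEigen h := by
  refine intEigen_induction (q := fun v => h v ∈ intEigen h) hv (by simp)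
    (fun v w h1 h2 => by rw [map_add]; exact add_mem h1 h2) fun n v h1 => ?_
  rw [h1]
  exact Submodule.smul_mem _ _ (mem_intEigen h1)

lemma e_intEigen (t : IsSl2Action e f h) {v : V} (hv : v ∈ intEigen h) : e v ∈ intEigen h := by
  refine intEigen_induction (q := fun v => e v ∈ intEigen h) hv (by simp)
    (fun v w h1 h2 => by rw [map_add]; exact add_mem h1 h2) fun n v h1 => ?_
  refine mem_intEigen (n := n + 2) ?_
  have := LinearMap.congr_fun t.h_mul_e v
  simp only [Module.End.mul_apply, h1, LinearMap.add_apply, LinearMap.smul_apply, map_smul] at this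
  rw [this, ← Nat.cast_smul_eq_nsmul K, ← add_smul]
  simp

lemma f_intEigen (t : IsSl2Action e f h) {v : V} (hv : v ∈ intEigen h) : f v ∈ intEigen h := by
  refine intEigen_induction (q := fun v => f v ∈ intEigen h) hv (by simp)
    (fun v w h1 h2 => by rw [map_add]; exact add_mem h1 h2) fun n v h1 => ?_
  refine mem_intEigen (n := n - 2) ?_
  have := LinearMap.congr_fun t.h_mul_f v
  simp only [Module.End.mul_apply, h1, LinearMap.sub_apply, LinearMap.smul_apply, map_smul] at this
  rw [this, ← Nat.cast_smul_eq_nsmul K, ← sub_smul]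
  simp

/-- Every element of the sum of the eigenspaces is the sum of a `ν`-eigenvector and of an element
of the image of `h - ν`. -/
lemma exists_eq_add {v : V} (hv : v ∈ intEigen h) (ν : ℤ) :
    ∃ u w, h u = (ν : K) • u ∧ w ∈ intEigen h ∧ v = u + (h w - (ν : K) • w) := by
  refine intEigen_induction (q := fun v => ∃ u w, h u = (ν : K) • u ∧ w ∈ intEigen h ∧
    v = u + (h w - (ν : K) • w)) hv ⟨0, 0, by simp⟩ ?_ ?_
  · rintro _ _ ⟨u, w, h1, h2, rfl⟩ ⟨u', w', h1', h2', rfl⟩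
    refine ⟨u + u', w + w', by rw [map_add, h1, h1', smul_add], add_mem h2 h2', ?_⟩
    rw [map_add, smul_add]; abel
  · intro n v h1
    by_cases hn : n = ν
    · exact ⟨v, 0, by rw [h1, hn], zero_mem _, by simp⟩
    · have hn' : (n : K) - ν ≠ 0 := sub_ne_zero.mpr (by exact_mod_cast hn)
      refine ⟨0, ((n : K) - ν)⁻¹ • v, by simp, Submodule.smul_mem _ _ (mem_intEigen h1), ?_⟩
      rw [map_smul, h1, smul_comm (ν : K), ← smul_sub, ← sub_smul, smul_smul, inv_mul_cancel₀ hn']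
      simp

/-- For v in the sum of the eigenspaces, h v - ν v has no component of eigenvalue ν. By independence
of the eigenspaces it vanishes if it is itself a ν-eigenvector. -/
lemma sub_smul_eq_zero {v : V} (hv : v ∈ intEigen h) {ν : K}
    (h2 : h (h v - ν • v) = ν • (h v - ν • v)) : h v = ν • v := by
  have h1 : h v - ν • v ∈ ⨆ n : {n : K // n ≠ ν}, h.eigenspace (n : K) := by
    refine intEigen_induction (q := fun v => h v - ν • v ∈ ⨆ n : {n : K // n ≠ ν},
      h.eigenspace (n : K)) hv (by simp) ?_ ?_
    · intro v w hv hw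
      rw [map_add, smul_add, add_sub_add_comm]
      exact add_mem hv hw
    · intro n v hv
      by_cases hn : (n : K) = ν
      · rw [hv, hn, sub_self]; exact zero_mem _
      · rw [hv, ← sub_smul]
        exact Submodule.smul_mem _ _ (Submodule.mem_iSup_of_mem (⟨n, hn⟩ : {n : K // n ≠ ν})
          (Module.End.mem_eigenspace_iff.mpr hv))
  have h3 := Module.End.eigenspaces_iSupIndep h ν
  rw [iSup_subtype] at h1
  exact sub_eq_zero.mp ((Submodule.disjoint_def.mp h3) _ (Module.End.mem_eigenspace_iff.mpr h2) h1)

lemma e_h_apply (t : IsSl2Action e f h) (v : V) : e (h v) = h (e v) - (2 : K) • e v := by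
  have := LinearMap.congr_fun t.h_mul_e v
  simp only [Module.End.mul_apply, LinearMap.add_apply, LinearMap.smul_apply] at this
  rw [this, ← Nat.cast_smul_eq_nsmul K]
  simp

lemma e_pow_f_pow_apply (t : IsSl2Action e f h) (k : ℕ) (v : V) :
    (e ^ (k + 1) * f ^ (k + 1)) v = (e ^ k * f ^ (k + 1)) (e v)
      + ((k : K) + 1) • (e ^ k * f ^ k) (h v - (k : K) • v) := by
  rw [pow_succ e, mul_assoc, t.e_mul_f_pow, mul_add, ← Nat.cast_smul_eq_nsmul K]
  simp

/-- Modulo the stable subspace W the vector v is killed by e, so e^k f^k acts on it as k! ∏_{i<k} (h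
- i). Since the result is zero modulo W, some partial product of v is nonzero modulo W and is an
eigenvector there, with a natural number as eigenvalue. -/
lemma exists_notMem_sub_mem (t : IsSl2Action e f h) {W : Submodule K V}
    (heW : ∀ v ∈ W, e v ∈ W) (hfW : ∀ v ∈ W, f v ∈ W) (hhW : ∀ v ∈ W, h v ∈ W) (k : ℕ) :
    ∀ v, v ∉ W → e v ∈ W → (e ^ k * f ^ k) v ∈ W →
      ∃ v', v' ∉ W ∧ e v' ∈ W ∧ ∃ n : ℕ, h v' - (n : K) • v' ∈ W := by
  induction k with
  | zero => intro v hv _ h0; exact absurd (by simpa using h0) hv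
  | succ k ih =>
    intro v hv hev hk
    by_cases h2 : h v - (k : K) • v ∈ W
    · exact ⟨v, hv, hev, k, h2⟩
    · refine ih _ h2 ?_ ?_
      · rw [map_sub, map_smul, t.e_h_apply]
        exact sub_mem (sub_mem (hhW _ hev) (W.smul_mem _ hev)) (W.smul_mem _ hev)
      · rw [t.e_pow_f_pow_apply] at hk
        have hpow : ∀ (g : Module.End K V), (∀ v ∈ W, g v ∈ W) → ∀ n, ∀ v ∈ W, (g ^ n) v ∈ W := by
          intro g hg n
          induction n with
          | zero => simp
          | succ n ih => intro v hv; rw [pow_succ]; exact ih _ (hg _ hv)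
        have h3 : (e ^ k * f ^ (k + 1)) (e v) ∈ W := hpow e heW _ _ (hpow f hfW _ _ hev)
        have h4 := (Submodule.add_mem_iff_right _ h3).mp hk
        exact (Submodule.smul_mem_iff _ (Nat.cast_add_one_ne_zero k)).mp h4

/-- The same identity, now exact: v is killed by ∏_{i<k} (h - i), which has distinct roots, so v is
a sum of eigenvectors. -/
lemma mem_intEigen_of_e_eq_zero (t : IsSl2Action e f h) (k : ℕ) :
    ∀ v, e v = 0 → (e ^ k * f ^ k) v = 0 → v ∈ ⨆ i : Fin k, h.eigenspace ((i : ℕ) : K) := by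
  induction k with
  | zero => intro v _ h0; rw [show v = 0 by simpa using h0]; exact zero_mem _
  | succ k ih =>
    intro v hev hk
    rw [t.e_pow_f_pow_apply, hev, map_zero, zero_add,
      smul_eq_zero_iff_right (Nat.cast_add_one_ne_zero k)] at hk
    have h1 := ih _ (by rw [map_sub, map_smul, t.e_h_apply]; simp [hev]) hk
    obtain ⟨w, hw, h2⟩ : ∃ w ∈ ⨆ i : Fin k, h.eigenspace ((i : ℕ) : K),
        h w - (k : K) • w = h v - (k : K) • v := by
      refine Submodule.iSup_induction _ (motive := fun x => ∃ w ∈ ⨆ i : Fin k,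
        h.eigenspace ((i : ℕ) : K), h w - (k : K) • w = x) h1 ?_ ⟨0, zero_mem _, by simp⟩ ?_
      · intro i x hx
        have hi : ((i : ℕ) : K) - k ≠ 0 := sub_ne_zero.mpr (by exact_mod_cast i.2.ne)
        refine ⟨(((i : ℕ) : K) - k)⁻¹ • x, Submodule.smul_mem _ _ (Submodule.mem_iSup_of_mem i hx), ?_⟩
        rw [map_smul, Module.End.mem_eigenspace_iff.mp hx, smul_comm (k : K), ← smul_sub,
          ← sub_smul, smul_smul, inv_mul_cancel₀ hi, one_smul]
      · rintro _ _ ⟨w, hw, rfl⟩ ⟨w', hw', rfl⟩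
        exact ⟨w + w', add_mem hw hw', by rw [map_add, smul_add]; abel⟩
    rw [← sub_add_cancel v w]
    refine add_mem ?_ (?_ : w ∈ _)
    · refine Submodule.mem_iSup_of_mem (Fin.last k) (Module.End.mem_eigenspace_iff.mpr ?_)
      rw [map_sub, smul_sub, Fin.val_last]
      rw [sub_eq_sub_iff_add_eq_add] at h2 ⊢
      rw [← h2, add_comm]
    · refine (iSup_le fun i => ?_ : (⨆ i : Fin k, h.eigenspace ((i : ℕ) : K)) ≤ _) hw
      exact le_iSup (fun i : Fin (k + 1) => h.eigenspace ((i : ℕ) : K)) i.castSucc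

/-- The operator e f preserves the ν-eigenspace, so by finite dimension injectivity suffices. If e f
y = 0 and k is the last exponent with e^k y ≠ 0, commuting f past e^(k+1) gives (k + 1)(ν + k) e^k y
= 0, which is impossible for ν > 0. -/
lemma exists_e_f_eq (t : IsSl2Action e f h) {ν : ℤ} (hν : 0 < ν) {u : V} (hu : h u = (ν : K) • u) :
    ∃ y, h y = (ν : K) • y ∧ e (f y) = u := by
  have hmap : ∀ y ∈ h.eigenspace (ν : K), (e * f) y ∈ h.eigenspace (ν : K) := by
    intro y hy
    rw [Module.End.mem_eigenspace_iff] at hy ⊢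
    have h1 : h * (e * f) = e * f * h := by
      rw [← mul_assoc, t.h_mul_e, add_mul, mul_assoc, t.h_mul_f]
      simp only [two_smul, mul_sub, add_mul, mul_add, mul_assoc]
      abel
    rw [← Module.End.mul_apply, h1, Module.End.mul_apply, hy, map_smul]
  let g : Module.End K (h.eigenspace (ν : K)) := (e * f).restrict hmap
  have hg : Function.Injective g := by
    rw [injective_iff_map_eq_zero]
    rintro ⟨y, hy⟩ hgy
    have h0 : e (f y) = 0 := congrArg Subtype.val hgy
    by_contra hne
    have hne' : y ≠ 0 := fun h => hne (Subtype.ext h)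
    obtain ⟨N, hN⟩ := t.isNilpotent_e
    have hex : ∃ n, (e ^ n) y = 0 := ⟨N, by simp [hN]⟩
    classical
    obtain ⟨k, hk⟩ : ∃ k, Nat.find hex = k + 1 := Nat.exists_eq_succ_of_ne_zero fun h => hne' (by
      simpa [h] using Nat.find_spec hex)
    have hk1 : (e ^ (k + 1)) y = 0 := hk ▸ Nat.find_spec hex
    have hk2 : (e ^ k) y ≠ 0 := Nat.find_min hex (by omega)
    have h1 := LinearMap.congr_fun (t.symm.e_mul_f_pow k) y
    rw [Module.End.mem_eigenspace_iff] at hy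
    simp only [Module.End.mul_apply, hk1, map_zero, LinearMap.add_apply, LinearMap.smul_apply,
      LinearMap.sub_apply, LinearMap.neg_apply, Module.End.one_apply, hy, map_sub, map_neg,
      map_smul] at h1
    rw [pow_succ, Module.End.mul_apply, h0, map_zero, zero_add, ← Nat.cast_smul_eq_nsmul K,
      ← neg_smul, ← sub_smul, smul_smul] at h1
    refine (smul_ne_zero (mul_ne_zero (Nat.cast_ne_zero.mpr k.succ_ne_zero) ?_) hk2) h1.symm
    have : (-(ν : K) - k) = ((-ν - k : ℤ) : K) := by push_cast; ring
    rw [this]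
    exact_mod_cast (by omega : -ν - (k : ℤ) ≠ 0)
  obtain ⟨y, hy⟩ := (LinearMap.injective_iff_surjective.mp hg) ⟨u, Module.End.mem_eigenspace_iff.mpr hu⟩
  exact ⟨y, Module.End.mem_eigenspace_iff.mp y.2, congrArg Subtype.val hy⟩

/-- In a finite-dimensional representation of `sl₂` the element `h` acts diagonalizably, with
integral eigenvalues. -/
theorem intEigen_eq_top (t : IsSl2Action e f h) : intEigen h = ⊤ := by
  classical
  by_contra hne
  obtain ⟨v, -, hv⟩ := SetLike.exists_of_lt (lt_top_iff_ne_top.mpr hne)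
  obtain ⟨N, hN⟩ := t.isNilpotent_e
  have hbase : ∀ v, e v = 0 → v ∈ intEigen h := fun v hv => by
    have h1 := t.mem_intEigen_of_e_eq_zero N v hv (by simp [hN])
    refine (iSup_le fun i => ?_ : (⨆ i : Fin N, h.eigenspace ((i : ℕ) : K)) ≤ _) h1
    exact_mod_cast le_iSup (fun n : ℤ => h.eigenspace (n : K)) (i : ℕ)
  obtain ⟨v, hv, hev⟩ : ∃ v, v ∉ intEigen h ∧ e v ∈ intEigen h := by
    have hex : ∃ n, (e ^ n) v ∈ intEigen h := ⟨N, by simp [hN]⟩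
    obtain ⟨k, hk⟩ : ∃ k, Nat.find hex = k + 1 := Nat.exists_eq_succ_of_ne_zero fun h => hv (by
      simpa [h] using Nat.find_spec hex)
    refine ⟨(e ^ k) v, Nat.find_min hex (by omega), ?_⟩
    have := Nat.find_spec hex
    rwa [hk, pow_succ'] at this
  -- No complete reducibility is needed. Take v outside the sum W of the eigenspaces with e v in W
  -- and h v ≡ n v modulo W. Correcting v by some w in W makes h v - n v a true n-eigenvector u;
  -- then e v is a true eigenvector of eigenvalue n + 2 > 0, hence of the form e f y. Now v - f y is
  -- killed by e and so lies in W, a contradiction.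
  obtain ⟨v, hv, hev, n, hn⟩ := t.exists_notMem_sub_mem (fun _ => t.e_intEigen)
    (fun _ => t.f_intEigen) (fun _ => h_intEigen) N v hv hev (by simp [hN])
  obtain ⟨u, w, hu, hw, hvu⟩ := exists_eq_add hn (n : ℤ)
  simp only [Int.cast_natCast] at hu hvu
  have hx1 : e (v - w) ∈ intEigen h := by
    rw [map_sub]; exact sub_mem hev (t.e_intEigen hw)
  have hx2 : h (v - w) = u + (n : K) • (v - w) := by
    rw [map_sub, smul_sub, ← sub_eq_zero]
    rw [← sub_eq_zero] at hvu
    rw [← hvu]; abel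
  have heh : ∀ x, h (e x) = e (h x) + (2 : K) • e x := fun x => by
    rw [t.e_h_apply]; simp
  have hx3 : h (e (v - w)) = ((n + 2 : ℤ) : K) • e (v - w) := by
    have h4 : h (e (v - w)) - ((n + 2 : ℤ) : K) • e (v - w) = e u := by
      rw [heh, hx2, map_add, map_smul]; push_cast; module
    refine sub_smul_eq_zero hx1 ?_
    rw [h4, heh, hu, map_smul]; push_cast; module
  obtain ⟨y, hy, hefy⟩ := t.exists_e_f_eq (by omega) hx3
  have h5 : v - w - f y ∈ intEigen h := hbase _ (by rw [map_sub, hefy, sub_self])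
  refine hv ?_
  have : v = (v - w - f y) + f y + w := by abel
  rw [this]
  exact add_mem (add_mem h5 (t.f_intEigen (mem_intEigen hy))) hw

theorem maxGenEigenspace_eq (t : IsSl2Action e f h) (ν : K) :
    h.maxGenEigenspace ν = h.eigenspace ν := by
  refine le_antisymm (fun v hv => ?_) (fun v hv =>
    (Module.End.mem_maxGenEigenspace _ _ _).mpr
      ⟨1, by simpa [sub_eq_zero] using Module.End.mem_eigenspace_iff.mp hv⟩)
  obtain ⟨k, hk⟩ := Module.End.mem_maxGenEigenspace _ _ _ |>.mp hv
  clear hv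
  induction k generalizing v with
  | zero => rw [show v = 0 by simpa using hk]; exact zero_mem _
  | succ k ih =>
    rw [pow_succ, Module.End.mul_apply] at hk
    have h1 := Module.End.mem_eigenspace_iff.mp (ih _ hk)
    refine Module.End.mem_eigenspace_iff.mpr (sub_smul_eq_zero (h := h) ?_ ?_)
    · rw [t.intEigen_eq_top]; trivial
    · simpa using h1

end IsSl2Action

end Sl2

/-! ## The Chevalley basis -/

section ChevalleyBasis

open LieAlgebra LieAlgebra.IsKilling LieModule Module

variable {K : Type*} [Field K] [CharZero K]
  {g : Type*} [LieRing g] [LieAlgebra K g] [FiniteDimensional K g] [LieAlgebra.IsSimple K g]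
  {H : LieSubalgebra K g} [H.IsCartanSubalgebra] [IsTriangularizable K H g]

lemma exists_root_eq_neg (α : H.root) :
    ∃ β, (rootSystem H).root β = -(rootSystem H).root α :=
  ⟨(rootSystem H).reflectionPerm α α, by
    rw [(rootSystem H).root_reflectionPerm, (rootSystem H).reflection_apply_self]⟩

lemma coroot_coe_ne_zero (α : H.root) : ((rootSystem H).coroot α : g) ≠ 0 := by
  intro h0
  exact (rootSystem H).ne_zero' α (Subtype.ext h0)

/-- The height with respect to a base, as an element of the Cartan subalgebra. -/
lemma exists_heightVector (b : (rootSystem H).Base) :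
    ∃ δ : H, ∀ α : H.root, (rootSystem H).root α δ = (b.height α : K) := by
  let φ : Module.Dual K (Module.Dual K H) := b.toWeightBasis.constr K fun _ => (1 : K)
  obtain ⟨δ, hδ⟩ := (Module.evalEquiv K H).surjective φ
  refine ⟨δ, fun α => ?_⟩
  obtain ⟨f, -, -, hf⟩ := b.exists_root_eq_sum_int α
  have h1 : (rootSystem H).root α δ = φ ((rootSystem H).root α) := by
    rw [← hδ]; rfl
  rw [h1, RootPairing.Base.height_eq_sum hf, hf, map_sum]
  push_cast
  refine Finset.sum_congr rfl fun j hj => ?_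
  have h2 : φ ((rootSystem H).root j) = 1 := by
    have := b.toWeightBasis.constr_basis K (fun _ => (1 : K)) ⟨j, hj⟩
    rwa [b.toWeightBasis_apply] at this
  rw [map_zsmul, h2]
  simp

namespace IsChevalleySystem

variable {X : H.root → g} (hX : IsChevalleySystem X) (b : (rootSystem H).Base)
include hX

lemma ne_zero (α : H.root) : X α ≠ 0 := by
  intro h0
  obtain ⟨β, hβ⟩ := exists_root_eq_neg α
  have := hX.lie_neg α β hβ
  rw [h0, zero_lie] at this
  exact coroot_coe_ne_zero α this.symm

/-- The members of the Chevalley basis. -/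
noncomputable def basisFun (X : H.root → g) (b : (rootSystem H).Base) : H.root ⊕ b.support → g :=
  Sum.elim X fun i => ((rootSystem H).coroot i : g)

lemma linearIndependent_basisFun : LinearIndependent K (basisFun X b) := by
  refine LinearIndependent.sum_type ?_ ?_ ?_
  · have h1 := LieSubmodule.iSupIndep_toSubmodule.mpr (iSupIndep_genWeightSpace' K H g)
    have h2 := h1.comp (f := fun α : H.root => (α : Weight K H g)) Subtype.val_injective
    exact h2.linearIndependent _ (fun α => hX.mem_rootSpace α) (fun α => hX.ne_zero α)
  · have h1 := b.toCoweightBasis.linearIndependent.map' H.toSubmodule.subtype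
      (Submodule.ker_subtype _)
    convert h1 using 1
    ext i
    rw [Function.comp_apply, b.toCoweightBasis_apply]
    rfl
  · have h1 := iSupIndep_genWeightSpace K H g
    have h2 := LieSubmodule.disjoint_toSubmodule.mpr (h1 0)
    refine (h2.mono ?_ ?_).symm
    · rw [Submodule.span_le]
      rintro _ ⟨i, rfl⟩
      exact toLieSubmodule_le_rootSpace_zero K g H (SetLike.coe_mem _)
    · rw [Submodule.span_le]
      rintro _ ⟨α, rfl⟩
      have hne : ((α : Weight K H g) : H → K) ≠ 0 := by
        simp
      have h3 : rootSpace H ((α : Weight K H g) : H → K) ≤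
          ⨆ χ, ⨆ (_ : χ ≠ (0 : H → K)), genWeightSpace g χ :=
        le_iSup₂_of_le _ hne le_rfl
      exact h3 (hX.mem_rootSpace α)

lemma span_basisFun : ⊤ ≤ Submodule.span K (Set.range (basisFun X b)) := by
  have h1 := congrArg LieSubmodule.toSubmodule (iSup_genWeightSpace_eq_top' K H g)
  rw [LieSubmodule.iSup_toSubmodule, LieSubmodule.top_toSubmodule] at h1
  rw [← h1]
  refine iSup_le fun χ => ?_
  by_cases hχ : χ.IsZero
  · intro x hx
    rw [hχ] at hx
    have hx' : x ∈ H := by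
      change x ∈ rootSpace H (0 : H → K) at hx
      rw [rootSpace_zero_eq] at hx
      exact hx
    have h2 : (⟨x, hx'⟩ : H) ∈ Submodule.span K (Set.range b.toCoweightBasis) := by
      rw [b.toCoweightBasis.span_eq]; trivial
    have h3 := Submodule.mem_map_of_mem (f := H.toSubmodule.subtype) h2
    rw [Submodule.map_span] at h3
    refine Submodule.span_mono ?_ h3
    rintro _ ⟨_, ⟨i, rfl⟩, rfl⟩
    exact ⟨Sum.inr i, by simp [basisFun]⟩
  · have hα : χ ∈ H.root := by simpa using hχ
    intro x hx
    have hf := finrank_rootSpace_eq_one χ hχ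
    obtain ⟨c, hc⟩ := (finrank_eq_one_iff_of_nonzero'
      (⟨X ⟨χ, hα⟩, hX.mem_rootSpace ⟨χ, hα⟩⟩ : rootSpace H χ)
      (fun h => hX.ne_zero ⟨χ, hα⟩ (congrArg Subtype.val h))).mp hf ⟨x, hx⟩
    have hc' : c • X ⟨χ, hα⟩ = x := congrArg Subtype.val hc
    rw [← hc']
    exact Submodule.smul_mem _ _ (Submodule.subset_span ⟨Sum.inl ⟨χ, hα⟩, rfl⟩)

/-- The Chevalley basis: the `X_α` and the simple coroots. -/
noncomputable def basis : Basis (H.root ⊕ b.support) K g :=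
  Basis.mk (hX.linearIndependent_basisFun b) (hX.span_basisFun b)

@[simp] lemma basis_inl (α : H.root) : hX.basis b (Sum.inl α) = X α := by
  simp [basis, basisFun]

@[simp] lemma basis_inr (i : b.support) :
    hX.basis b (Sum.inr i) = ((rootSystem H).coroot i : g) := by
  simp [basis, basisFun]

omit hX in
/-- The degrees of the members of the Chevalley basis. -/
noncomputable def deg (b : (rootSystem H).Base) : H.root ⊕ b.support → ℤ := Sum.elim b.height fun _ => 0

omit hX in
@[simp] lemma deg_inl (α : H.root) : deg b (Sum.inl α) = b.height α := rfl

omit hX in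
@[simp] lemma deg_inr (i : b.support) : deg b (Sum.inr i) = 0 := rfl

omit hX in
lemma height_lt (α : H.root) : b.height α < coxeterNumber b := by
  have h1 : (b.height α).toNat ≤ Finset.univ.sup fun α : H.root => (b.height α).toNat :=
    Finset.le_sup (f := fun α : H.root => (b.height α).toNat) (Finset.mem_univ α)
  unfold coxeterNumber
  push_cast
  omega

omit hX in
lemma deg_lt (j : H.root ⊕ b.support) : deg b j < coxeterNumber b := by
  rcases j with α | i
  · exact height_lt b α
  · simp [coxeterNumber]

omit hX in
lemma neg_lt_deg (j : H.root ⊕ b.support) : -(coxeterNumber b : ℤ) < deg b j := by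
  rcases j with α | i
  · obtain ⟨β, hβ⟩ := exists_root_eq_neg α
    have h1 := height_lt b β
    -- Writing -α as α + (-2)α yields ht(-α) = -ht(α) from the formula for heights along a root
    -- string.
    have h2 : (rootSystem H).root β = (rootSystem H).root α + (-2 : ℤ) • (rootSystem H).root α := by
      rw [hβ]; module
    have := b.height_add_zsmul h2
    simp only [smul_eq_mul] at this
    simp only [deg_inl]
    omega
  · simp only [deg_inr, coxeterNumber]
    omega

lemma span_int_eq : Submodule.span ℤ (Set.range X ∪ Set.range fun α => ((rootSystem H).coroot α : g))
    = Submodule.span ℤ (Set.range (hX.basis b)) := by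
  apply le_antisymm
  · rw [Submodule.span_le]
    rintro _ (⟨α, rfl⟩ | ⟨α, rfl⟩)
    · exact Submodule.subset_span ⟨Sum.inl α, by simp⟩
    · have h1 := b.coroot_mem_span_int α
      have h3 := Submodule.mem_map_of_mem (f := (H.toSubmodule.subtype.restrictScalars ℤ)) h1
      rw [Submodule.map_span] at h3
      refine Submodule.span_mono ?_ h3
      rintro _ ⟨_, ⟨i, hi, rfl⟩, rfl⟩
      exact ⟨Sum.inr ⟨i, hi⟩, by simp⟩
  · rw [Submodule.span_le]
    rintro _ ⟨α | i, rfl⟩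
    · exact Submodule.subset_span (Or.inl ⟨α, by simp⟩)
    · exact Submodule.subset_span (Or.inr ⟨i, by simp⟩)

lemma heightVector_lie {δ : H} (hδ : ∀ α : H.root, (rootSystem H).root α δ = (b.height α : K))
    (j : H.root ⊕ b.support) : ⁅(δ : g), hX.basis b j⁆ = (deg b j : K) • hX.basis b j := by
  rcases j with α | i
  · have h1 := lie_eq_smul_of_mem_rootSpace (hX.mem_rootSpace α) δ
    rw [basis_inl, deg_inl, ← hδ]
    exact h1
  · have h1 : ⁅δ, (rootSystem H).coroot i⁆ = 0 := trivial_lie_zero _ _ _ _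
    rw [basis_inr, deg_inr, ← LieSubalgebra.coe_bracket, h1]
    simp

/-- The structure constants of the Chevalley basis are integers, and the bracket is graded. -/
lemma exists_structureConstants : ∃ C : H.root ⊕ b.support → H.root ⊕ b.support →
    H.root ⊕ b.support → ℤ, (∀ i j, ⁅hX.basis b i, hX.basis b j⁆ = ∑ l, C i j l • hX.basis b l) ∧
      ∀ i j l, C i j l ≠ 0 → deg b l = deg b i + deg b j := by
  have h1 : ∀ i j, ∃ c : H.root ⊕ b.support → ℤ,
      ∑ l, c l • hX.basis b l = ⁅hX.basis b i, hX.basis b j⁆ := by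
    intro i j
    rw [← Submodule.mem_span_range_iff_exists_fun, ← hX.span_int_eq]
    refine hX.intForm.lie_mem' ?_ ?_
    all_goals
      change _ ∈ Submodule.span ℤ _
      rw [hX.span_int_eq b]
      exact Submodule.subset_span ⟨_, rfl⟩
  choose C hC using h1
  refine ⟨C, fun i j => (hC i j).symm, fun i j l hl => ?_⟩
  -- The derivation ad δ multiplies each basis vector by its degree, so comparing coefficients of
  -- [δ, [e_i, e_j]] forces every e_l that occurs to have degree deg e_i + deg e_j.
  obtain ⟨δ, hδ⟩ := exists_heightVector b
  have h2 : ⁅(δ : g), ⁅hX.basis b i, hX.basis b j⁆⁆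
      = ((deg b i + deg b j : ℤ) : K) • ⁅hX.basis b i, hX.basis b j⁆ := by
    rw [leibniz_lie, hX.heightVector_lie b hδ, hX.heightVector_lie b hδ, smul_lie, lie_smul,
      ← add_smul]
    push_cast; rfl
  rw [← hC, lie_sum, Finset.smul_sum, ← sub_eq_zero, ← Finset.sum_sub_distrib] at h2
  have h3 : ∀ l, ⁅(δ : g), C i j l • hX.basis b l⁆
      - ((deg b i + deg b j : ℤ) : K) • C i j l • hX.basis b l
      = ((C i j l * (deg b l - (deg b i + deg b j)) : ℤ) : K) • hX.basis b l := by
    intro l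
    rw [lie_zsmul, hX.heightVector_lie b hδ, ← Int.cast_smul_eq_zsmul K,
      ← Int.cast_smul_eq_zsmul K]
    push_cast
    module
  simp only [h3] at h2
  have h4 := Fintype.linearIndependent_iff.mp (hX.basis b).linearIndependent _ h2 l
  have h5 : C i j l * (deg b l - (deg b i + deg b j)) = 0 := by exact_mod_cast h4
  exact sub_eq_zero.mp ((mul_eq_zero.mp h5).resolve_left hl)

end IsChevalleySystem

end ChevalleyBasis

/-! ## Weights -/

section Weights

open LieAlgebra LieAlgebra.IsKilling LieModule Module

variable {K : Type*} [Field K] [CharZero K]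
  {g : Type*} [LieRing g] [LieAlgebra K g] [FiniteDimensional K g] [LieAlgebra.IsSimple K g]
  {H : LieSubalgebra K g} [H.IsCartanSubalgebra] [IsTriangularizable K H g]

/-- A function on the dual of the Cartan subalgebra which extends the height. -/
lemma exists_degreeFun (b : (rootSystem H).Base) : ∃ c : Module.Dual K H → ℤ,
    ∀ (μ : Module.Dual K H) (α : H.root), c (μ + (rootSystem H).root α) = c μ + b.height α := by
  obtain ⟨δ, hδ⟩ := exists_heightVector b
  -- On the root lattice Q the height vector δ takes integral values, but not on arbitrary μ.
  -- Subtracting a chosen representative of the coset of μ modulo Q makes the value integral without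
  -- affecting its increments along roots.
  let Q : AddSubgroup (Module.Dual K H) := AddSubgroup.closure (Set.range (rootSystem H).root)
  have hQ : ∀ ν ∈ Q, ∃ n : ℤ, ν δ = n := by
    intro ν hν
    induction hν using AddSubgroup.closure_induction with
    | mem x hx => obtain ⟨α, rfl⟩ := hx; exact ⟨_, hδ α⟩
    | zero => exact ⟨0, by simp⟩
    | add x y _ _ hx hy =>
      obtain ⟨m, hm⟩ := hx
      obtain ⟨n, hn⟩ := hy
      exact ⟨m + n, by simp [hm, hn]⟩
    | neg x _ hx =>
      obtain ⟨m, hm⟩ := hx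
      exact ⟨-m, by simp [hm]⟩
  have hrep : ∀ μ : Module.Dual K H, ∃ n : ℤ, (-(QuotientAddGroup.mk (s := Q) μ).out + μ) δ = n :=
    fun μ => hQ _ (QuotientAddGroup.eq.mp (QuotientAddGroup.out_eq' _))
  choose c hc using hrep
  refine ⟨c, fun μ α => ?_⟩
  have h1 : QuotientAddGroup.mk (s := Q) (μ + (rootSystem H).root α) = QuotientAddGroup.mk μ := by
    symm
    rw [QuotientAddGroup.eq, neg_add_cancel_left]
    exact AddSubgroup.subset_closure ⟨α, rfl⟩
  have h2 := hc (μ + (rootSystem H).root α)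
  rw [h1, ← add_assoc, LinearMap.add_apply, hc, hδ] at h2
  exact_mod_cast h2.symm

variable (V : Type*) [AddCommGroup V] [Module K V] [FiniteDimensional K V] [LieRingModule g V]
  [LieModule K g V]

lemma mem_weightSpace_dual {V : Type*} [AddCommGroup V] [Module K V] [LieRingModule g V]
    [LieModule K g V] {μ : Module.Dual K H} {v : V} :
    v ∈ weightSpace V (μ : H → K) ↔ ∀ x : H, ⁅(x : g), v⁆ = μ x • v :=
  mem_weightSpace _ _

namespace IsChevalleySystem

variable {X : H.root → g} (hX : IsChevalleySystem X) (b : (rootSystem H).Base)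
include hX

lemma coe_lie (x : H) (α : H.root) : ⁅(x : g), X α⁆ = (rootSystem H).root α x • X α :=
  lie_eq_smul_of_mem_rootSpace (hX.mem_rootSpace α) x

lemma isSl2Action {α β : H.root} (hβ : (rootSystem H).root β = -(rootSystem H).root α) :
    IsSl2Action (toEnd K g V (X α)) (toEnd K g V (X β))
      (toEnd K g V ((rootSystem H).coroot α : g)) := by
  have h2 : (rootSystem H).root α ((rootSystem H).coroot α) = 2 := (rootSystem H).root_coroot_two α
  have key : ∀ x y : g, toEnd K g V x * toEnd K g V y = toEnd K g V y * toEnd K g V x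
      + toEnd K g V ⁅x, y⁆ := fun x y => LinearMap.ext fun v => by
    simp only [Module.End.mul_apply, toEnd_apply_apply, LinearMap.add_apply]
    rw [leibniz_lie, add_comm]
  refine ⟨?_, ?_, ?_⟩
  · rw [key, hX.coe_lie, h2, map_smul, ← Nat.cast_smul_eq_nsmul K]; simp
  · rw [key, hX.coe_lie, hβ, LinearMap.neg_apply, h2, map_smul, ← Nat.cast_smul_eq_nsmul K]
    simp [sub_eq_add_neg]
  · rw [key, hX.lie_neg α β hβ]

/-- The simple coroots act by commuting operators, each diagonalizable by the theory of `sl₂`, so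
they are simultaneously diagonalizable. As they form a basis of H, a joint eigenvector is a weight
vector. -/
lemma iSup_weightSpace_eq_top (b : (rootSystem H).Base) :
    ⨆ μ : Module.Dual K H, (weightSpace V (μ : H → K)).toSubmodule = ⊤ := by
  have h1 := Module.End.iSup_iInf_maxGenEigenspace_eq_top_of_iSup_maxGenEigenspace_eq_top_of_commute
    (fun i : b.support => toEnd K g V ((rootSystem H).coroot i : g)) (fun i j _ => by
      have h0 : ⁅(rootSystem H).coroot i, (rootSystem H).coroot j⁆ = 0 := trivial_lie_zero _ _ _ _
      refine LinearMap.ext fun v => ?_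
      simp only [Module.End.mul_apply, toEnd_apply_apply]
      rw [leibniz_lie, ← LieSubalgebra.coe_bracket, h0]
      simp) (fun i => by
      obtain ⟨β, hβ⟩ := exists_root_eq_neg (i : H.root)
      have t := hX.isSl2Action V hβ
      rw [eq_top_iff, ← t.intEigen_eq_top]
      refine iSup_le fun n => ?_
      rw [← t.maxGenEigenspace_eq]
      exact le_iSup (fun μ => (toEnd K g V ((rootSystem H).coroot i : g)).maxGenEigenspace μ) (n : K))
  rw [eq_top_iff, ← h1]
  refine iSup_le fun χ => ?_
  refine le_iSup_of_le (b.toCoweightBasis.constr K χ) fun v hv => ?_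
  rw [LieSubmodule.mem_toSubmodule, mem_weightSpace_dual]
  have h2 : ∀ i : b.support, ⁅((rootSystem H).coroot i : g), v⁆ = χ i • v := fun i => by
    obtain ⟨β, hβ⟩ := exists_root_eq_neg (i : H.root)
    have h3 := Submodule.mem_iInf _ |>.mp hv i
    rw [(hX.isSl2Action V hβ).maxGenEigenspace_eq, Module.End.mem_eigenspace_iff] at h3
    exact h3
  intro x
  conv_lhs => rw [← b.toCoweightBasis.sum_repr x]
  conv_rhs => rw [← b.toCoweightBasis.sum_repr x, map_sum, Finset.sum_smul]
  rw [AddSubmonoidClass.coe_finsetSum, sum_lie]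
  refine Finset.sum_congr rfl fun i _ => ?_
  rw [map_smul, Basis.constr_basis, smul_assoc, ← h2, b.toCoweightBasis_apply]
  exact smul_lie _ _ _

end IsChevalleySystem

end Weights

/-! ## Integral weight bases -/

section Lattice

open LieAlgebra LieAlgebra.IsKilling LieModule Module
open scoped Pointwise

variable {K : Type*} [Field K] [CharZero K]
  {g : Type*} [LieRing g] [LieAlgebra K g] [FiniteDimensional K g] [LieAlgebra.IsSimple K g]
  {H : LieSubalgebra K g} [H.IsCartanSubalgebra] [IsTriangularizable K H g]
  {V : Type*} [AddCommGroup V] [Module K V] [FiniteDimensional K V] [LieRingModule g V]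
  [LieModule K g V]

lemma finite_iUnion_pow_smul {S : Set (Module.End K V)} {T : Set V} (hS : S.Finite) (hT : T.Finite)
    (R : ℕ) (hR : ∀ k, R ≤ k → ∀ v ∈ S ^ k • T, v = 0) : (⋃ k : ℕ, S ^ k • T).Finite := by
  have h0 : ∀ k : ℕ, (S ^ k).Finite := fun k => by
    induction k with
    | zero => simp
    | succ k ih => rw [pow_succ]; exact Set.Finite.mul ih hS
  have h1 : ((⋃ k ∈ Set.Iio R, S ^ k • T) ∪ {0}).Finite := by
    refine Set.Finite.union (Set.Finite.biUnion (Set.finite_Iio R) fun k _ => ?_)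
      (Set.finite_singleton 0)
    exact Set.Finite.smul (h0 k) hT
  refine h1.subset (Set.iUnion_subset fun k v hv => ?_)
  by_cases hk : k < R
  · exact Or.inl (Set.mem_biUnion (Set.mem_Iio.mpr hk) hv)
  · exact Or.inr (hR k (not_lt.mp hk) v hv)

/-- A weight vector of `V`. -/
def IsWeightVector (H : LieSubalgebra K g) [H.IsCartanSubalgebra] (v : V) : Prop :=
  ∃ μ : Module.Dual K H, v ∈ weightSpace V (μ : H → K)

lemma finite_weights (V : Type*) [AddCommGroup V] [Module K V] [FiniteDimensional K V]
    [LieRingModule g V] [LieModule K g V] :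
    {μ : Module.Dual K H | weightSpace V (μ : H → K) ≠ ⊥}.Finite := by
  have h1 := finite_genWeightSpace_ne_bot K H V
  refine Set.Finite.of_finite_image (f := fun μ : Module.Dual K H => (μ : H → K))
    (h1.subset ?_) DFunLike.coe_injective.injOn
  rintro _ ⟨μ, hμ, rfl⟩ h2
  exact hμ (le_bot_iff.mp (h2 ▸ weightSpace_le_genWeightSpace V (μ : H → K)))

namespace IsChevalleySystem

variable {X : H.root → g} (hX : IsChevalleySystem X) (b : (rootSystem H).Base)
include hX

lemma lie_mem_weightSpace {μ : Module.Dual K H} {v : V} (hv : v ∈ weightSpace V (μ : H → K))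
    (α : H.root) :
    ⁅X α, v⁆ ∈ weightSpace V ((μ + (rootSystem H).root α : Module.Dual K H) : H → K) := by
  rw [mem_weightSpace_dual] at hv ⊢
  intro x
  rw [leibniz_lie, hX.coe_lie, hv, smul_lie, lie_smul, LinearMap.add_apply]
  module

/-- The operators on `V` given by the root vectors of positive or negative height. -/
def rootOps (V : Type*) [AddCommGroup V] [Module K V] [LieRingModule g V]
    [LieModule K g V] (X : H.root → g) (b : (rootSystem H).Base) (ε : ℤ) : Set (Module.End K V) :=
  (fun α => toEnd K g V (X α)) '' {α | 0 < ε * b.height α}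

omit hX in
lemma finite_rootOps (ε : ℤ) : (rootOps V X b ε).Finite := Set.Finite.image _ (Set.toFinite _)

/-- Each root vector in the word raises ε c by at least one. Since V has finitely many weights, this
bounds the length of the words that do not vanish on T. -/
lemma exists_weight_of_mem_pow_smul {c : Module.Dual K H → ℤ}
    (hc : ∀ (μ : Module.Dual K H) (α : H.root), c (μ + (rootSystem H).root α) = c μ + b.height α)
    {ε : ℤ} {T : Set V} (hT : ∀ v ∈ T, IsWeightVector H v) (k : ℕ) :
    ∀ v ∈ rootOps V X b ε ^ k • T, v ≠ 0 → ∃ μ₀ μ : Module.Dual K H,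
      weightSpace V (μ₀ : H → K) ≠ ⊥ ∧ v ∈ weightSpace V (μ : H → K) ∧ ε * c μ₀ + k ≤ ε * c μ := by
  induction k with
  | zero =>
    intro v hv h0
    rw [pow_zero, one_smul] at hv
    obtain ⟨μ, hμ⟩ := hT v hv
    refine ⟨μ, μ, fun h => h0 ?_, hμ, by simp⟩
    rw [h] at hμ
    simpa using hμ
  | succ k ih =>
    intro v hv h0
    rw [pow_succ', mul_smul] at hv
    obtain ⟨_, ⟨α, hα, rfl⟩, w, hw, rfl⟩ := hv
    obtain ⟨μ₀, μ, h1, h2, h3⟩ := ih w hw (by rintro rfl; simp at h0)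
    refine ⟨μ₀, _, h1, hX.lie_mem_weightSpace h2 α, ?_⟩
    rw [hc, mul_add]
    simp only [Set.mem_ofPred_eq] at hα
    push_cast
    omega

omit hX in
lemma isWeightVector_of_mem_iUnion (hX : IsChevalleySystem X) {ε : ℤ} {T : Set V}
    (hT : ∀ v ∈ T, IsWeightVector H v) :
    ∀ v ∈ ⋃ k : ℕ, rootOps V X b ε ^ k • T, IsWeightVector H v := by
  obtain ⟨c, hc⟩ := exists_degreeFun b
  intro v hv
  obtain ⟨k, hk⟩ := Set.mem_iUnion.mp hv
  by_cases h0 : v = 0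
  · exact ⟨0, h0 ▸ zero_mem _⟩
  · obtain ⟨-, μ, -, h, -⟩ := hX.exists_weight_of_mem_pow_smul b hc hT k v hk h0
    exact ⟨μ, h⟩

lemma finite_iUnion_rootOps {ε : ℤ} {T : Set V} (hTf : T.Finite)
    (hT : ∀ v ∈ T, IsWeightVector H v) : (⋃ k : ℕ, rootOps V X b ε ^ k • T).Finite := by
  obtain ⟨c, hc⟩ := exists_degreeFun b
  have hfin := finite_weights (H := H) V
  obtain ⟨m, hm⟩ := (hfin.image fun μ => ε * c μ).bddBelow
  obtain ⟨M, hM⟩ := (hfin.image fun μ => ε * c μ).bddAbove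
  refine finite_iUnion_pow_smul (finite_rootOps b ε) hTf (M - m + 1).toNat fun k hk v hv => ?_
  by_contra h0
  obtain ⟨μ₀, μ, h1, h2, h3⟩ := hX.exists_weight_of_mem_pow_smul b hc hT k v hv h0
  have h4 : weightSpace V (μ : H → K) ≠ ⊥ := by
    intro h
    rw [h] at h2
    exact h0 (by simpa using h2)
  have h5 := hm ⟨μ₀, h1, rfl⟩
  have h6 := hM ⟨μ, h4, rfl⟩
  simp only at h5 h6
  omega

omit hX in
lemma span_stable_of_mem {O : Type*} [CommRing O] [Module O V] [Algebra O K]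
    [IsScalarTower O K V] {ε : ℤ} {T : Set V} {α : H.root} (hα : 0 < ε * b.height α) {v : V}
    (hv : v ∈ Submodule.span O (⋃ k : ℕ, rootOps V X b ε ^ k • T)) :
    ⁅X α, v⁆ ∈ Submodule.span O (⋃ k : ℕ, rootOps V X b ε ^ k • T) := by
  have h1 := Submodule.mem_map_of_mem (f := (toEnd K g V (X α)).restrictScalars O) hv
  rw [Submodule.map_span] at h1
  refine Submodule.span_mono ?_ h1
  rintro _ ⟨w, hw, rfl⟩
  obtain ⟨k, hk⟩ := Set.mem_iUnion.mp hw
  refine Set.mem_iUnion.mpr ⟨k + 1, ?_⟩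
  rw [pow_succ', mul_smul]
  exact Set.smul_mem_smul ⟨α, hα, rfl⟩ hk

/-- A finitely generated module spanned by weight vectors and stable under the integral form. -/
lemma exists_lattice (O : Type*) [CommRing O] [Module O V] [Algebra O K]
    [IsScalarTower O K V]
    (hint : ∀ μ : Module.Dual K H, weightSpace V (μ : H → K) ≠ ⊥ → μ ∈ weightLattice H)
    (b : (rootSystem H).Base) :
    ∃ T : Set V, T.Finite ∧ (∀ v ∈ T, IsWeightVector H v) ∧ Submodule.span K T = ⊤ ∧
      ∀ (α : H.root), ∀ v ∈ Submodule.span O T, ⁅X α, v⁆ ∈ Submodule.span O T := by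
  obtain ⟨T₀, hT₀, hT₀'⟩ : ∃ T₀ : Finset V, (T₀ : Set V) ⊆ {v | IsWeightVector H v} ∧
      Submodule.span K (T₀ : Set V) = ⊤ := by
    have h1 : Submodule.span K {v : V | IsWeightVector H v} = ⊤ := by
      rw [eq_top_iff, ← hX.iSup_weightSpace_eq_top V b]
      exact iSup_le fun μ v hv => Submodule.subset_span ⟨μ, hv⟩
    have h2 : (Submodule.span K {v : V | IsWeightVector H v}).FG := by rw [h1]; exact Module.Finite.fg_top
    obtain ⟨T₀, h3, h4⟩ := (Submodule.fg_span_iff_fg_span_finset_subset _).mp h2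
    exact ⟨T₀, h3, by rw [← h4, h1]⟩
  have hw₀ : ∀ v ∈ (T₀ : Set V), IsWeightVector H v := fun v hv => hT₀ hv
  -- Start from a finite spanning set of weight vectors, apply all words in positive root vectors,
  -- then all words in negative ones. No divided powers are used: only stability under the X_α
  -- themselves is wanted.
  obtain ⟨T₁, hT₁⟩ : ∃ T₁ : Set V, T₁ = ⋃ k : ℕ, rootOps V X b 1 ^ k • (T₀ : Set V) := ⟨_, rfl⟩
  have hw₁ : ∀ v ∈ T₁, IsWeightVector H v := hT₁ ▸ isWeightVector_of_mem_iUnion b hX hw₀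
  have hf₁ : T₁.Finite := hT₁ ▸ hX.finite_iUnion_rootOps b T₀.finite_toSet hw₀
  obtain ⟨T₂, hT₂⟩ : ∃ T₂ : Set V, T₂ = ⋃ k : ℕ, rootOps V X b (-1) ^ k • T₁ := ⟨_, rfl⟩
  have h01 : (T₀ : Set V) ⊆ T₁ := fun v hv => hT₁ ▸ Set.mem_iUnion.mpr ⟨0, by simpa using hv⟩
  have h12 : T₁ ⊆ T₂ := fun v hv => hT₂ ▸ Set.mem_iUnion.mpr ⟨0, by simpa using hv⟩
  have hw₂ : ∀ v ∈ T₂, IsWeightVector H v := hT₂ ▸ isWeightVector_of_mem_iUnion b hX hw₁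
  refine ⟨T₂, hT₂ ▸ hX.finite_iUnion_rootOps b hf₁ hw₁, hw₂, ?_, ?_⟩
  · rw [eq_top_iff, ← hT₀']
    exact Submodule.span_mono (h01.trans h12)
  have hneg : ∀ α : H.root, b.height α < 0 → ∀ v ∈ Submodule.span O T₂,
      ⁅X α, v⁆ ∈ Submodule.span O T₂ := fun α hα v hv => by
    rw [hT₂] at hv ⊢
    exact span_stable_of_mem b (by omega) hv
  have hcor : ∀ (α : H.root), ∀ v, IsWeightVector H v → v ∈ Submodule.span O T₂ →
      ⁅((rootSystem H).coroot α : g), v⁆ ∈ Submodule.span O T₂ := by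
    rintro α v ⟨μ, hμ⟩ hv
    by_cases h0 : v = 0
    · rw [h0, lie_zero]; exact zero_mem _
    obtain ⟨n, hn⟩ := hint μ (fun h => h0 (by rw [h] at hμ; simpa using hμ)) α
    rw [mem_weightSpace_dual.mp hμ, hn, Int.cast_smul_eq_zsmul]
    exact zsmul_mem hv n
  -- Move x to the right past the negative root vectors, one at a time. Each move produces a
  -- commutator [x, X_β], so the induction on the length of the word must run over all of the
  -- integral form at once. The base case uses stability of T₁ under positive root vectors and
  -- integrality of the weights on coroots.
  have key : ∀ k : ℕ, ∀ x ∈ Submodule.span ℤ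
      (Set.range X ∪ Set.range fun α => ((rootSystem H).coroot α : g)),
      ∀ v ∈ rootOps V X b (-1) ^ k • T₁, ⁅x, v⁆ ∈ Submodule.span O T₂ := by
    intro k
    induction k with
    | zero =>
      intro x hx v hv
      rw [pow_zero, one_smul] at hv
      have hv2 : v ∈ Submodule.span O T₂ := Submodule.subset_span (h12 hv)
      induction hx using Submodule.span_induction with
      | mem x hx =>
        obtain ⟨α, rfl⟩ | ⟨α, rfl⟩ := hx
        · obtain h | h := lt_or_gt_of_ne (b.height_ne_zero α)
          · exact hneg α h v hv2
          · have h1 := Submodule.subset_span (R := O) hv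
            rw [hT₁] at h1
            have h2 := span_stable_of_mem b (by omega) h1 (α := α)
            rw [← hT₁] at h2
            exact Submodule.span_mono h12 h2
        · exact hcor α v (hw₁ v hv) hv2
      | zero => rw [zero_lie]; exact zero_mem _
      | add x y _ _ hx hy => rw [add_lie]; exact add_mem hx hy
      | smul n x _ hx => rw [zsmul_lie]; exact zsmul_mem hx n
    | succ k ih =>
      intro x hx v hv
      rw [pow_succ', mul_smul] at hv
      obtain ⟨_, ⟨β, hβ, rfl⟩, w, hw, rfl⟩ := hv
      change ⁅x, ⁅X β, w⁆⁆ ∈ _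
      simp only [Set.mem_ofPred_eq] at hβ
      rw [leibniz_lie]
      refine add_mem (ih _ ?_ w hw) (hneg β (by omega) _ (ih x hx w hw))
      exact hX.intForm.lie_mem' hx (Submodule.subset_span (Or.inl ⟨β, rfl⟩))
  intro α v hv
  have h1 := Submodule.mem_map_of_mem (f := (toEnd K g V (X α)).restrictScalars O) hv
  rw [Submodule.map_span] at h1
  refine Submodule.span_le.mpr ?_ h1
  rintro _ ⟨w, hw, rfl⟩
  rw [hT₂] at hw
  obtain ⟨k, hk⟩ := Set.mem_iUnion.mp hw
  exact key k _ (Submodule.subset_span (Or.inl ⟨α, rfl⟩)) w hk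

/-- A basis of weight vectors in which the root vectors have coefficients in `O`. -/
theorem exists_integral_weightBasis (O : Type*) [CommRing O] [IsDomain O] [IsPrincipalIdealRing O]
    [Algebra O K] [IsFractionRing O K] [Module O V] [IsScalarTower O K V]
    (hint : ∀ μ : Module.Dual K H, weightSpace V (μ : H → K) ≠ ⊥ → μ ∈ weightLattice H)
    (b : (rootSystem H).Base) :
    ∃ (n : ℕ) (v : Basis (Fin n) K V) (wt : Fin n → Module.Dual K H),
      (∀ i, v i ∈ weightSpace V (wt i : H → K)) ∧
      ∀ (α : H.root) (i j : Fin n), ∃ a : O, v.repr ⁅X α, v j⁆ i = algebraMap O K a := by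
  classical
  obtain ⟨T, hTf, hTw, hTs, hTX⟩ := hX.exists_lattice O hint b (V := V)
  have hMfg : (Submodule.span O T).FG := Submodule.fg_span hTf
  have : IsNoetherian O (Submodule.span O T) := isNoetherian_of_fg_of_noetherian _ hMfg
  let W : Module.Dual K H → Submodule K V := fun μ => (weightSpace V (μ : H → K)).toSubmodule
  have hW : DirectSum.IsInternal W := by
    refine DirectSum.isInternal_submodule_of_iSupIndep_of_iSup_eq_top ?_
      (hX.iSup_weightSpace_eq_top V b)
    have h1 := LieSubmodule.iSupIndep_toSubmodule.mpr (iSupIndep_genWeightSpace K H V)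
    exact (h1.comp (f := fun μ : Module.Dual K H => (μ : H → K)) DFunLike.coe_injective).mono
      fun μ => weightSpace_le_genWeightSpace V (μ : H → K)
  -- The part of the lattice in each weight space is free, as O is a principal ideal domain. The
  -- lattice is spanned by weight vectors and so is the sum of these parts; their bases together
  -- give a K-basis of V in which lattice elements have coordinates in O.
  let M : ∀ μ, Submodule O (W μ) := fun μ =>
    (Submodule.span O T).comap ((W μ).subtype.restrictScalars O)
  have hM : ∀ μ (x : W μ), x ∈ M μ ↔ (x : V) ∈ Submodule.span O T := fun μ x => Iff.rfl
  have hlat : ∀ μ, (M μ).IsLattice K := by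
    intro μ
    refine ⟨?_, ?_⟩
    · let f : M μ →ₗ[O] Submodule.span O T :=
        (((W μ).subtype.restrictScalars O).comp (M μ).subtype).codRestrict _ fun x => x.2
      have hf : Function.Injective f := fun x y hxy => by
        have := congrArg Subtype.val hxy
        exact Subtype.ext (Subtype.ext this)
      have := isNoetherian_of_injective f hf
      exact Module.Finite.iff_fg.mp inferInstance
    · rw [eq_top_iff]
      rintro ⟨x, hx⟩ -
      have h1 : ∀ x ∈ Submodule.span K T, ∃ d : O, d ≠ 0 ∧ d • x ∈ Submodule.span O T := by
        intro x hx
        induction hx using Submodule.span_induction with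
        | mem x hx => exact ⟨1, one_ne_zero, by simpa using Submodule.subset_span hx⟩
        | zero => exact ⟨1, one_ne_zero, by simp⟩
        | add x y _ _ hx hy =>
          obtain ⟨d, hd, hdx⟩ := hx
          obtain ⟨d', hd', hdx'⟩ := hy
          refine ⟨d * d', mul_ne_zero hd hd', ?_⟩
          rw [smul_add]
          refine add_mem ?_ ?_
          · rw [mul_comm, mul_smul]; exact Submodule.smul_mem _ _ hdx
          · rw [mul_smul]; exact Submodule.smul_mem _ _ hdx'
        | smul c x _ hx =>
          obtain ⟨d, hd, hdx⟩ := hx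
          obtain ⟨r, s, hs, rfl⟩ := IsFractionRing.div_surjective (A := O) c
          refine ⟨s * d, mul_ne_zero (nonZeroDivisors.ne_zero hs) hd, ?_⟩
          have h2 : algebraMap O K s ≠ 0 := by
            simpa using nonZeroDivisors.ne_zero hs
          have h3 : (s * d) • (algebraMap O K r / algebraMap O K s) • x = r • d • x := by
            rw [← algebraMap_smul K (s * d), ← algebraMap_smul K r, ← algebraMap_smul K d, smul_smul,
              smul_smul, map_mul]
            congr 1
            field_simp
          rw [h3]
          exact Submodule.smul_mem _ _ hdx
      obtain ⟨d, hd, hdx⟩ := h1 x (hTs ▸ trivial)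
      have h2 : d • (⟨x, hx⟩ : W μ) ∈ Submodule.span K (M μ : Set (W μ)) :=
        Submodule.subset_span ((hM μ _).mpr hdx)
      rw [← algebraMap_smul K d] at h2
      exact (Submodule.smul_mem_iff _ (by simpa using hd)).mp h2
  have hfree : ∀ μ, Module.Free O (M μ) := fun μ => by
    have h0 : Module.IsTorsionFree O K := inferInstance
    have h1 : Module.IsTorsionFree O (W μ) := Module.IsTorsionFree.trans_faithfulSMul O K (W μ)
    infer_instance
  let e : ∀ μ, Basis (Module.Free.ChooseBasisIndex O (M μ)) K (W μ) := fun μ =>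
    (Module.Free.chooseBasis O (M μ)).extendOfIsLattice K
  let v₀ := hW.collectedBasis e
  have : Finite (Σ μ, Module.Free.ChooseBasisIndex O (M μ)) := Module.Finite.finite_basis v₀
  obtain ⟨n, ⟨σ⟩⟩ := Finite.exists_equiv_fin (Σ μ, Module.Free.ChooseBasisIndex O (M μ))
  have hv₀ : ∀ i, v₀ i = ((e i.1 i.2 : W i.1) : V) := fun i => by
    rw [hW.collectedBasis_coe]
  have hv₀' : ∀ i, v₀ i ∈ Submodule.span O T := fun i => by
    rw [hv₀, Basis.extendOfIsLattice_apply]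
    exact (Module.Free.chooseBasis O (M i.1) i.2).2
  have hspan : Submodule.span O T ≤ Submodule.span O (Set.range v₀) := by
    refine Submodule.span_le.mpr fun t ht => ?_
    obtain ⟨μ, hμ⟩ := hTw t ht
    let t' : M μ := ⟨⟨t, hμ⟩, Submodule.subset_span ht⟩
    have h1 := (Module.Free.chooseBasis O (M μ)).mem_span t'
    have h2 := Submodule.mem_map_of_mem
      (f := ((W μ).subtype.restrictScalars O).comp (M μ).subtype) h1
    rw [Submodule.map_span] at h2
    refine Submodule.span_mono ?_ h2
    rintro _ ⟨_, ⟨k, rfl⟩, rfl⟩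
    refine ⟨⟨μ, k⟩, ?_⟩
    rw [hv₀, Basis.extendOfIsLattice_apply]
    rfl
  have hcoord : ∀ x ∈ Submodule.span O T, ∀ i, ∃ a : O, v₀.repr x i = algebraMap O K a := by
    intro x hx i
    have h1 := hspan hx
    clear hx
    induction h1 using Submodule.span_induction with
    | mem x hx =>
      obtain ⟨j, rfl⟩ := hx
      by_cases h : j = i
      · exact ⟨1, by simp [h]⟩
      · exact ⟨0, by simp [h]⟩
    | zero => exact ⟨0, by simp⟩
    | add x y _ _ hx hy =>
      obtain ⟨a, ha⟩ := hx
      obtain ⟨c, hc⟩ := hy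
      exact ⟨a + c, by simp [ha, hc]⟩
    | smul r x _ hx =>
      obtain ⟨a, ha⟩ := hx
      refine ⟨r * a, ?_⟩
      rw [← algebraMap_smul K r x, map_smul, Finsupp.smul_apply, ha, map_mul, smul_eq_mul]
  refine ⟨n, v₀.reindex σ, fun i => (σ.symm i).1, fun i => ?_, fun α i j => ?_⟩
  · rw [Basis.reindex_apply, hv₀]
    exact (e _ _).2
  · rw [Basis.reindex_apply, Basis.repr_reindex_apply]
    exact hcoord _ (hTX α _ (hv₀' _)) _

end IsChevalleySystem

end Lattice

/-! ## Filtered rings -/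

section FilteredRing

/-- A complete separated filtration of a ring in which multiplication by `p` raises degrees by
exactly `h`, and the integers prime to `p` act invertibly. -/
structure IsPadicFiltration {E : Type*} [Ring E] (p h : ℕ) (A : ℤ → AddSubgroup E) : Prop where
  anti : Antitone A
  protected one_mem : (1 : E) ∈ A 0
  protected mul_mem : ∀ {m n : ℤ} {x y : E}, x ∈ A m → y ∈ A n → x * y ∈ A (m + n)
  prime_mul_mem_iff : ∀ {m : ℤ} {x : E}, (p : E) * x ∈ A (m + h) ↔ x ∈ A m
  eq_zero_of_forall : ∀ x : E, (∀ m, x ∈ A m) → x = 0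
  complete : ∀ (d : ℤ) (x : ℕ → E), (∀ n : ℕ, x (n + 1) - x n ∈ A (n - d)) →
    ∃ y, ∀ n : ℕ, y - x n ∈ A (n - d)
  mem_of_coprime : ∀ {u : ℕ}, u.Coprime p → ∀ {m : ℤ} {x : E}, (u : E) * x ∈ A m → x ∈ A m

lemma IsFracFiltration.isPadicFiltration {K : Type*} [Field K] {p h : ℕ} {P : ℤ → AddSubgroup K}
    (hP : IsFracFiltration p h P) : IsPadicFiltration p h P where
  anti := hP.anti
  one_mem := hP.one_mem
  mul_mem := hP.mul_mem
  prime_mul_mem_iff := hP.prime_mul_mem_iff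
  eq_zero_of_forall := hP.eq_zero_of_forall
  complete := hP.complete
  mem_of_coprime := hP.mem_of_coprime

/-- A lower bound for the filtration degree of `x ^ k / k!`, where `x` has degree at least `m`. -/
def expRate (p h : ℕ) (m : ℤ) (k : ℕ) : ℤ := k * m - (((k - 1) * h / (p - 1) : ℕ) : ℤ)

section Rate

variable {p h : ℕ}

@[simp] lemma expRate_zero (m : ℤ) : expRate p h m 0 = 0 := by simp [expRate]

@[simp] lemma expRate_one (m : ℤ) : expRate p h m 1 = m := by simp [expRate]

/-- The loss caused by the denominators is superadditive; hence Cauchy products of series obeying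
the bound obey it again. -/
lemma expRate_add_le (m : ℤ) (j k : ℕ) :
    expRate p h m (j + k) ≤ expRate p h m j + expRate p h m k := by
  rcases Nat.eq_zero_or_pos j with rfl | hj
  · simp
  rcases Nat.eq_zero_or_pos k with rfl | hk
  · simp
  have h1 := Nat.div_add_div_le_add_div (x := (j - 1) * h) (y := (k - 1) * h) (z := p - 1)
  have h2 : (j - 1) * h + (k - 1) * h ≤ (j + k - 1) * h := by
    rw [← add_mul]; exact Nat.mul_le_mul_right _ (by omega)
  have h3 := h1.trans (Nat.div_le_div_right (c := p - 1) h2)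
  have h4 : (((j - 1) * h / (p - 1) : ℕ) : ℤ) + (((k - 1) * h / (p - 1) : ℕ) : ℤ)
    ≤ (((j + k - 1) * h / (p - 1) : ℕ) : ℤ) := by exact_mod_cast h3
  unfold expRate
  push_cast [-Int.natCast_ediv] at h4 ⊢
  linarith

/-- One more factor adds m ≥ 1 to the degree, while the loss grows by at most one because h < p - 1.
-/
lemma expRate_mono (hp : h < p - 1) {m : ℤ} (hm : 1 ≤ m) : Monotone (expRate p h m) := by
  refine monotone_nat_of_le_succ fun k => ?_
  have h1 : k * h ≤ (k - 1) * h + (p - 1) := by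
    rcases k with _ | k
    · simp
    · rw [Nat.add_sub_cancel, add_mul]; omega
  have h2 := Nat.div_le_div_right (c := p - 1) h1
  rw [Nat.add_div_right _ (by omega)] at h2
  have h3 : ((k * h / (p - 1) : ℕ) : ℤ) ≤ (((k - 1) * h / (p - 1) : ℕ) : ℤ) + 1 := by
    exact_mod_cast h2
  unfold expRate
  rw [Nat.add_sub_cancel]
  push_cast [-Int.natCast_ediv] at h3 ⊢
  linarith

/-- The loss is at most k - 2. This strict gain is what gives exp x ≡ 1 + x to first order, and it
is the main use of h < p - 1. -/
lemma lt_expRate (hp : h < p - 1) {m : ℤ} (hm : 1 ≤ m) {k : ℕ} (hk : 2 ≤ k) :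
    m + 1 ≤ expRate p h m k := by
  have h1 : (k - 1) * h / (p - 1) < k - 1 := by
    refine Nat.div_lt_of_lt_mul ?_
    rw [mul_comm]
    exact Nat.mul_lt_mul_of_pos_right hp (by omega)
  have h2 : (((k - 1) * h / (p - 1) : ℕ) : ℤ) ≤ k - 2 := by omega
  unfold expRate
  have h3 : (0 : ℤ) ≤ (k - 1) * (m - 1) := mul_nonneg (by omega) (by omega)
  linarith

lemma le_expRate (hp : h < p - 1) {m : ℤ} (hm : 1 ≤ m) {k : ℕ} (hk : 1 ≤ k) :
    m ≤ expRate p h m k := by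
  have := expRate_mono hp hm hk
  rwa [expRate_one] at this

lemma exists_le_expRate (hp : h < p - 1) {m : ℤ} (hm : 1 ≤ m) (D : ℤ) :
    ∃ k, D ≤ expRate p h m k := by
  -- For k = (p - 1) D and h ≤ p - 2 the loss is at most k(p - 2)/(p - 1) = k - D.
  refine ⟨(p - 1) * D.toNat, ?_⟩
  set q := p - 1 with hq
  set k := q * D.toNat with hk
  have h1 : (k - 1) * h / q ≤ k - D.toNat := by
    refine Nat.div_le_of_le_mul ?_
    rcases Nat.eq_zero_or_pos k with h0 | h0
    · simp [h0]
    have h3 : (k - 1) * h ≤ k * (q - 1) := Nat.mul_le_mul (by omega) (by omega)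
    have h2 : q * (k - D.toNat) = k * (q - 1) := by
      rw [Nat.mul_sub, Nat.mul_sub, ← hk, mul_one, mul_comm]
    omega
  have h2 : D.toNat ≤ k := Nat.le_mul_of_pos_left _ (by omega)
  have h3 : (((k - 1) * h / q : ℕ) : ℤ) ≤ k - D.toNat := by omega
  unfold expRate
  have : (k : ℤ) * 1 ≤ k * m := mul_le_mul_of_nonneg_left hm (by omega)
  have := Int.self_le_toNat D
  linarith

/-- This controls the substitution of w X^n into the exponential series when w has degree at least
`expRate p h m n`. -/
lemma expRate_mul_le (m : ℤ) {n : ℕ} (hn : 1 ≤ n) (k : ℕ) :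
    expRate p h m (n * k) ≤ expRate p h (expRate p h m n) k := by
  rcases Nat.eq_zero_or_pos k with rfl | hk
  · simp
  have h1 : k * ((n - 1) * h / (p - 1)) ≤ (k * ((n - 1) * h)) / (p - 1) :=
    Nat.mul_div_le_mul_div_assoc _ _ _
  have h2 := Nat.div_add_div_le_add_div (x := k * ((n - 1) * h)) (y := (k - 1) * h) (z := p - 1)
  have h3 : k * ((n - 1) * h) + (k - 1) * h = (n * k - 1) * h := by
    obtain ⟨n, rfl⟩ := Nat.exists_eq_add_of_le' hn
    obtain ⟨k, rfl⟩ := Nat.exists_eq_add_of_le' hk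
    have : (n + 1) * (k + 1) - 1 = (k + 1) * n + k := by
      rw [Nat.sub_eq_iff_eq_add (Nat.mul_pos (by omega) (by omega))]; ring
    rw [this]
    simp only [Nat.add_sub_cancel]
    ring
  rw [h3] at h2
  have h4 : (k : ℤ) * (((n - 1) * h / (p - 1) : ℕ) : ℤ) + (((k - 1) * h / (p - 1) : ℕ) : ℤ)
      ≤ (((n * k - 1) * h / (p - 1) : ℕ) : ℤ) := by
    exact_mod_cast (add_le_add_left h1 _).trans h2
  unfold expRate
  have h5 : ((n * k : ℕ) : ℤ) * m = k * (n * m) := by push_cast; ring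
  rw [h5, mul_sub]
  linarith

end Rate

namespace IsPadicFiltration

variable {K E : Type*} [Field K] [CharZero K] [Ring E] [Algebra K E] {p h : ℕ}
  {A : ℤ → AddSubgroup E} (hA : IsPadicFiltration p h A)
include hA

lemma mul_mem_zero_left {m : ℤ} {x y : E} (hx : x ∈ A 0) (hy : y ∈ A m) : x * y ∈ A m := by
  simpa using hA.mul_mem hx hy

lemma mul_mem_zero_right {m : ℤ} {x y : E} (hx : x ∈ A m) (hy : y ∈ A 0) : x * y ∈ A m := by
  simpa using hA.mul_mem hx hy

protected lemma pow_mem {m : ℤ} {x : E} (hx : x ∈ A m) (k : ℕ) : x ^ k ∈ A (k * m) := by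
  induction k with
  | zero => simpa using hA.one_mem
  | succ k ih =>
    rw [pow_succ]
    have := hA.mul_mem ih hx
    convert this using 2
    push_cast; ring

lemma zero_of_one_add {m : ℤ} (hm : 0 ≤ m) {x : E} (hx : x - 1 ∈ A m) : x ∈ A 0 := by
  have := add_mem (hA.anti hm hx) hA.one_mem
  simpa using this

lemma mem_of_prime_pow_mul {m : ℤ} {x : E} {n : ℕ} (hx : ((p ^ n : ℕ) : E) * x ∈ A m) :
    x ∈ A (m - n * h) := by
  induction n generalizing x with
  | zero => simpa using hx
  | succ n ih =>
    have h1 := ih (x := (p : E) * x) (by simpa [pow_succ, mul_assoc] using hx)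
    rw [← hA.prime_mul_mem_iff]
    convert h1 using 2
    push_cast; ring

/-- By Legendre's formula (p - 1) v_p(k!) = k - s_p(k) ≤ k - 1, where s_p is the sum of the p-adic
digits. Each factor p in the denominator costs h, and the part of k! prime to p costs nothing. -/
lemma inv_factorial_smul_mem [Fact p.Prime] {m : ℤ} {x : E} (hx : x ∈ A m) {k : ℕ} (hk : 1 ≤ k) :
    (k.factorial : K)⁻¹ • x ∈ A (m - (((k - 1) * h / (p - 1) : ℕ) : ℤ)) := by
  have hp : 1 < p := (Fact.out : p.Prime).one_lt
  set n := padicValNat p k.factorial with hn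
  set y := (k.factorial : K)⁻¹ • x with hy
  have hxy : (k.factorial : E) * y = x := by
    rw [hy, ← map_natCast (algebraMap K E), ← Algebra.smul_def,
      smul_inv_smul₀ (Nat.cast_ne_zero.mpr k.factorial_ne_zero)]
  have h1 : (p - 1) * n ≤ k - 1 := by
    rw [hn, sub_one_mul_padicValNat_factorial]
    have : (p.digits k).sum ≠ 0 := by
      rw [Ne, List.sum_eq_zero_iff]
      exact fun h0 => Nat.getLast_digit_ne_zero p (by omega)
        (h0 _ (List.getLast_mem (Nat.digits_ne_nil_iff_ne_zero.mpr (by omega))))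
    omega
  obtain ⟨u, hu⟩ := pow_padicValNat_dvd (p := p) (n := k.factorial)
  rw [← hn] at hu
  have hcop : u.Coprime p := by
    rw [Nat.coprime_comm, Nat.Prime.coprime_iff_not_dvd Fact.out]
    rintro ⟨v, rfl⟩
    have : p ^ (n + 1) ∣ k.factorial := ⟨v, by rw [hu]; ring⟩
    exact pow_succ_padicValNat_not_dvd k.factorial_ne_zero this
  have h2 : ((p ^ n : ℕ) : E) * y ∈ A m := by
    refine hA.mem_of_coprime hcop ?_
    rw [← mul_assoc, ← Nat.cast_mul, mul_comm u, ← hu, hxy]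
    exact hx
  refine hA.anti ?_ (hA.mem_of_prime_pow_mul h2)
  have h3 : n * h ≤ (k - 1) * h / (p - 1) := by
    rw [Nat.le_div_iff_mul_le (by omega)]
    calc n * h * (p - 1) = ((p - 1) * n) * h := by ring
      _ ≤ _ := Nat.mul_le_mul_right _ h1
  have : ((n * h : ℕ) : ℤ) ≤ (((k - 1) * h / (p - 1) : ℕ) : ℤ) := by exact_mod_cast h3
  push_cast [-Int.natCast_ediv] at this
  linarith

lemma inv_factorial_smul_pow_mem [Fact p.Prime] {m : ℤ} {x : E} (hx : x ∈ A m) (k : ℕ) :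
    (k.factorial : K)⁻¹ • x ^ k ∈ A (expRate p h m k) := by
  rcases Nat.eq_zero_or_pos k with rfl | hk
  · simpa using hA.one_mem
  · exact hA.inv_factorial_smul_mem (hA.pow_mem hx k) hk

lemma eq_of_forall {x y : E} (hxy : ∀ D, x - y ∈ A D) : x = y :=
  sub_eq_zero.mp (hA.eq_zero_of_forall _ hxy)

/-- Successive approximation: an element `s` is a value of `f` on `L N` as soon as `f` is, to first
order, additive along a complete filtration `L`, and `s` can be improved step by step. -/
lemma exists_eq_of_approx {M : Type*} [AddCommGroup M] {L : ℤ → AddSubgroup M}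
    (hLanti : Antitone L)
    (hLc : ∀ (d : ℤ) (x : ℕ → M), (∀ n : ℕ, x (n + 1) - x n ∈ L (n - d)) →
      ∃ y, ∀ n : ℕ, y - x n ∈ L (n - d))
    {f φ : M → E} (hφ : ∀ {n : ℤ} {x}, x ∈ L n → φ x ∈ A n)
    (hf : ∀ {n : ℤ}, 1 ≤ n → ∀ {a x}, a ∈ L 1 → x ∈ L n → f (a + x) - f a - φ x ∈ A (n + 1))
    {N : ℤ} (hN : 1 ≤ N) {s : E} (h0 : s - f 0 ∈ A N)
    (hs : ∀ {n : ℤ}, N ≤ n → ∀ {y}, y ∈ L N → s - f y ∈ A n →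
      ∃ x ∈ L n, s - f y - φ x ∈ A (n + 1)) : ∃ y ∈ L N, s = f y := by
  have hstep : ∀ n : ℕ, ∀ y : {y : M // y ∈ L N ∧ s - f y ∈ A (N + n)},
      ∃ y' : {y : M // y ∈ L N ∧ s - f y ∈ A (N + (n + 1 : ℕ))}, y'.1 - y.1 ∈ L (N + n) := by
    rintro n ⟨y, hy, hsy⟩
    obtain ⟨x, hx, hsx⟩ := hs (by omega) hy hsy
    refine ⟨⟨y + x, add_mem hy (hLanti (by omega) hx), ?_⟩, by simpa using hx⟩
    have h1 := hf (by omega) (hLanti hN hy) hx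
    have : s - f (y + x) = (s - f y - φ x) - (f (y + x) - f y - φ x) := by abel
    rw [this]
    have h2 := sub_mem hsx h1
    rwa [add_assoc] at h2
  choose g hg using hstep
  -- The approximants are built recursively; the n-th one solves the equation modulo degree N + n,
  -- and completeness of L supplies the limit.
  let Y : ∀ n : ℕ, {y : M // y ∈ L N ∧ s - f y ∈ A (N + n)} := fun n =>
    Nat.rec ⟨0, zero_mem _, by simpa using h0⟩ (fun n y => g n y) n
  have hY : ∀ n : ℕ, (Y (n + 1)).1 - (Y n).1 ∈ L (N + n) := fun n => hg n (Y n)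
  obtain ⟨y, hy⟩ := hLc (-N) (fun n => (Y n).1) fun n => by
    exact hLanti (by omega) (hY n)
  have hy' : ∀ n : ℕ, y - (Y n).1 ∈ L (N + n) := fun n => by
    exact hLanti (by omega) (hy n)
  have hyN : y ∈ L N := by
    have := add_mem (hLanti (by simp) (hy' 0)) (Y 0).2.1
    simpa using this
  refine ⟨y, hyN, hA.eq_of_forall fun D => ?_⟩
  have h1 : s - f y ∈ A (N + D.toNat) := by
    have h2 := hf (n := N + D.toNat) (by omega) (hLanti hN (Y D.toNat).2.1) (hy' D.toNat)
    rw [add_sub_cancel] at h2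
    have h3 := add_mem (hA.anti (by omega) h2) (hφ (hy' D.toNat))
    have h4 := sub_mem (Y D.toNat).2.2 h3
    convert h4 using 1
    abel
  exact hA.anti (by have := Int.self_le_toNat D; omega) h1

end IsPadicFiltration

end FilteredRing

/-! ## Formal exponentials -/

section FormalExp

namespace PowerSeries

variable {E : Type*} [Ring E]

/-- The Euler operator `X d/dX`. -/
noncomputable def euler (f : PowerSeries E) : PowerSeries E := mk fun k => k • coeff k f

@[simp] lemma coeff_euler (f : PowerSeries E) (k : ℕ) : coeff k (euler f) = k • coeff k f :=
  coeff_mk _ _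

lemma euler_mul (f g : PowerSeries E) : euler (f * g) = euler f * g + f * euler g := by
  ext k
  simp only [coeff_euler, coeff_mul, map_add]
  rw [Finset.smul_sum, ← Finset.sum_add_distrib]
  refine Finset.sum_congr rfl fun ij hij => ?_
  rw [← Finset.HasAntidiagonal.mem_antidiagonal.mp hij, add_smul, smul_mul_assoc, mul_smul_comm]

@[simp] lemma euler_C (a : E) : euler (C a) = 0 := by
  ext k
  rcases k with _ | k <;> simp [coeff_C]

lemma coeff_mul_of_forall_lt {f g : PowerSeries E} {k : ℕ} (hk : 1 ≤ k)
    (hf : ∀ i, 1 ≤ i → i < k → coeff i f = 0) :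
    coeff k (f * g) = coeff 0 f * coeff k g + coeff k f * coeff 0 g := by
  obtain ⟨k, rfl⟩ := Nat.exists_eq_add_of_le' hk
  rw [coeff_mul, Finset.Nat.sum_antidiagonal_eq_sum_range_succ_mk, Finset.sum_range_succ,
    Finset.sum_range_succ', Finset.sum_eq_zero, zero_add]
  · simp
  · intro i hi
    rw [hf (i + 1) (by omega) (by have := Finset.mem_range.mp hi; omega), zero_mul]

variable (K : Type*) [Field K] [CharZero K] [Algebra K E]

/-- The formal exponential `exp (w X ^ n)`. -/
noncomputable def formalExp (n : ℕ) (w : E) : PowerSeries E :=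
  mk fun k => if n ∣ k then ((k / n).factorial : K)⁻¹ • w ^ (k / n) else 0

variable {n : ℕ} (hn : 1 ≤ n) (w : E)
include hn

lemma coeff_formalExp_mul (i : ℕ) :
    coeff (n * i) (formalExp K n w) = (i.factorial : K)⁻¹ • w ^ i := by
  rw [formalExp, coeff_mk, if_pos (dvd_mul_right n i), Nat.mul_div_cancel_left _ hn]

lemma coeff_formalExp_of_not_dvd {k : ℕ} (hk : ¬ n ∣ k) : coeff k (formalExp K n w) = 0 := by
  rw [formalExp, coeff_mk, if_neg hk]

@[simp] lemma coeff_zero_formalExp : coeff 0 (formalExp K n w) = 1 := by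
  simp [formalExp]

@[simp] lemma coeff_self_formalExp : coeff n (formalExp K n w) = w := by
  have := coeff_formalExp_mul K hn w 1
  simpa using this

lemma coeff_formalExp_of_lt {i : ℕ} (hi : 1 ≤ i) (hin : i < n) :
    coeff i (formalExp K n w) = 0 :=
  coeff_formalExp_of_not_dvd K hn w fun h => absurd (Nat.le_of_dvd hi h) (by omega)

lemma euler_formalExp :
    euler (formalExp K n w) = X ^ n * (C (n • w) * formalExp K n w) := by
  ext k
  rw [coeff_euler, coeff_X_pow_mul']
  split_ifs with hk
  · obtain ⟨j, rfl⟩ := Nat.exists_eq_add_of_le' hk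
    rw [Nat.add_sub_cancel, coeff_C_mul]
    by_cases hj : n ∣ j
    · obtain ⟨i, rfl⟩ := hj
      rw [← mul_add_one, coeff_formalExp_mul K hn, coeff_formalExp_mul K hn, Nat.factorial_succ,
        ← Nat.cast_smul_eq_nsmul K, ← Nat.cast_smul_eq_nsmul K, smul_smul, smul_mul_smul_comm,
        pow_succ']
      congr 1
      have : (i.factorial : K) ≠ 0 := Nat.cast_ne_zero.mpr i.factorial_ne_zero
      have : (i + 1 : K) ≠ 0 := by exact_mod_cast i.succ_ne_zero
      push_cast
      field_simp
    · rw [coeff_formalExp_of_not_dvd K hn _ hj, mul_zero, coeff_formalExp_of_not_dvd K hn _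
        (by simpa using hj), smul_zero]
  · rcases Nat.eq_zero_or_pos k with rfl | h0
    · simp
    · rw [coeff_formalExp_of_lt K hn w h0 (by omega), smul_zero]

lemma commute_C_formalExp {a : E} (ha : Commute a w) : Commute (C a) (formalExp K n w) := by
  ext k
  rw [coeff_C_mul, coeff_mul_C]
  by_cases hk : n ∣ k
  · obtain ⟨i, rfl⟩ := hk
    rw [coeff_formalExp_mul K hn]
    exact ((ha.pow_right i).smul_right _).eq
  · rw [coeff_formalExp_of_not_dvd K hn _ hk, mul_zero, zero_mul]

/-- A linear differential equation for the conjugate. Only the product rule and commutation with w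
enter, so it can be used below to prove that the two outer factors are inverse to each other. -/
lemma euler_conj (u : PowerSeries E) :
    euler (formalExp K n w * u * formalExp K n (-w)) =
      formalExp K n w * euler u * formalExp K n (-w)
      + X ^ n * (C (n • w) * (formalExp K n w * u * formalExp K n (-w))
        - formalExp K n w * u * formalExp K n (-w) * C (n • w)) := by
  have h1 : C (n • w) * formalExp K n (-w) = formalExp K n (-w) * C (n • w) :=
    commute_C_formalExp K hn (-w) (((Commute.refl w).neg_right).smul_left n)
  have h2 : ∀ a b c : PowerSeries E, a * (X ^ n * b) * c = X ^ n * (a * b * c) := by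
    intro a b c
    rw [← mul_assoc, (commute_X_pow a n).eq]
    simp only [mul_assoc]
  rw [euler_mul, euler_mul, euler_formalExp K hn, euler_formalExp K hn, smul_neg, map_neg]
  have h3 : formalExp K n w * u * (X ^ n * (-C (n • w) * formalExp K n (-w)))
      = - (X ^ n * (formalExp K n w * u * formalExp K n (-w) * C (n • w))) := by
    rw [neg_mul, h1]
    have := h2 (formalExp K n w * u) (formalExp K n (-w) * C (n • w)) 1
    simp only [mul_one, mul_assoc] at this ⊢
    simp only [mul_neg, this]
  rw [h3]
  simp only [mul_sub, add_mul, mul_assoc]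
  abel

/-- The case u = 1 of `euler_conj`: the product commutes with w, so its Euler derivative vanishes,
and in characteristic zero it equals its constant term 1. -/
lemma formalExp_mul_neg : formalExp K n w * formalExp K n (-w) = 1 := by
  have hu := euler_conj K hn w 1
  have h0 : euler (1 : PowerSeries E) = 0 := by rw [← map_one C, euler_C]
  rw [h0, mul_zero, zero_mul, zero_add, mul_one] at hu
  set u := formalExp K n w * formalExp K n (-w) with hu'
  have hc : C (n • w) * u = u * C (n • w) := by
    have h1 := commute_C_formalExp K hn w (((Commute.refl w)).smul_left n)
    have h2 := commute_C_formalExp K hn (-w) (((Commute.refl w).neg_right).smul_left n)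
    exact (h1.mul_right h2).eq
  rw [hc, sub_self, mul_zero] at hu
  ext k
  rcases Nat.eq_zero_or_pos k with rfl | hk
  · simp [hu', coeff_mul, hn]
  · have := congrArg (coeff k) hu
    rw [coeff_euler, ← Nat.cast_smul_eq_nsmul K, map_zero, smul_eq_zero] at this
    rw [coeff_one, if_neg hk.ne']
    exact this.resolve_left (Nat.cast_ne_zero.mpr hk.ne')

variable {𝔤 : Submodule K E} (h𝔤 : ∀ x ∈ 𝔤, ∀ y ∈ 𝔤, x * y - y * x ∈ 𝔤)
include h𝔤

/-- The differential equation expresses k times the k-th coefficient as a commutator of n w with the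
coefficient of index k - n. By induction the formal adjoint action of exp(w X^n) preserves 𝔤[[X]].
-/
lemma coeff_conj_C_mem {w v : E} (hw : w ∈ 𝔤) (hv : v ∈ 𝔤) (k : ℕ) :
    coeff k (formalExp K n w * C v * formalExp K n (-w)) ∈ 𝔤 := by
  have hu := euler_conj K hn w (C v)
  set u := formalExp K n w * C v * formalExp K n (-w) with hu'
  rw [euler_C, mul_zero, zero_mul, zero_add] at hu
  induction k using Nat.strong_induction_on with | _ k ih
  rcases Nat.eq_zero_or_pos k with rfl | hk
  · have : coeff 0 u = v := by simp [hu', coeff_mul, hn]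
    rwa [this]
  have h1 := congrArg (coeff k) hu
  rw [coeff_euler, coeff_X_pow_mul', ← Nat.cast_smul_eq_nsmul K] at h1
  have hk0 : (k : K) ≠ 0 := Nat.cast_ne_zero.mpr hk.ne'
  rw [← inv_smul_smul₀ hk0 (coeff k u), h1]
  refine 𝔤.smul_mem _ ?_
  split_ifs with hnk
  · rw [map_sub, coeff_C_mul, coeff_mul_C]
    exact h𝔤 _ (nsmul_mem hw n) _ (ih _ (by omega))
  · exact zero_mem _

lemma coeff_conj_mem {w : E} (hw : w ∈ 𝔤) {u : PowerSeries E} (hu : ∀ k, coeff k u ∈ 𝔤) (k : ℕ) :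
    coeff k (formalExp K n w * u * formalExp K n (-w)) ∈ 𝔤 := by
  induction k generalizing u with
  | zero => simpa [coeff_mul, hn] using hu 0
  | succ k ih =>
    rw [eq_X_mul_shift_add_const u, mul_add, add_mul, map_add]
    refine add_mem ?_ (coeff_conj_C_mem K hn h𝔤 hw (by simpa using hu 0) _)
    rw [← mul_assoc, (commute_X (formalExp K n w)).eq, mul_assoc X, mul_assoc X, coeff_succ_X_mul]
    exact ih fun k => by simpa using hu (k + 1)

end PowerSeries

end FormalExp

/-! ## Exponentials in filtered rings -/

section Exponentials

/-- `s` is the value at `1` of the power series `f`, whose coefficients have degrees at least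
`c k`. -/
def HasValue {E : Type*} [Ring E] (A : ℤ → AddSubgroup E) (c : ℕ → ℤ) (f : PowerSeries E) (s : E) :
    Prop :=
  ∀ N, s - ∑ k ∈ Finset.range N, PowerSeries.coeff k f ∈ A (c N)

/-- `s = exp x`. -/
def IsExp (K : Type*) {E : Type*} [Field K] [Ring E] [Algebra K E] (p h : ℕ)
    (A : ℤ → AddSubgroup E) (x s : E) : Prop :=
  ∀ N, s - ∑ k ∈ Finset.range N, (k.factorial : K)⁻¹ • x ^ k ∈ A (expRate p h 1 N)

namespace IsPadicFiltration

variable {K E : Type*} [Field K] [CharZero K] [Ring E] [Algebra K E] {p h : ℕ} [Fact p.Prime]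
  {A : ℤ → AddSubgroup E} (hA : IsPadicFiltration p h A) (hp : h < p - 1)
include hA hp

lemma hasValue_unique {m : ℤ} (hm : 1 ≤ m) {f : PowerSeries E} {s t : E}
    (hs : HasValue A (expRate p h m) f s) (ht : HasValue A (expRate p h m) f t) : s = t := by
  refine hA.eq_of_forall fun D => ?_
  obtain ⟨N, hN⟩ := exists_le_expRate hp hm D
  have := sub_mem (hs N) (ht N)
  rw [sub_sub_sub_cancel_right] at this
  exact hA.anti hN this

/-- The error of the truncated Cauchy product splits into the error for s times t, and the
coefficients of f times the tails for t. Subadditivity of `expRate` bounds the latter. -/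
lemma hasValue_mul {m : ℤ} {f g : PowerSeries E} {s t : E}
    (hs : HasValue A (expRate p h m) f s) (ht : HasValue A (expRate p h m) g t)
    (hf : ∀ k, PowerSeries.coeff k f ∈ A (expRate p h m k)) :
    HasValue A (expRate p h m) (f * g) (s * t) := by
  intro N
  have ht0 : t ∈ A 0 := by simpa using ht 0
  have h1 : ∑ k ∈ Finset.range N, PowerSeries.coeff k (f * g)
      = ∑ i ∈ Finset.range N, PowerSeries.coeff i f *
          ∑ j ∈ Finset.range (N - i), PowerSeries.coeff j g := by
    simp only [PowerSeries.coeff_mul, Finset.Nat.sum_antidiagonal_eq_sum_range_succ_mk,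
      Finset.mul_sum]
    exact Finset.sum_range_diag_flip N fun i j => PowerSeries.coeff i f * PowerSeries.coeff j g
  have h2 : s * t - ∑ k ∈ Finset.range N, PowerSeries.coeff k (f * g)
      = (s - ∑ i ∈ Finset.range N, PowerSeries.coeff i f) * t
        + ∑ i ∈ Finset.range N, PowerSeries.coeff i f *
          (t - ∑ j ∈ Finset.range (N - i), PowerSeries.coeff j g) := by
    simp only [h1, mul_sub, sub_mul, Finset.sum_sub_distrib, Finset.sum_mul]
    abel
  rw [h2]
  refine add_mem (hA.mul_mem_zero_right (hs N) ht0) (sum_mem fun i hi => ?_)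
  refine hA.anti ?_ (hA.mul_mem (hf i) (ht (N - i)))
  have := expRate_add_le (p := p) (h := h) m i (N - i)
  rwa [Nat.add_sub_cancel' (Finset.mem_range.mp hi).le] at this

lemma hasValue_one {m : ℤ} : HasValue A (expRate p h m) (1 : PowerSeries E) 1 := by
  intro N
  rcases Nat.eq_zero_or_pos N with rfl | hN
  · simpa using hA.one_mem
  · have : ∑ k ∈ Finset.range N, PowerSeries.coeff k (1 : PowerSeries E) = 1 := by
      simp [PowerSeries.coeff_one, Finset.sum_ite_eq', hN]
    rw [this, sub_self]
    exact zero_mem _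

lemma coeff_formalExp_mem {m : ℤ} {n : ℕ} (hn : 1 ≤ n) {w : E} (hw : w ∈ A (expRate p h m n))
    (k : ℕ) : PowerSeries.coeff k (PowerSeries.formalExp K n w) ∈ A (expRate p h m k) := by
  by_cases hk : n ∣ k
  · obtain ⟨i, rfl⟩ := hk
    rw [PowerSeries.coeff_formalExp_mul K hn]
    exact hA.anti (expRate_mul_le m hn i) (hA.inv_factorial_smul_pow_mem hw i)
  · rw [PowerSeries.coeff_formalExp_of_not_dvd K hn _ hk]
    exact zero_mem _

/-- `IsExp` only records the convergence rate valid for elements of degree one. Summing far beyond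
N, until that error is negligible, and then discarding the extra terms recovers the sharper rate
attached to m. -/
lemma hasValue_formalExp {m : ℤ} (hm : 1 ≤ m) {n : ℕ} (hn : 1 ≤ n) {w s : E}
    (hw : w ∈ A (expRate p h m n)) (hs : IsExp K p h A w s) :
    HasValue A (expRate p h m) (PowerSeries.formalExp K n w) s := by
  have hsum : ∀ M, ∑ i ∈ Finset.range M, (i.factorial : K)⁻¹ • w ^ i
      = ∑ k ∈ Finset.range (n * M), PowerSeries.coeff k (PowerSeries.formalExp K n w) := by
    intro M
    induction M with
    | zero => simp
    | succ M ih =>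
      rw [Finset.sum_range_succ, ih, mul_add_one, Finset.sum_range_add]
      congr 1
      rw [Finset.sum_eq_single_of_mem 0 (Finset.mem_range.mpr hn), add_zero,
        PowerSeries.coeff_formalExp_mul K hn]
      intro j hj hj0
      refine PowerSeries.coeff_formalExp_of_not_dvd K hn _ fun hd => ?_
      have := Nat.le_of_dvd (by omega) ((Nat.dvd_add_right (dvd_mul_right n M)).mp hd)
      have := Finset.mem_range.mp hj
      omega
  intro N
  obtain ⟨M', hM'⟩ := exists_le_expRate hp le_rfl (expRate p h m N)
  set M := max M' N with hM
  have h1 := hs M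
  rw [hsum] at h1
  have hNM : N ≤ n * M := (le_max_right _ _).trans (Nat.le_mul_of_pos_left _ hn)
  obtain ⟨d, hd⟩ := Nat.exists_eq_add_of_le hNM
  rw [hd, Finset.sum_range_add] at h1
  have h2 := hA.anti (hM'.trans (expRate_mono hp le_rfl (le_max_left M' N))) h1
  have h3 : ∑ x ∈ Finset.range d, PowerSeries.coeff (N + x) (PowerSeries.formalExp K n w)
      ∈ A (expRate p h m N) := sum_mem fun x _ =>
    hA.anti (expRate_mono hp hm (Nat.le_add_right N x)) (hA.coeff_formalExp_mem hp hn hw _)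
  have h4 := add_mem h2 h3
  rwa [sub_add_eq_sub_sub, sub_add_cancel] at h4

lemma isExp_of_hasValue {x s : E}
    (hs : HasValue A (expRate p h 1) (PowerSeries.formalExp K 1 x) s) : IsExp K p h A x s := by
  intro N
  convert hs N using 3 with k
  have := PowerSeries.coeff_formalExp_mul K le_rfl x k
  rw [one_mul] at this
  exact this.symm

variable (K) in
lemma exists_isExp {x : E} (hx : x ∈ A 1) : ∃ s, IsExp K p h A x s := by
  -- Completeness asks for errors of degree growing like the index, whereas partial sums improve
  -- only at the slower rate `expRate`. The first `M j` terms reach degree j.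
  choose M hM using fun j : ℕ => exists_le_expRate hp (le_refl (1 : ℤ)) (j : ℤ)
  let f : ℕ → E := fun N => ∑ k ∈ Finset.range N, (k.factorial : K)⁻¹ • x ^ k
  have hf : ∀ (a b : ℕ) (D : ℤ), D ≤ expRate p h 1 a → D ≤ expRate p h 1 b →
      f b - f a ∈ A D := by
    have : ∀ (a b : ℕ) (D : ℤ), a ≤ b → D ≤ expRate p h 1 a → f b - f a ∈ A D := by
      intro a b D hab ha
      obtain ⟨d, rfl⟩ := Nat.exists_eq_add_of_le hab
      simp only [f, Finset.sum_range_add, add_sub_cancel_left]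
      exact sum_mem fun k _ => hA.anti (ha.trans (expRate_mono hp le_rfl (Nat.le_add_right a k)))
        (hA.inv_factorial_smul_pow_mem hx _)
    intro a b D ha hb
    rcases le_total a b with hab | hab
    · exact this a b D hab ha
    · rw [← neg_sub]; exact neg_mem (this b a D hab hb)
  obtain ⟨s, hs⟩ := hA.complete 0 (fun j => f (M j)) fun j => by
    refine hf _ _ _ (by simp [hM j]) ?_
    have := hM (j + 1)
    push_cast at this
    linarith
  refine ⟨s, fun N => ?_⟩
  have h1 := hs (expRate p h 1 N).toNat
  have h2 := hf N (M (expRate p h 1 N).toNat) (expRate p h 1 N) le_rfl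
    ((Int.self_le_toNat _).trans (hM _))
  have h3 := add_mem (hA.anti (by simp) h1) h2
  rwa [sub_add_sub_cancel] at h3

lemma isExp_unique {x s t : E} (hs : IsExp K p h A x s) (ht : IsExp K p h A x t) : s = t := by
  refine hA.eq_of_forall fun D => ?_
  obtain ⟨N, hN⟩ := exists_le_expRate hp (le_refl (1 : ℤ)) D
  have := sub_mem (hs N) (ht N)
  rw [sub_sub_sub_cancel_right] at this
  exact hA.anti hN this

lemma isExp_sub_mem {m : ℤ} (hm : 1 ≤ m) {x s : E} (hx : x ∈ A m) (hs : IsExp K p h A x s) :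
    s - 1 - x ∈ A (m + 1) := by
  have := hA.hasValue_formalExp hp hm le_rfl (by simpa using hx) hs 2
  simp only [Finset.sum_range_succ, Finset.sum_range_zero, zero_add,
    PowerSeries.coeff_zero_formalExp K le_rfl, PowerSeries.coeff_self_formalExp K le_rfl] at this
  rw [← sub_sub] at this
  exact hA.anti (lt_expRate hp hm le_rfl) this

lemma isExp_sub_one_mem {m : ℤ} (hm : 1 ≤ m) {x s : E} (hx : x ∈ A m) (hs : IsExp K p h A x s) :
    s - 1 ∈ A m := by
  have := add_mem (hA.anti (by omega) (hA.isExp_sub_mem hp hm hx hs)) hx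
  simpa using this

lemma isExp_zero : IsExp K p h A 0 1 :=
  hA.isExp_of_hasValue hp (by
    have : PowerSeries.formalExp K 1 (0 : E) = 1 := by
      ext k
      have := PowerSeries.coeff_formalExp_mul K le_rfl (0 : E) k
      rw [one_mul] at this
      rw [this, PowerSeries.coeff_one]
      rcases k with _ | k <;> simp
    rw [this]
    exact hA.hasValue_one hp)

lemma isExp_mul_neg {x s t : E} (hx : x ∈ A 1) (hs : IsExp K p h A x s)
    (ht : IsExp K p h A (-x) t) : s * t = 1 := by
  have hx' : x ∈ A (expRate p h 1 1) := by simpa using hx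
  have h1 := hA.hasValue_mul hp (hA.hasValue_formalExp hp le_rfl le_rfl hx' hs)
    (hA.hasValue_formalExp hp le_rfl le_rfl (neg_mem hx') ht)
    (hA.coeff_formalExp_mem hp le_rfl hx')
  rw [PowerSeries.formalExp_mul_neg K le_rfl] at h1
  exact hA.hasValue_unique hp le_rfl h1 (hA.hasValue_one hp)

variable (K) in
lemma exists_unit_isExp {x : E} (hx : x ∈ A 1) :
    ∃ s : Eˣ, IsExp K p h A x s ∧ IsExp K p h A (-x) (s⁻¹ : Eˣ) := by
  obtain ⟨s, hs⟩ := hA.exists_isExp K hp hx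
  obtain ⟨t, ht⟩ := hA.exists_isExp K hp (neg_mem hx)
  exact ⟨⟨s, t, hA.isExp_mul_neg hp hx hs ht,
    hA.isExp_mul_neg hp (neg_mem hx) ht (by rwa [neg_neg])⟩, hs, ht⟩

lemma isExp_neg {x : E} (hx : x ∈ A 1) {s : Eˣ} (hs : IsExp K p h A x s) :
    IsExp K p h A (-x) (s⁻¹ : Eˣ) := by
  obtain ⟨t, ht, ht'⟩ := hA.exists_unit_isExp K hp hx
  rwa [Units.ext (hA.isExp_unique hp hs ht)]

lemma isExp_add {x y s t : E} (hx : x ∈ A 1) (hy : y ∈ A 1) (hxy : Commute x y)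
    (hs : IsExp K p h A x s) (ht : IsExp K p h A y t) : IsExp K p h A (x + y) (s * t) := by
  have hx' : x ∈ A (expRate p h 1 1) := by simpa using hx
  have hy' : y ∈ A (expRate p h 1 1) := by simpa using hy
  have h1 := hA.hasValue_mul hp (hA.hasValue_formalExp hp le_rfl le_rfl hx' hs)
    (hA.hasValue_formalExp hp le_rfl le_rfl hy' ht)
    (hA.coeff_formalExp_mem hp le_rfl hx')
  refine hA.isExp_of_hasValue hp ?_
  have h2 : PowerSeries.formalExp K 1 (x + y)
      = PowerSeries.formalExp K 1 x * PowerSeries.formalExp K 1 y := by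
    have hc : ∀ (w : E) k, PowerSeries.coeff k (PowerSeries.formalExp K 1 w)
        = (k.factorial : K)⁻¹ • w ^ k := fun w k => by
      have := PowerSeries.coeff_formalExp_mul K le_rfl w k
      rwa [one_mul] at this
    ext k
    rw [PowerSeries.coeff_mul, hc, hxy.add_pow', Finset.smul_sum]
    refine Finset.sum_congr rfl fun ij hij => ?_
    rw [Finset.HasAntidiagonal.mem_antidiagonal] at hij
    subst hij
    rw [hc, hc, smul_mul_smul_comm, ← Nat.cast_smul_eq_nsmul K, smul_smul]
    congr 1
    rw [← Nat.add_choose_mul_factorial_mul_factorial ij.1 ij.2]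
    have h1 : (ij.1.factorial : K) ≠ 0 := Nat.cast_ne_zero.mpr ij.1.factorial_ne_zero
    have h2 : (ij.2.factorial : K) ≠ 0 := Nat.cast_ne_zero.mpr ij.2.factorial_ne_zero
    have h3 : ((ij.1 + ij.2).choose ij.1 : K) ≠ 0 :=
      Nat.cast_ne_zero.mpr (Nat.choose_pos (by omega)).ne'
    rw [Nat.choose_symm_add] at h3 ⊢
    push_cast
    field_simp
  rwa [h2]

end IsPadicFiltration

end Exponentials

/-! ## Groups generated by exponentials -/

section ExpGroup

/-- The group of units `s` with `s ≡ 1` modulo `A D`. -/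
def congrUnits {E : Type*} [Ring E] {p h : ℕ} {A : ℤ → AddSubgroup E}
    (hA : IsPadicFiltration p h A) (D : ℕ) : Subgroup Eˣ where
  carrier := {s | (s : E) - 1 ∈ A D ∧ ((s⁻¹ : Eˣ) : E) - 1 ∈ A D}
  one_mem' := by simp
  mul_mem' := by
    have key : ∀ {s t : E}, s - 1 ∈ A D → t - 1 ∈ A D → s * t - 1 ∈ A D := by
      intro s t hs ht
      have : s * t - 1 = (s - 1) * t + (t - 1) := by noncomm_ring
      rw [this]
      exact add_mem (hA.mul_mem_zero_right hs (hA.zero_of_one_add (by omega) ht)) ht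
    rintro s t ⟨hs, hs'⟩ ⟨ht, ht'⟩
    refine ⟨key hs ht, ?_⟩
    rw [mul_inv_rev]
    exact key ht' hs'
  inv_mem' := fun ⟨hs, hs'⟩ => ⟨hs', by rwa [inv_inv]⟩

/-- The group generated by the exponentials of the elements of `𝔤` of degree at least `m`. -/
def expGroup {K E : Type*} [Field K] [Ring E] [Algebra K E] (p h : ℕ)
    (A : ℤ → AddSubgroup E) (𝔤 : Submodule K E) (m : ℤ) : Subgroup Eˣ :=
  Subgroup.closure {s | ∃ x ∈ 𝔤, x ∈ A m ∧ IsExp K p h A x s}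

/-- The formal curves `∏ exp (w_i X ^ (n_i))` with `w_i ∈ 𝔤` of degree at least `expRate m n_i`. -/
noncomputable def formalCurves {K E : Type*} [Field K] [CharZero K] [Ring E] [Algebra K E] (p h : ℕ)
    (A : ℤ → AddSubgroup E) (𝔤 : Submodule K E) (m : ℤ) : Submonoid (PowerSeries E) :=
  Submonoid.closure {f | ∃ n, 1 ≤ n ∧ ∃ w ∈ 𝔤, w ∈ A (expRate p h m n) ∧
    f = PowerSeries.formalExp K n w}

variable {K E : Type*} [Field K] [CharZero K] [Ring E] [Algebra K E] {p h : ℕ} [Fact p.Prime]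
  {A : ℤ → AddSubgroup E}

namespace IsPadicFiltration

variable (hA : IsPadicFiltration p h A)

lemma mem_congrUnits_of_mem {D : ℕ} {s : Eˣ} (hs : s ∈ congrUnits hA 0)
    (hD : (s : E) - 1 ∈ A D) : s ∈ congrUnits hA D := by
  refine ⟨hD, ?_⟩
  have h1 : ((s⁻¹ : Eˣ) : E) - 1 = -(((s⁻¹ : Eˣ) : E) * ((s : E) - 1)) := by
    rw [mul_sub, Units.inv_mul]; noncomm_ring
  rw [h1]
  exact neg_mem (hA.mul_mem_zero_left (hA.zero_of_one_add le_rfl (by exact_mod_cast hs.2)) hD)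

lemma congrUnits_anti : Antitone (congrUnits hA) := fun _ _ hD _ hs =>
  ⟨hA.anti (by exact_mod_cast hD) hs.1, hA.anti (by exact_mod_cast hD) hs.2⟩

lemma congrUnits_conj {D : ℕ} {s g : Eˣ} (hs : s ∈ congrUnits hA D) (hg : g ∈ congrUnits hA 0) :
    g * s * g⁻¹ ∈ congrUnits hA D := by
  have key : ∀ {s : Eˣ}, (s : E) - 1 ∈ A D → ((g * s * g⁻¹ : Eˣ) : E) - 1 ∈ A D := by
    intro s hs
    have h1 : ((g * s * g⁻¹ : Eˣ) : E) - 1 = g * (s - 1) * (g⁻¹ : Eˣ) := by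
      rw [mul_sub, sub_mul]; simp
    rw [h1]
    exact hA.mul_mem_zero_right (hA.mul_mem_zero_left
      (hA.zero_of_one_add le_rfl (by exact_mod_cast hg.1)) hs)
      (hA.zero_of_one_add le_rfl (by exact_mod_cast hg.2))
  refine ⟨key hs.1, ?_⟩
  have : (g * s * g⁻¹)⁻¹ = g * s⁻¹ * g⁻¹ := by group
  rw [this]
  exact key hs.2

include hA in
lemma expGroup_anti (𝔤 : Submodule K E) : Antitone (expGroup p h A 𝔤) := fun _ _ hm =>
  Subgroup.closure_mono fun _ ⟨x, hx, hxm, hs⟩ => ⟨x, hx, hA.anti hm hxm, hs⟩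

/-! ### Formal curves and their logarithmic derivatives. -/

section Curves

variable {𝔤 : Submodule K E} (h𝔤 : ∀ x ∈ 𝔤, ∀ y ∈ 𝔤, x * y - y * x ∈ 𝔤)
  {m : ℤ} {f : PowerSeries E} (hf : f ∈ formalCurves p h A 𝔤 m)
include hf

lemma coeff_zero_formalCurves : PowerSeries.coeff 0 f = 1 := by
  induction hf using Submonoid.closure_induction_left with
  | one => simp
  | mul_left x hx y _ hy =>
    obtain ⟨n, hn, w, -, -, rfl⟩ := hx
    simp [PowerSeries.coeff_mul, hy, hn]

include hA in
lemma coeff_formalCurves_mem (hp : h < p - 1) (k : ℕ) :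
    PowerSeries.coeff k f ∈ A (expRate p h m k) := by
  induction hf using Submonoid.closure_induction_left generalizing k with
  | one =>
    rw [PowerSeries.coeff_one]
    split_ifs with hk
    · rw [hk, expRate_zero]; exact hA.one_mem
    · exact zero_mem _
  | mul_left x hx y _ hy =>
    obtain ⟨n, hn, w, -, hw, rfl⟩ := hx
    rw [PowerSeries.coeff_mul]
    refine sum_mem fun ij hij => ?_
    rw [Finset.HasAntidiagonal.mem_antidiagonal] at hij
    subst hij
    exact hA.anti (expRate_add_le m ij.1 ij.2)
      (hA.mul_mem (hA.coeff_formalExp_mem hp hn hw _) (hy _))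

include h𝔤

/-- Here u is the logarithmic derivative of f. For a product exp(w X^n) y it is n w X^n plus the
logarithmic derivative of y conjugated by exp(w X^n), and conjugation preserves 𝔤[[X]]. -/
lemma exists_euler_formalCurves_eq :
    ∃ u, (∀ k, PowerSeries.coeff k u ∈ 𝔤) ∧ PowerSeries.euler f = u * f := by
  induction hf using Submonoid.closure_induction_left with
  | one => exact ⟨0, by simp, by rw [← map_one PowerSeries.C, PowerSeries.euler_C, zero_mul]⟩
  | mul_left x hx y _ hy =>
    obtain ⟨n, hn, w, hw, -, rfl⟩ := hx
    obtain ⟨u, hu, huy⟩ := hy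
    refine ⟨PowerSeries.X ^ n * PowerSeries.C (n • w) + PowerSeries.formalExp K n w * u *
      PowerSeries.formalExp K n (-w), fun k => ?_, ?_⟩
    · rw [map_add]
      refine add_mem ?_ (PowerSeries.coeff_conj_mem K hn h𝔤 hw hu k)
      rw [PowerSeries.coeff_X_pow_mul']
      split_ifs
      · rw [PowerSeries.coeff_C]
        split_ifs
        · exact nsmul_mem hw n
        · exact zero_mem _
      · exact zero_mem _
    · rw [PowerSeries.euler_mul, PowerSeries.euler_formalExp K hn, huy, add_mul]
      have := PowerSeries.formalExp_mul_neg K hn (-w)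
      rw [neg_neg] at this
      congr 1
      · simp only [mul_assoc]
      · rw [mul_assoc _ _ (PowerSeries.formalExp K n w * y),
          ← mul_assoc (PowerSeries.formalExp K n (-w)), this, one_mul, mul_assoc]

/-- If f = 1 + a X^n + ..., its logarithmic derivative begins with n a X^n, and n is invertible in
K. This is the substitute for the Baker-Campbell-Hausdorff theorem. -/
lemma coeff_formalCurves_mem_lie {n : ℕ} (hn : 1 ≤ n)
    (h0 : ∀ k, 1 ≤ k → k < n → PowerSeries.coeff k f = 0) : PowerSeries.coeff n f ∈ 𝔤 := by
  obtain ⟨u, hu, huf⟩ := exists_euler_formalCurves_eq h𝔤 hf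
  have hf0 := coeff_zero_formalCurves hf
  have hu0 : PowerSeries.coeff 0 u = 0 := by
    have := congrArg (PowerSeries.coeff 0) huf
    rw [PowerSeries.coeff_euler, zero_smul] at this
    simpa [PowerSeries.coeff_mul, hf0] using this.symm
  have hk : ∀ k, 1 ≤ k → k ≤ n → PowerSeries.coeff k (u * f) = PowerSeries.coeff k u := by
    intro k hk hkn
    rw [PowerSeries.coeff_mul, Finset.sum_eq_single_of_mem (k, 0) (by simp)]
    · rw [hf0, mul_one]
    · rintro ⟨i, j⟩ hij hne
      rw [Finset.HasAntidiagonal.mem_antidiagonal] at hij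
      dsimp only at hij ⊢
      rcases Nat.eq_zero_or_pos i with rfl | hi
      · rw [hu0, zero_mul]
      · have hj : j ≠ 0 := by rintro rfl; exact hne (by simpa using hij)
        rw [h0 j (by omega) (by omega), mul_zero]
  have h1 := congrArg (PowerSeries.coeff n) huf
  rw [hk n hn le_rfl, PowerSeries.coeff_euler, ← Nat.cast_smul_eq_nsmul K] at h1
  have hn0 : (n : K) ≠ 0 := Nat.cast_ne_zero.mpr (by omega)
  rw [← inv_smul_smul₀ hn0 (PowerSeries.coeff n f), h1]
  exact 𝔤.smul_mem _ (hu n)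

end Curves

variable (hp : h < p - 1)
include hp

lemma expGroup_le_congrUnits (𝔤 : Submodule K E) {m : ℕ} (hm : 1 ≤ m) :
    expGroup p h A 𝔤 m ≤ congrUnits hA m := by
  rw [expGroup, Subgroup.closure_le]
  rintro s ⟨x, hx, hxm, hs⟩
  have hm' : (1 : ℤ) ≤ m := by exact_mod_cast hm
  exact ⟨hA.isExp_sub_one_mem hp hm' hxm hs, hA.isExp_sub_one_mem hp hm' (neg_mem hxm)
    (hA.isExp_neg hp (hA.anti hm' hxm) hs)⟩

variable {𝔤 : Submodule K E} (h𝔤 : ∀ x ∈ 𝔤, ∀ y ∈ 𝔤, x * y - y * x ∈ 𝔤)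
include hA h𝔤

/-- The value of a formal curve with trivial coefficients below `n` is a product of exponentials of
elements of `𝔤` of degree at least `expRate m n`. -/
lemma exists_mul_of_formalCurve {m : ℤ} (hm : 1 ≤ m) (D d : ℕ) {n : ℕ} (hn : 1 ≤ n)
    (hD : (D : ℤ) ≤ expRate p h m (n + d))
    {f : PowerSeries E} (hf : f ∈ formalCurves p h A 𝔤 m)
    (h0 : ∀ k, 1 ≤ k → k < n → PowerSeries.coeff k f = 0) {s : Eˣ}
    (hs : HasValue A (expRate p h m) f s) :
    ∃ r ∈ expGroup p h A 𝔤 (expRate p h m n), ((r⁻¹ * s : Eˣ) : E) - 1 ∈ A D := by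
  induction d generalizing n f s with
  | zero =>
    refine ⟨1, one_mem _, ?_⟩
    have h1 : ∑ k ∈ Finset.range n, PowerSeries.coeff k f = 1 := by
      rw [Finset.sum_eq_single_of_mem 0 (Finset.mem_range.mpr hn), coeff_zero_formalCurves hf]
      intro k hk hk0
      exact h0 k (by omega) (Finset.mem_range.mp hk)
    have h2 := hs n
    rw [h1] at h2
    rw [inv_one, one_mul]
    exact hA.anti hD h2
  | succ d ih =>
    -- Multiplying by exp(-w X^n) kills the coefficient of X^n and costs a factor exp w in the
    -- group. After d such steps the remaining curve is trivial up to degree D.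
    set w := PowerSeries.coeff n f with hw
    have hwg : w ∈ 𝔤 := coeff_formalCurves_mem_lie h𝔤 hf hn h0
    have hwA : w ∈ A (expRate p h m n) := hA.coeff_formalCurves_mem hf hp n
    have hw1 : w ∈ A 1 := hA.anti (hm.trans (le_expRate hp hm hn)) hwA
    obtain ⟨e, he, he'⟩ := hA.exists_unit_isExp K hp hw1
    have hmem : PowerSeries.formalExp K n (-w) ∈ formalCurves p h A 𝔤 m :=
      Submonoid.subset_closure ⟨n, hn, -w, neg_mem hwg, neg_mem hwA, rfl⟩
    obtain ⟨r, hr, hrs⟩ := ih (n := n + 1) (f := PowerSeries.formalExp K n (-w) * f)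
      (s := e⁻¹ * s) (by omega) (by rwa [add_right_comm]) (mul_mem hmem hf) (by
        intro k hk hkn
        rw [PowerSeries.coeff_mul_of_forall_lt hk fun i hi hik =>
          PowerSeries.coeff_formalExp_of_lt K hn _ hi (by omega),
          PowerSeries.coeff_zero_formalExp K hn, coeff_zero_formalCurves hf, one_mul, mul_one]
        rcases (Nat.lt_succ_iff.mp hkn).lt_or_eq with hlt | rfl
        · rw [h0 k hk hlt, PowerSeries.coeff_formalExp_of_lt K hn _ hk hlt, add_zero]
        · rw [PowerSeries.coeff_self_formalExp K hn, ← hw, add_neg_cancel])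
      (by
        rw [Units.val_mul]
        exact hA.hasValue_mul hp (hA.hasValue_formalExp hp hm hn (neg_mem hwA) he') hs
          (hA.coeff_formalExp_mem hp hn (neg_mem hwA)))
    refine ⟨e * r, mul_mem (Subgroup.subset_closure ⟨w, hwg, hwA, he⟩)
      (hA.expGroup_anti 𝔤 (expRate_mono hp hm n.le_succ) hr), ?_⟩
    rwa [mul_inv_rev, mul_assoc]

/-- The first order Baker-Campbell-Hausdorff formula. -/
lemma exists_isExp_mul_eq {m : ℕ} (hm : 1 ≤ m) {x y : E} (hx : x ∈ 𝔤) (hxm : x ∈ A m) (hy : y ∈ 𝔤)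
    (hym : y ∈ A m) {s t e : Eˣ} (hs : IsExp K p h A x s) (ht : IsExp K p h A y t)
    (he : IsExp K p h A (x + y) e) (D : ℕ) :
    ∃ r ∈ expGroup p h A 𝔤 (m + 1), ∃ u ∈ congrUnits hA D, s * t = e * r * u := by
  have hm' : (1 : ℤ) ≤ m := by exact_mod_cast hm
  have hxm' : x ∈ A (expRate p h m 1) := by simpa using hxm
  have hym' : y ∈ A (expRate p h m 1) := by simpa using hym
  have hz : -(x + y) ∈ A (expRate p h m 1) := neg_mem (add_mem hxm' hym')
  have hmem : ∀ {w}, w ∈ 𝔤 → w ∈ A (expRate p h m 1) →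
      PowerSeries.formalExp K 1 w ∈ formalCurves p h A 𝔤 m := fun hw hwA =>
    Submonoid.subset_closure ⟨1, le_rfl, _, hw, hwA, rfl⟩
  have he' := hA.isExp_neg hp (hA.anti hm' (add_mem hxm hym)) he
  have hval := hA.hasValue_mul hp (hA.hasValue_formalExp hp hm' le_rfl hz he')
    (hA.hasValue_mul hp (hA.hasValue_formalExp hp hm' le_rfl hxm' hs)
      (hA.hasValue_formalExp hp hm' le_rfl hym' ht)
      (hA.coeff_formalExp_mem hp le_rfl hxm')) (hA.coeff_formalExp_mem hp le_rfl hz)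
  have hf := mul_mem (hmem (neg_mem (add_mem hx hy)) hz) (mul_mem (hmem hx hxm') (hmem hy hym'))
  obtain ⟨d, hd⟩ := exists_le_expRate hp hm' (D : ℤ)
  -- The curve exp(-(x + y)X) exp(xX) exp(yX) has zero linear coefficient, so the peeling may start
  -- at n = 2, where `lt_expRate` gives degree at least m + 1.
  obtain ⟨r, hr, hru⟩ := hA.exists_mul_of_formalCurve hp h𝔤 hm' D d (n := 2) (by omega)
    (hd.trans (expRate_mono hp hm' (by omega))) hf (s := e⁻¹ * (s * t)) (by
      intro k hk hk2
      obtain rfl : k = 1 := by omega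
      simp only [PowerSeries.coeff_mul_of_forall_lt le_rfl fun i hi hi' => absurd hi' (by omega),
        PowerSeries.coeff_self_formalExp K le_rfl, PowerSeries.coeff_zero_formalExp K le_rfl,
        PowerSeries.coeff_mul, Finset.Nat.antidiagonal_zero, Finset.sum_singleton]
      noncomm_ring) (by simpa using hval)
  refine ⟨r, hA.expGroup_anti 𝔤 (lt_expRate hp hm' le_rfl) hr, r⁻¹ * (e⁻¹ * (s * t)),
    hA.mem_congrUnits_of_mem ?_ hru, by group⟩
  have hU : ∀ {w : E} {v : Eˣ}, w ∈ A m → IsExp K p h A w v → v ∈ congrUnits hA 0 :=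
    fun hw hv => hA.congrUnits_anti (Nat.zero_le 1)
      ⟨hA.isExp_sub_one_mem hp le_rfl (hA.anti hm' hw) hv, hA.isExp_sub_one_mem hp le_rfl
        (neg_mem (hA.anti hm' hw)) (hA.isExp_neg hp (hA.anti hm' hw) hv)⟩
  refine mul_mem (inv_mem ?_) (mul_mem (inv_mem (hU (add_mem hxm hym) he))
    (mul_mem (hU hxm hs) (hU hym ht)))
  refine hA.congrUnits_anti (Nat.zero_le 1) (hA.expGroup_le_congrUnits hp 𝔤 le_rfl ?_)
  exact hA.expGroup_anti 𝔤 (hm'.trans (le_expRate hp hm' (by omega))) hr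

/-- Modulo the next step of the filtration, and up to an arbitrarily small error u, products of
exponentials are exponentials of sums. The error is moved to the right by conjugation. -/
lemma exists_eq_isExp_mul {m : ℕ} (hm : 1 ≤ m) (D : ℕ) {s : Eˣ} (hs : s ∈ expGroup p h A 𝔤 m) :
    ∃ x ∈ 𝔤, x ∈ A m ∧ ∃ e : Eˣ, IsExp K p h A x e ∧ ∃ r ∈ expGroup p h A 𝔤 (m + 1),
      ∃ u ∈ congrUnits hA D, s = e * r * u := by
  have hm' : (1 : ℤ) ≤ m := by exact_mod_cast hm
  have key : ∀ {x : E} {e : Eˣ}, x ∈ 𝔤 → x ∈ A m → IsExp K p h A x e → ∀ {t : Eˣ},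
      (∃ x ∈ 𝔤, x ∈ A m ∧ ∃ e : Eˣ, IsExp K p h A x e ∧ ∃ r ∈ expGroup p h A 𝔤 (m + 1),
        ∃ u ∈ congrUnits hA D, t = e * r * u) →
      ∃ x ∈ 𝔤, x ∈ A m ∧ ∃ e' : Eˣ, IsExp K p h A x e' ∧ ∃ r ∈ expGroup p h A 𝔤 (m + 1),
        ∃ u ∈ congrUnits hA D, e * t = e' * r * u := by
    rintro x e hx hxm he _ ⟨y, hy, hym, e₂, he₂, r, hr, u, hu, rfl⟩
    obtain ⟨e₃, he₃, -⟩ := hA.exists_unit_isExp K hp (hA.anti hm' (add_mem hxm hym))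
    obtain ⟨r', hr', u', hu', heq⟩ := hA.exists_isExp_mul_eq hp h𝔤 hm hx hxm hy hym he he₂ he₃ D
    refine ⟨x + y, add_mem hx hy, add_mem hxm hym, e₃, he₃, r' * r, mul_mem hr' hr,
      r⁻¹ * u' * r⁻¹⁻¹ * u, mul_mem (hA.congrUnits_conj hu' (inv_mem ?_)) hu, ?_⟩
    · exact hA.congrUnits_anti (Nat.zero_le 1) (hA.expGroup_le_congrUnits hp 𝔤 le_rfl
        (hA.expGroup_anti 𝔤 (by push_cast; omega) hr))
    · rw [← mul_assoc, ← mul_assoc, heq]; group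
  induction hs using Subgroup.closure_induction_left with
  | one => exact ⟨0, zero_mem _, zero_mem _, 1, by simpa using hA.isExp_zero hp, 1, one_mem _, 1,
      one_mem _, by simp⟩
  | mul_left s hs t _ ih =>
    obtain ⟨x, hx, hxm, hs⟩ := hs
    exact key hx hxm hs ih
  | inv_mul_cancel s hs t _ ih =>
    obtain ⟨x, hx, hxm, hs⟩ := hs
    exact key (neg_mem hx) (neg_mem hxm) (hA.isExp_neg hp (hA.anti hm' hxm) hs) ih

/-- The leading term of an element of the group generated by the exponentials lies in `𝔤`. -/
theorem exists_sub_mem_of_mem_expGroup {N : ℕ} (hN : 1 ≤ N) {s : Eˣ} (hs : s ∈ expGroup p h A 𝔤 1)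
    (hsN : (s : E) - 1 ∈ A N) : ∃ x ∈ 𝔤, x ∈ A N ∧ (s : E) - 1 - x ∈ A (N + 1) := by
  have hmul : ∀ {m : ℕ} {e r u : Eˣ} {x : E}, 1 ≤ m → m ≤ N → x ∈ A m → IsExp K p h A x e →
      r ∈ expGroup p h A 𝔤 (m + 1) → u ∈ congrUnits hA (N + 1) →
      ((e * r * u : Eˣ) : E) - 1 - x ∈ A (m + 1) := by
    intro m e r u x hm hmN hx he hr hu
    have hm' : (1 : ℤ) ≤ m := by exact_mod_cast hm
    have h1 := hA.isExp_sub_mem hp hm' hx he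
    have h2 : r * u ∈ congrUnits hA (m + 1) := mul_mem
      (hA.expGroup_le_congrUnits hp 𝔤 (by omega) (by exact_mod_cast hr))
      (hA.congrUnits_anti (by omega) hu)
    have h3 : ((e * r * u : Eˣ) : E) - 1 - x
        = ((e : E) - 1 - x) + e * (((r * u : Eˣ) : E) - 1) := by
      push_cast; noncomm_ring
    rw [h3]
    refine add_mem h1 (hA.mul_mem_zero_left ?_ (by exact_mod_cast h2.1))
    exact hA.zero_of_one_add (by omega) (hA.isExp_sub_one_mem hp hm' hx he)
  -- As long as m < N, the leading logarithm x in degree m must already lie in A (m + 1), because s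
  -- - 1 does. Its exponential can therefore be absorbed into the next group, until m reaches N.
  have key : ∀ m : ℕ, 1 ≤ m → m ≤ N →
      ∃ r ∈ expGroup p h A 𝔤 m, ∃ u ∈ congrUnits hA (N + 1), s = r * u := by
    intro m hm
    induction m, hm using Nat.le_induction with
    | base => exact fun _ => ⟨s, by exact_mod_cast hs, 1, one_mem _, (mul_one s).symm⟩
    | succ m hm ih =>
      intro hmN
      obtain ⟨r, hr, u, hu, rfl⟩ := ih (by omega)
      obtain ⟨x, hx, hxm, e, he, r', hr', u', hu', rfl⟩ :=
        hA.exists_eq_isExp_mul hp h𝔤 hm (N + 1) hr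
      have h1 := hmul hm (by omega) hxm he hr' (mul_mem hu' hu)
      rw [← mul_assoc] at h1
      have hx' : x ∈ A (m + 1) := by
        have := sub_mem (hA.anti (by exact_mod_cast hmN) hsN) h1
        rwa [sub_sub_cancel] at this
      exact ⟨e * r', mul_mem (Subgroup.subset_closure ⟨x, hx, by exact_mod_cast hx', he⟩)
        (by exact_mod_cast hr'), u' * u, mul_mem hu' hu, by group⟩
  obtain ⟨r, hr, u, hu, rfl⟩ := key N hN le_rfl
  obtain ⟨x, hx, hxm, e, he, r', hr', u', hu', rfl⟩ :=
    hA.exists_eq_isExp_mul hp h𝔤 hN (N + 1) hr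
  refine ⟨x, hx, hxm, ?_⟩
  have h1 := hmul hN le_rfl hxm he hr' (mul_mem hu' hu)
  rwa [← mul_assoc] at h1

end IsPadicFiltration

end ExpGroup

/-! ## Congruence filtrations are `p`-valuations -/

section CongruenceFiltration

open scoped commutatorElement

variable {E : Type*} [Ring E] {p h : ℕ} [Fact p.Prime] {A : ℤ → AddSubgroup E} (hA : IsPadicFiltration p h A)

namespace IsPadicFiltration

include hA

lemma prime_mul_mem {m : ℤ} {x : E} (hx : x ∈ A m) : (p : E) * x ∈ A (m + h) :=
  hA.prime_mul_mem_iff.mpr hx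

lemma natCast_mul_mem (n : ℕ) {m : ℤ} {x : E} (hx : x ∈ A m) : (n : E) * x ∈ A m := by
  rw [← nsmul_eq_mul]; exact nsmul_mem hx n

/-- The middle binomial coefficients are divisible by p, which yields degree at least 2i + h. The
last term a^p has degree p i ≥ i + h + 1 because h < p - 1. -/
lemma one_add_pow_sub_mem (hp : h < p - 1) {i : ℤ} (hi : 1 ≤ i) {a : E}
    (ha : a ∈ A i) : (1 + a) ^ p - 1 - p * a ∈ A (i + h + 1) := by
  have hp2 : 2 ≤ p := (Fact.out : p.Prime).two_le
  rw [add_comm 1 a, (Commute.one_right a).add_pow]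
  simp only [one_pow, mul_one]
  obtain ⟨q, hq⟩ := Nat.exists_eq_add_of_le' hp2
  rw [hq, Finset.sum_range_succ, Finset.sum_range_succ', Finset.sum_range_succ', ← hq]
  have h1 : ∑ k ∈ Finset.range q, a ^ (k + 1 + 1) * ((p.choose (k + 1 + 1) : ℕ) : E)
      ∈ A (i + h + 1) := by
    refine sum_mem fun k hk => ?_
    have hk' := Finset.mem_range.mp hk
    obtain ⟨c, hc⟩ := (Fact.out : p.Prime).dvd_choose_self (k := k + 1 + 1) (by omega) (by omega)
    rw [hc, (Nat.cast_commute _ _).eq.symm, Nat.cast_mul, mul_assoc]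
    refine hA.anti ?_ (hA.prime_mul_mem (hA.natCast_mul_mem c (hA.pow_mem ha (k + 1 + 1))))
    have : (0 : ℤ) ≤ k * i := mul_nonneg (by omega) (by omega)
    push_cast
    linarith
  have h2 : a ^ p ∈ A (i + h + 1) := by
    refine hA.anti ?_ (hA.pow_mem ha p)
    have h3 : (0 : ℤ) ≤ (p - 1) * (i - 1) := mul_nonneg (by omega) (by omega)
    have h4 : (h : ℤ) + 1 ≤ p - 1 := by omega
    linarith
  have h3 := add_mem h1 h2
  convert h3 using 1
  simp only [zero_add, pow_zero, pow_one, Nat.choose_zero_right, Nat.choose_one_right,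
    Nat.choose_self, Nat.cast_one, mul_one, (Nat.cast_commute p a).eq]
  abel

lemma pow_sub_mem (hp : h < p - 1) {i : ℤ} (hi : 1 ≤ i) {s : E}
    (hs : s - 1 ∈ A i) : s ^ p - 1 - p * (s - 1) ∈ A (i + h + 1) := by
  have := hA.one_add_pow_sub_mem hp hi hs
  rwa [add_sub_cancel] at this

/-- The identity [s, t] - 1 = (st - ts) s⁻¹t⁻¹, in which s⁻¹t⁻¹ may be replaced by 1 at the cost of
one degree. -/
lemma commutator_sub_mem {i j : ℕ} {s t : Eˣ} (hi : 1 ≤ i) (hj : 1 ≤ j) (hs : s ∈ congrUnits hA i)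
    (ht : t ∈ congrUnits hA j) :
    ((⁅s, t⁆ : Eˣ) : E) - 1 - ((s - 1) * (t - 1) - (t - 1) * (s - 1)) ∈ A (i + j + 1) := by
  have h1 : ((⁅s, t⁆ : Eˣ) : E) - 1 - ((s - 1) * (t - 1) - (t - 1) * (s - 1) : E)
      = ((s - 1) * (t - 1) - (t - 1) * (s - 1) : E) * (((s⁻¹ * t⁻¹ : Eˣ) : E) - 1) := by
    have h2 : ((s - 1) * (t - 1) - (t - 1) * (s - 1) : E) = s * t - t * s := by noncomm_ring
    have h3 : (t * s * (s⁻¹ * t⁻¹) : Eˣ) = 1 := by group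
    have h4 : (t : E) * s * ((s⁻¹ * t⁻¹ : Eˣ) : E) = 1 := by
      rw [← Units.val_mul, ← Units.val_mul, h3, Units.val_one]
    have h5 : ((⁅s, t⁆ : Eˣ) : E) = s * t * ((s⁻¹ * t⁻¹ : Eˣ) : E) := by
      rw [commutatorElement_def]; push_cast; simp only [mul_assoc]
    rw [h2, mul_sub, sub_mul, h4, h5, mul_one]
  rw [h1]
  refine hA.mul_mem (sub_mem (hA.mul_mem hs.1 ht.1) ?_) ?_
  · rw [add_comm]; exact hA.mul_mem ht.1 hs.1
  · have := mul_mem (inv_mem (hA.congrUnits_anti hi hs)) (inv_mem (hA.congrUnits_anti hj ht))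
    exact_mod_cast this.1

lemma commutator_mem {i j : ℕ} {s t : Eˣ} (hi : 1 ≤ i) (hj : 1 ≤ j) (hs : s ∈ congrUnits hA i)
    (ht : t ∈ congrUnits hA j) : ((⁅s, t⁆ : Eˣ) : E) - 1 ∈ A (i + j) := by
  have h1 := hA.anti (le_add_of_nonneg_right zero_le_one) (hA.commutator_sub_mem hi hj hs ht)
  have h2 : ((s - 1) * (t - 1) - (t - 1) * (s - 1) : E) ∈ A (i + j) :=
    sub_mem (hA.mul_mem hs.1 ht.1) (by rw [add_comm]; exact hA.mul_mem ht.1 hs.1)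
  have h3 := add_mem h1 h2
  rwa [sub_add_cancel] at h3

lemma inv_mul_sub_one_mem {n : ℤ} {s t : Eˣ} (hs : s ∈ congrUnits hA 0)
    (hst : (t : E) - s ∈ A n) : ((s⁻¹ * t : Eˣ) : E) - 1 ∈ A n := by
  have h1 : ((s⁻¹ * t : Eˣ) : E) - 1 = (s⁻¹ : Eˣ) * ((t : E) - s) := by
    rw [mul_sub, Units.inv_mul]; push_cast; rfl
  rw [h1]
  exact hA.mul_mem_zero_left (hA.zero_of_one_add le_rfl (by exact_mod_cast hs.2)) hst

omit hA in
/-- The filtration induced by a congruence filtration of units is a `p`-valuation. -/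
theorem isPValuedFiltration (hA : IsPadicFiltration p h A) (h0 : 0 < h)
    (hp : h < p - 1) {Γ : Type*} [Group Γ] (ρ : Γ →* Eˣ) (hρ : Function.Injective ρ)
    {F : ℕ → Subgroup Γ} (hFanti : Antitone F) (hF1 : ∀ x ∈ F 1, ρ x ∈ congrUnits hA 1)
    (hF : ∀ {i x}, 1 ≤ i → (x ∈ F i ↔ x ∈ F 1 ∧ (ρ x : E) - 1 ∈ A i)) :
    IsPValuedFiltration p h F := by
  have hU : ∀ {i x}, 1 ≤ i → x ∈ F i → ρ x ∈ congrUnits hA i := fun hi hx =>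
    hA.mem_congrUnits_of_mem (hA.congrUnits_anti (Nat.zero_le 1) (hF1 _ ((hF hi).mp hx).1))
      ((hF hi).mp hx).2
  have hU0 : ∀ {x}, x ∈ F 1 → ρ x ∈ congrUnits hA 0 := fun hx =>
    hA.congrUnits_anti (Nat.zero_le 1) (hF1 _ hx)
  have hpow : ∀ {i x}, 1 ≤ i → x ∈ F i →
      ((ρ (x ^ p) : Eˣ) : E) - 1 - p * ((ρ x : E) - 1) ∈ A (i + h + 1) := fun hi hx => by
    rw [map_pow, Units.val_pow_eq_pow_val]
    exact hA.pow_sub_mem hp (by exact_mod_cast hi) (hU hi hx).1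
  have hone : ∀ {i x}, 1 ≤ i → x ∈ F i → x ∈ F 1 := fun hi hx => ((hF hi).mp hx).1
  have hpowmem : ∀ {i x}, 1 ≤ i → x ∈ F i → x ^ p ∈ F (i + h) := by
    intro i x hi hx
    refine (hF (by omega)).mpr ⟨pow_mem (hone hi hx) p, ?_⟩
    have := add_mem (hA.anti (by omega) (hpow hi hx)) (hA.prime_mul_mem (hU hi hx).1)
    rw [sub_add_cancel] at this
    exact_mod_cast this
  have hcomm1 : ∀ {x y : Γ}, x ∈ F 1 → y ∈ F 1 → ⁅x, y⁆ ∈ F 1 := fun hx hy => by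
    rw [commutatorElement_def]
    exact mul_mem (mul_mem (mul_mem hx hy) (inv_mem hx)) (inv_mem hy)
  have hlie : ∀ {i j : ℕ}, 1 ≤ i → 1 ≤ j → ∀ {x y : Γ}, x ∈ F i → y ∈ F j → ⁅x, y⁆ ∈ F (i + j) := by
    intro i j hi hj x y hx hy
    refine (hF (by omega)).mpr ⟨hcomm1 (hone hi hx) (hone hj hy), ?_⟩
    rw [map_commutatorElement]
    exact_mod_cast hA.commutator_mem hi hj (hU hi hx) (hU hj hy)
  refine ⟨h0, hp, hFanti, fun x hx => ?_, hlie, fun hi _ hx => hpowmem hi hx, ?_, ?_, ?_⟩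
  · refine hρ (Units.ext (hA.eq_of_forall fun D => ?_))
    rw [map_one, Units.val_one]
    refine hA.anti ?_ ((hF (Nat.le_add_left 1 D.toNat)).mp (hx _)).2
    have := Int.self_le_toNat D
    push_cast; omega
  · intro i hi x hx hxp
    refine (hF (by omega)).mpr ⟨hone hi hx, ?_⟩
    have h1 := ((hF (by omega)).mp hxp).2
    push_cast at h1
    have h2 := sub_mem h1 (hpow hi hx)
    rw [sub_sub_cancel, add_right_comm] at h2
    exact_mod_cast hA.prime_mul_mem_iff.mp h2
  · intro i hi x y hx hy
    have hxp := hpowmem hi hx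
    have hyp := hpowmem hi hy
    have hxy := mul_mem hx hy
    have hp1 : ∀ {x}, x ∈ F i → x ^ p ∈ F 1 := fun hx => pow_mem (hone hi hx) p
    refine (hF (by omega)).mpr ⟨mul_mem (inv_mem (mul_mem (hp1 hx) (hp1 hy))) (hp1 hxy), ?_⟩
    rw [map_mul, map_inv]
    push_cast
    refine hA.inv_mul_sub_one_mem (hU0 (mul_mem (hp1 hx) (hp1 hy))) ?_
    set a : E := (ρ x : E) - 1 with ha
    set b : E := (ρ y : E) - 1 with hb
    have hai : a ∈ A i := (hU hi hx).1
    have hbi : b ∈ A i := (hU hi hy).1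
    have hxp' : (ρ (x ^ p) : E) - 1 ∈ A (i + h) := by exact_mod_cast (hU (by omega) hxp).1
    have hyp' : (ρ (y ^ p) : E) - 1 ∈ A (i + h) := by exact_mod_cast (hU (by omega) hyp).1
    -- Each of the three p-th powers is compared with its linear approximation. What is left over is
    -- p a b and the product of two factors of degree i + h, both of degree at least i + h + 1.
    have h1 : ((ρ ((x * y) ^ p) : Eˣ) : E) - ((ρ (x ^ p * y ^ p) : Eˣ) : E)
        = (((ρ ((x * y) ^ p) : Eˣ) : E) - 1 - p * ((ρ (x * y) : E) - 1))
          - (((ρ (x ^ p) : Eˣ) : E) - 1 - p * a) - (((ρ (y ^ p) : Eˣ) : E) - 1 - p * b)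
          - ((ρ (x ^ p) : E) - 1) * ((ρ (y ^ p) : E) - 1) + p * (a * b) := by
      have h2 : (ρ (x * y) : E) - 1 = a + b + a * b := by
        rw [map_mul, ha, hb]; push_cast; noncomm_ring
      rw [h2, map_mul _ (x ^ p)]
      push_cast
      noncomm_ring
    rw [h1]
    refine add_mem (sub_mem (sub_mem (sub_mem (hpow hi hxy) (hpow hi hx)) (hpow hi hy)) ?_) ?_
    · exact hA.anti (by omega) (hA.mul_mem hxp' hyp')
    · exact hA.anti (by omega) (hA.prime_mul_mem (hA.mul_mem hai hbi))
  · intro i j hi hj x y hx hy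
    have hxp := hpowmem hi hx
    have hc := hlie hi hj hx hy
    have hij : 1 ≤ i + j := by omega
    refine (hF (by omega)).mpr ⟨mul_mem (inv_mem (pow_mem (hone hij hc) p))
      (hcomm1 (hone (by omega) hxp) (hone hj hy)), ?_⟩
    rw [map_mul, map_inv]
    push_cast
    refine hA.inv_mul_sub_one_mem (hU0 (pow_mem (hone hij hc) p)) ?_
    set a : E := (ρ x : E) - 1 with ha
    set b : E := (ρ y : E) - 1 with hb
    set a' : E := (ρ (x ^ p) : E) - 1 with ha'
    have hbj : b ∈ A j := (hU hj hy).1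
    have hpx : a' - p * a ∈ A (i + h + 1) := hpow hi hx
    have h1 := hpow hij hc
    have h2 := hA.commutator_sub_mem hi hj (hU hi hx) (hU hj hy)
    have h3 := hA.commutator_sub_mem (by omega) hj (hU (by omega) hxp) (hU hj hy)
    rw [← map_commutatorElement] at h2 h3
    rw [← ha, ← hb] at h2
    rw [← ha', ← hb] at h3
    -- Both sides are compared with p (a b - b a): the commutator with x^p through a' ≡ p a, and the
    -- p-th power of [x, y] through its linear approximation.
    have h4 : ((ρ ⁅x ^ p, y⁆ : Eˣ) : E) - ((ρ (⁅x, y⁆ ^ p) : Eˣ) : E)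
      = (((ρ ⁅x ^ p, y⁆ : Eˣ) : E) - 1 - (a' * b - b * a'))
        - (((ρ (⁅x, y⁆ ^ p) : Eˣ) : E) - 1 - p * ((ρ ⁅x, y⁆ : E) - 1))
        - p * ((ρ ⁅x, y⁆ : E) - 1 - (a * b - b * a))
        + ((a' - p * a) * b - b * (a' - p * a)) := by
      have h5 : b * (p * a) = p * (b * a) := by
        rw [← mul_assoc, ← (Nat.cast_commute p b).eq, mul_assoc]
      clear_value a b a'
      simp only [mul_sub, sub_mul, mul_assoc, h5]
      abel
    rw [h4]
    push_cast at h1 h3 ⊢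
    refine add_mem (sub_mem (sub_mem (hA.anti (by omega) h3) h1) ?_) (sub_mem ?_ ?_)
    · exact hA.anti (by omega) (hA.prime_mul_mem h2)
    · exact hA.anti (by omega) (hA.mul_mem hpx hbj)
    · exact hA.anti (by omega) (hA.mul_mem hbj hpx)

end IsPadicFiltration

end CongruenceFiltration

/-! ## Filtrations of coordinate spaces and of endomorphism rings -/

section EndFiltration

open Module

variable {K : Type*} [Field K] {V : Type*} [AddCommGroup V] [Module K V]

/-- The filtration of `ι → K` in which the `j`-th coordinate vector has degree `d j`. -/
def coordFil {ι : Type*} (P : ℤ → AddSubgroup K) (d : ι → ℤ) (m : ℤ) : AddSubgroup (ι → K) where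
  carrier := {y | ∀ j, y j ∈ P (m - d j)}
  zero_mem' _ := zero_mem _
  add_mem' hx hy j := add_mem (hx j) (hy j)
  neg_mem' hx j := neg_mem (hx j)

/-- The filtration of `End V` in which the matrix unit `v j ↦ v i` has degree `c i - c j`. -/
def endFil {ι : Type*} (P : ℤ → AddSubgroup K) (v : Basis ι K V) (c : ι → ℤ) (m : ℤ) :
    AddSubgroup (Module.End K V) where
  carrier := {φ | ∀ i j, v.repr (φ (v j)) i ∈ P (m - c i + c j)}
  zero_mem' i j := by simp
  add_mem' {φ ψ} hφ hψ i j := by simpa using add_mem (hφ i j) (hψ i j)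
  neg_mem' {φ} hφ i j := by simpa using hφ i j

variable {ι : Type*} {P : ℤ → AddSubgroup K} {p h : ℕ}

namespace IsFracFiltration

variable (hP : IsFracFiltration p h P)
include hP

lemma zsmul_one_mem (n : ℤ) : (n : K) ∈ P 0 := by
  have := zsmul_mem hP.one_mem n
  simpa using this

lemma anti_coordFil (d : ι → ℤ) : Antitone (coordFil P d) := fun _ _ hmn _ hx j =>
  hP.anti (by omega) (hx j)

lemma complete_coordFil (d : ι → ℤ) (e : ℤ) (x : ℕ → ι → K)
    (hx : ∀ n : ℕ, x (n + 1) - x n ∈ coordFil P d (n - e)) :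
    ∃ y, ∀ n : ℕ, y - x n ∈ coordFil P d (n - e) := by
  have : ∀ j, ∃ y, ∀ n : ℕ, y - x n j ∈ P (n - (e + d j)) := fun j =>
    hP.complete (e + d j) (fun n => x n j) fun n => by
      have := hx n j
      rwa [sub_sub] at this
  choose y hy using this
  refine ⟨y, fun n j => ?_⟩
  have := hy j n
  rwa [← sub_sub] at this

lemma smul_mem_endFil {v : Basis ι K V} {c : ι → ℤ} {m n : ℤ} {z : K} (hz : z ∈ P m)
    {φ : Module.End K V} (hφ : φ ∈ endFil P v c n) : z • φ ∈ endFil P v c (m + n) := by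
  intro i j
  have := hP.mul_mem hz (hφ i j)
  rw [LinearMap.smul_apply, map_smul, Finsupp.smul_apply, smul_eq_mul]
  convert this using 2
  ring

lemma mem_endFil_of_diagonal {v : Basis ι K V} (c : ι → ℤ) {m : ℤ}
    {φ : Module.End K V} {a : ι → K} (hφ : ∀ j, φ (v j) = a j • v j) (ha : ∀ j, a j ∈ P m) :
    φ ∈ endFil P v c m := by
  classical
  intro i j
  rw [hφ, map_smul, Basis.repr_self, Finsupp.smul_single, smul_eq_mul, mul_one,
    Finsupp.single_apply]
  split_ifs with hij
  · subst hij; simpa using ha j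
  · exact zero_mem _

/-- All properties are checked on matrix entries. In a product the degree shifts c telescope, and
finiteness of the basis is used only for sums over it and to build a limit from its entries. -/
theorem isPadicFiltration_endFil [Finite ι] (v : Basis ι K V) (c : ι → ℤ) :
    IsPadicFiltration p h (endFil P v c) where
  anti _ _ hmn _ hx i j := hP.anti (by omega) (hx i j)
  one_mem := hP.mem_endFil_of_diagonal c (a := fun _ => 1) (by simp) fun _ => hP.one_mem
  mul_mem := by
    have := Fintype.ofFinite ι
    intro m n φ ψ hφ hψ i j
    rw [Module.End.mul_apply, ← v.sum_repr (ψ (v j)), map_sum, map_sum, Finsupp.finsetSum_apply]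
    refine sum_mem fun k _ => ?_
    rw [map_smul, map_smul, Finsupp.smul_apply, smul_eq_mul]
    have := hP.mul_mem (hψ k j) (hφ i k)
    convert this using 2
    ring
  prime_mul_mem_iff := by
    intro m φ
    refine forall_congr' fun i => forall_congr' fun j => ?_
    rw [← nsmul_eq_mul, LinearMap.smul_apply, map_nsmul, Finsupp.smul_apply, nsmul_eq_mul,
      ← hP.prime_mul_mem_iff (m := m - c i + c j)]
    rw [show m + h - c i + c j = m - c i + c j + h by ring]
  eq_zero_of_forall := by
    intro φ hφ
    refine v.ext fun j => v.repr.injective (Finsupp.ext fun i => ?_)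
    rw [LinearMap.zero_apply, map_zero, Finsupp.zero_apply]
    refine hP.eq_zero_of_forall _ fun m => ?_
    have := hφ (m + c i - c j) i j
    rwa [show m + c i - c j - c i + c j = m by ring] at this
  complete := by
    classical
    have := Fintype.ofFinite ι
    intro d x hx
    have : ∀ i j, ∃ y, ∀ n : ℕ, y - v.repr (x n (v j)) i ∈ P (n - (d + c i - c j)) := fun i j =>
      hP.complete _ _ fun n => by
        have := hx n i j
        rw [LinearMap.sub_apply, map_sub, Finsupp.sub_apply] at this
        convert this using 2
        ring
    choose y hy using this
    refine ⟨Matrix.toLin v v (Matrix.of y), fun n i j => ?_⟩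
    rw [LinearMap.sub_apply, map_sub, Finsupp.sub_apply, Matrix.toLin_self, v.repr_sum_self]
    have := hy i j n
    rwa [show (n : ℤ) - (d + c i - c j) = n - d - c i + c j by ring] at this
  mem_of_coprime := by
    intro u hu m φ hφ i j
    refine hP.mem_of_coprime hu ?_
    have := hφ i j
    rwa [← nsmul_eq_mul, LinearMap.smul_apply, map_nsmul, Finsupp.smul_apply, nsmul_eq_mul] at this

end IsFracFiltration

end EndFiltration

/-! ## Integral bases of weight vectors -/

section WeightBasis

open LieAlgebra LieAlgebra.IsKilling LieModule Module

variable {K : Type*} [Field K] [CharZero K]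
  {g : Type*} [LieRing g] [LieAlgebra K g] [FiniteDimensional K g] [LieAlgebra.IsSimple K g]
  {H : LieSubalgebra K g} [H.IsCartanSubalgebra] [IsTriangularizable K H g]
  {V : Type*} [AddCommGroup V] [Module K V] [FiniteDimensional K V] [LieRingModule g V]
  [LieModule K g V]

/-- A basis `v` of weight vectors of weights `wt` such that the root vectors have coefficients in
`P 0`, together with degrees `c` of its members that are compatible with the heights. -/
structure IsIntegralWeightBasis {ι : Type*} (X : H.root → g) (b : (rootSystem H).Base)
    (P : ℤ → AddSubgroup K) (v : Basis ι K V) (wt : ι → Module.Dual K H) (c : ι → ℤ) : Prop where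
  mem_weightSpace : ∀ i, v i ∈ weightSpace V (wt i : H → K)
  repr_mem : ∀ (α : H.root) (i j : ι), v.repr ⁅X α, v j⁆ i ∈ P 0
  deg_eq : ∀ (α : H.root) (i j : ι), wt i = wt j + (rootSystem H).root α → c i = c j + b.height α

/-- The action on `V` of the element of `g` with given coordinates in the Chevalley basis. -/
noncomputable def IsChevalleySystem.actionMap {X : H.root → g} (hX : IsChevalleySystem X)
    (b : (rootSystem H).Base) (V : Type*) [AddCommGroup V] [Module K V] [LieRingModule g V]
    [LieModule K g V] : (H.root ⊕ b.support → K) →ₗ[K] Module.End K V :=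
  (toEnd K g V : g →ₗ[K] Module.End K V) ∘ₗ (hX.basis b).equivFun.symm.toLinearMap

namespace IsChevalleySystem

variable {X : H.root → g} (hX : IsChevalleySystem X) (b : (rootSystem H).Base)

lemma actionMap_apply (y : H.root ⊕ b.support → K) :
    hX.actionMap b V y = ∑ j, y j • toEnd K g V (hX.basis b j) := by
  simp [actionMap, Basis.equivFun_symm_apply]

lemma range_actionMap : LinearMap.range (hX.actionMap b V) =
    LinearMap.range (toEnd K g V : g →ₗ[K] Module.End K V) := by
  rw [actionMap, LinearMap.range_comp_of_range_eq_top]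
  exact LinearEquiv.range _

lemma lie_mem_range_actionMap : ∀ x ∈ LinearMap.range (hX.actionMap b V),
    ∀ y ∈ LinearMap.range (hX.actionMap b V),
      x * y - y * x ∈ LinearMap.range (hX.actionMap b V) := by
  rw [range_actionMap]
  rintro _ ⟨x, rfl⟩ _ ⟨y, rfl⟩
  exact ⟨⁅x, y⁆, by simp [LieHom.map_lie, LieRing.of_associative_ring_bracket]⟩

open scoped Classical in
lemma exists_fundamentalWeights (b : (rootSystem H).Base) :
    ∃ ϖ : b.support → Module.Dual K H, (∀ i, ϖ i ∈ weightLattice H) ∧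
      ∀ (i j : b.support), ϖ i ((rootSystem H).coroot j) = if i = j then 1 else 0 := by
  have key : ∀ (i j : b.support),
      b.toCoweightBasis.coord i ((rootSystem H).coroot j) = if i = j then (1 : K) else 0 := by
    intro i j
    rw [← b.toCoweightBasis_apply, Basis.coord_apply, Basis.repr_self, Finsupp.single_apply]
    simp [eq_comm]
  refine ⟨fun i => b.toCoweightBasis.coord i, fun i α => ?_, key⟩
  have h1 := b.coroot_mem_span_int α
  generalize (rootSystem H).coroot α = x at h1
  induction h1 using Submodule.span_induction with
  | mem x hx =>
    obtain ⟨j, hj, rfl⟩ := hx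
    have := key i ⟨j, hj⟩
    exact ⟨if i = ⟨j, hj⟩ then 1 else 0, by rw [this]; split_ifs <;> simp⟩
  | zero => exact ⟨0, by simp⟩
  | add x y _ _ hx hy =>
    obtain ⟨m, hm⟩ := hx
    obtain ⟨n, hn⟩ := hy
    exact ⟨m + n, by rw [map_add, hm, hn, Int.cast_add]⟩
  | smul a x _ hx =>
    obtain ⟨m, hm⟩ := hx
    exact ⟨a * m, by rw [map_zsmul, hm, zsmul_eq_mul, Int.cast_mul]⟩

end IsChevalleySystem

namespace IsIntegralWeightBasis

variable {ι : Type*} [Finite ι] {X : H.root → g} {b : (rootSystem H).Base}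
  {P : ℤ → AddSubgroup K} {v : Basis ι K V} {wt : ι → Module.Dual K H} {c : ι → ℤ}
  (hw : IsIntegralWeightBasis X b P v wt c)
include hw

lemma lie_apply (x : H) (i : ι) : ⁅(x : g), v i⁆ = wt i x • v i :=
  mem_weightSpace_dual.mp (hw.mem_weightSpace i) x

lemma repr_lie (x : H) (u : V) (i : ι) : v.repr ⁅(x : g), u⁆ i = wt i x * v.repr u i := by
  have := Fintype.ofFinite ι
  classical
  conv_lhs => rw [← v.sum_repr u]
  rw [lie_sum, map_sum, Finsupp.finsetSum_apply, Finset.sum_eq_single_of_mem i (Finset.mem_univ _)]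
  · rw [lie_smul, hw.lie_apply]
    simp [mul_comm]
  · intro j _ hj
    rw [lie_smul, hw.lie_apply]
    simp [hj]

lemma repr_eq_zero {μ : Module.Dual K H} {u : V} (hu : u ∈ weightSpace V (μ : H → K)) {i : ι}
    (hi : wt i ≠ μ) : v.repr u i = 0 := by
  by_contra h0
  refine hi (LinearMap.ext fun x => ?_)
  have h1 := hw.repr_lie x u i
  rw [mem_weightSpace_dual.mp hu x, map_smul, Finsupp.smul_apply, smul_eq_mul] at h1
  exact (mul_right_cancel₀ h0 h1).symm

lemma exists_wt_eq {μ : Module.Dual K H} (hμ : weightSpace V (μ : H → K) ≠ ⊥) : ∃ i, wt i = μ := by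
  by_contra! hne
  refine hμ ((LieSubmodule.eq_bot_iff _).mpr fun u hu => ?_)
  exact v.repr.injective (Finsupp.ext fun i => by simpa using hw.repr_eq_zero hu (hne i))

lemma weightSpace_wt_ne_bot (i : ι) : weightSpace V (wt i : H → K) ≠ ⊥ := by
  intro h0
  have := hw.mem_weightSpace i
  rw [h0] at this
  exact v.ne_zero i (by simpa using this)

lemma wt_mem_charLattice (i : ι) : wt i ∈ charLattice H V :=
  AddSubgroup.subset_closure (hw.weightSpace_wt_ne_bot i)

lemma apply_eq_smul_of_mem_weightSpace {s : Module.End K V} {a : K} {μ : Module.Dual K H}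
    (hs : ∀ i, wt i = μ → s (v i) = a • v i) {u : V} (hu : u ∈ weightSpace V (μ : H → K)) :
    s u = a • u := by
  have := Fintype.ofFinite ι
  conv_lhs => rw [← v.sum_repr u]
  conv_rhs => rw [← v.sum_repr u]
  rw [map_sum, Finset.smul_sum]
  refine Finset.sum_congr rfl fun i _ => ?_
  by_cases hi : wt i = μ
  · rw [map_smul, hs i hi, smul_comm]
  · rw [hw.repr_eq_zero hu hi, zero_smul, map_zero, smul_zero]

variable (hX : IsChevalleySystem X) {p h : ℕ} (hP : IsFracFiltration p h P)
include hX

lemma repr_root_eq_zero {α : H.root} {i j : ι} (hij : wt i ≠ wt j + (rootSystem H).root α) :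
    v.repr ⁅X α, v j⁆ i = 0 :=
  hw.repr_eq_zero (hX.lie_mem_weightSpace (hw.mem_weightSpace j) α) hij

include hP

/-- A nonzero entry of X_α joins weights that differ by α; there the degrees c differ by exactly
ht(α), so integrality of the entry is all that is needed. -/
lemma toEnd_root_mem (α : H.root) : toEnd K g V (X α) ∈ endFil P v c (b.height α) := by
  intro i j
  rw [toEnd_apply_apply]
  by_cases hij : wt i = wt j + (rootSystem H).root α
  · have := hw.deg_eq α i j hij
    rw [show b.height α - c i + c j = 0 by omega]
    exact hw.repr_mem α i j
  · rw [hw.repr_root_eq_zero hX hij]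
    exact zero_mem _

variable (hV : IsOfSimplyConnectedType H V)
include hV

lemma toEnd_basis_mem (j : H.root ⊕ b.support) :
    toEnd K g V (hX.basis b j) ∈ endFil P v c (IsChevalleySystem.deg b j) := by
  rcases j with α | i
  · rw [IsChevalleySystem.basis_inl, IsChevalleySystem.deg_inl]
    exact hw.toEnd_root_mem hX hP α
  · rw [IsChevalleySystem.basis_inr, IsChevalleySystem.deg_inr]
    refine hP.mem_endFil_of_diagonal c (a := fun j => wt j ((rootSystem H).coroot i))
      (fun j => hw.lie_apply _ j) fun j => ?_
    have h1 := hw.wt_mem_charLattice j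
    rw [show charLattice H V = weightLattice H from hV] at h1
    obtain ⟨n, hn⟩ := h1 i
    rw [hn]
    exact hP.zsmul_one_mem n

lemma actionMap_mem {m : ℤ} {y : H.root ⊕ b.support → K}
    (hy : y ∈ coordFil P (IsChevalleySystem.deg b) m) : hX.actionMap b V y ∈ endFil P v c m := by
  rw [hX.actionMap_apply]
  refine sum_mem fun j _ => ?_
  have := hP.smul_mem_endFil (hy j) (hw.toEnd_basis_mem hX hP hV j)
  rwa [sub_add_cancel] at this

-- The diagonal entries of x are the values of the weights of V at x. Since V is of simply connected
-- type these weights generate the whole weight lattice, and the bound extends to it.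
omit hP hX in
lemma apply_mem_of_toEnd_mem {m : ℤ} {x : H} (hx : toEnd K g V (x : g) ∈ endFil P v c m)
    {μ : Module.Dual K H} (hμ : μ ∈ weightLattice H) : μ x ∈ P m := by
  rw [← show charLattice H V = weightLattice H from hV] at hμ
  induction hμ using AddSubgroup.closure_induction with
  | mem μ hμ =>
    obtain ⟨i, rfl⟩ := hw.exists_wt_eq hμ
    have := hx i i
    rw [toEnd_apply_apply, hw.lie_apply] at this
    simpa using this
  | zero => simp
  | add μ ν _ _ h1 h2 => simpa using add_mem h1 h2
  | neg μ _ h1 => simpa using h1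

variable (hp : 2 < p) (hprime : p.Prime)
include hp hprime

/-- The root vectors and the torus part occupy disjoint sets of matrix entries, as they shift
weights differently; so each component lies separately in degree m. A root coordinate y is recovered
from [y X_α, X_{-α}] = y H_α by evaluating α, which gives 2y, and 2 is invertible as p is odd. A
torus coordinate is recovered by evaluating a fundamental weight. -/
lemma mem_coordFil_of_actionMap_mem {m : ℤ} {y : H.root ⊕ b.support → K}
    (hy : hX.actionMap b V y ∈ endFil P v c m) : y ∈ coordFil P (IsChevalleySystem.deg b) m := by
  classical
  have hA := hP.isPadicFiltration_endFil (p := p) (h := h) v c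
  have hentry : ∀ i j, v.repr (hX.actionMap b V y (v j)) i
      = ∑ α, y (Sum.inl α) * v.repr ⁅X α, v j⁆ i
        + ∑ k : b.support, y (Sum.inr k) * (wt j ((rootSystem H).coroot k) *
          v.repr (v j) i) := by
    intro i j
    rw [hX.actionMap_apply, Fintype.sum_sum_type, LinearMap.add_apply, LinearMap.sum_apply,
      LinearMap.sum_apply, map_add, map_sum, map_sum, Finsupp.add_apply, Finsupp.finsetSum_apply,
      Finsupp.finsetSum_apply]
    congr 1
    · refine Finset.sum_congr rfl fun α _ => ?_
      rw [IsChevalleySystem.basis_inl, LinearMap.smul_apply, map_smul, toEnd_apply_apply]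
      rfl
    · refine Finset.sum_congr rfl fun k _ => ?_
      rw [IsChevalleySystem.basis_inr, LinearMap.smul_apply, map_smul, toEnd_apply_apply,
        hw.lie_apply, map_smul]
      rfl
  have hroot : ∀ α : H.root, y (Sum.inl α) • toEnd K g V (X α) ∈ endFil P v c m := by
    intro α i j
    rw [LinearMap.smul_apply, map_smul, toEnd_apply_apply, Finsupp.smul_apply, smul_eq_mul]
    by_cases hij : wt i = wt j + (rootSystem H).root α
    · have h1 := hy i j
      rw [hentry, Finset.sum_eq_single_of_mem α (Finset.mem_univ _), Finset.sum_eq_zero,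
        add_zero] at h1
      · exact h1
      · intro k _
        have hne : j ≠ i := by
          rintro rfl
          rw [left_eq_add] at hij
          exact (rootSystem H).ne_zero α hij
        rw [Basis.repr_self, Finsupp.single_eq_of_ne hne.symm, mul_zero, mul_zero]
      · intro β _ hβ
        rw [hw.repr_root_eq_zero hX, mul_zero]
        rw [hij]
        exact fun h => hβ ((rootSystem H).root.injective (add_left_cancel h)).symm
    · rw [hw.repr_root_eq_zero hX hij, mul_zero]
      exact zero_mem _
  have htorus : toEnd K g V ((∑ k : b.support, y (Sum.inr k) • (rootSystem H).coroot k : H) : g)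
      ∈ endFil P v c m := by
    refine hP.mem_endFil_of_diagonal c (a := fun j =>
      wt j (∑ k : b.support, y (Sum.inr k) • (rootSystem H).coroot k))
      (fun j => hw.lie_apply _ j) fun j => ?_
    have h1 := hy j j
    rw [hentry, Finset.sum_eq_zero, zero_add] at h1
    · rw [sub_add_cancel] at h1
      rw [map_sum]
      convert h1 using 2 with k
      simp
    · intro α _
      rw [hw.repr_root_eq_zero hX, mul_zero]
      intro h
      rw [left_eq_add] at h
      exact (rootSystem H).ne_zero α h
  rintro (α | k)
  · obtain ⟨β, hβ⟩ := exists_root_eq_neg α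
    have h1 := hroot α
    have h2 := hw.toEnd_root_mem hX hP β
    have h3 : b.height β = -b.height α := by
      have h4 : (rootSystem H).root β
          = (rootSystem H).root α + (-2 : ℤ) • (rootSystem H).root α := by
        rw [hβ]; module
      have := b.height_add_zsmul h4
      simp only [smul_eq_mul] at this
      omega
    have h4 : toEnd K g V ((y (Sum.inl α) • (rootSystem H).coroot α : H) : g)
        ∈ endFil P v c (m + b.height β) := by
      have h5 := sub_mem (hA.mul_mem h1 h2) (add_comm (b.height β) m ▸ hA.mul_mem h2 h1)
      convert h5 using 1
      change toEnd K g V (y (Sum.inl α) • ((rootSystem H).coroot α : g)) = _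
      have h6 : toEnd K g V ⁅X α, X β⁆
          = toEnd K g V (X α) * toEnd K g V (X β) - toEnd K g V (X β) * toEnd K g V (X α) := by
        simp [LieHom.map_lie, LieRing.of_associative_ring_bracket]
      rw [← hX.lie_neg α β hβ, map_smul, h6, smul_sub, smul_mul_assoc, mul_smul_comm]
    have h5 : (rootSystem H).root α ∈ weightLattice H := fun γ =>
      ⟨(rootSystem H).pairingIn ℤ α γ, ((rootSystem H).algebraMap_pairingIn ℤ α γ).symm⟩
    have h7 : (rootSystem H).root α ((rootSystem H).coroot α) = 2 :=
      (rootSystem H).root_coroot_two α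
    have h6 := hw.apply_mem_of_toEnd_mem hV h4 h5
    rw [map_smul, h7, smul_eq_mul, mul_comm, h3,
      ← sub_eq_add_neg] at h6
    have hcop : Nat.Coprime 2 p := (Nat.coprime_primes Nat.prime_two hprime).mpr hp.ne
    exact hP.mem_of_coprime hcop (by exact_mod_cast h6)
  · obtain ⟨ϖ, hϖ, hϖc⟩ := IsChevalleySystem.exists_fundamentalWeights (H := H) b
    have h1 := hw.apply_mem_of_toEnd_mem hV htorus (hϖ k)
    rw [map_sum, Finset.sum_eq_single_of_mem k (Finset.mem_univ _)] at h1
    · rw [map_smul, hϖc, if_pos rfl, smul_eq_mul, mul_one] at h1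
      simpa using h1
    · intro l _ hl
      rw [map_smul, hϖc, if_neg hl.symm, smul_zero]

end IsIntegralWeightBasis

end WeightBasis

/-! ## Exponentials of nilpotent and of diagonal operators -/

section SpecialExponentials

open Module

namespace IsPadicFiltration

section

variable {K E : Type*} [Field K] [CharZero K] [Ring E] [Algebra K E] {p h : ℕ} [Fact p.Prime]
  {A : ℤ → AddSubgroup E} (hA : IsPadicFiltration p h A) (hp : h < p - 1)
include hA hp

lemma isExp_of_pow_eq_zero {x : E} (hx : x ∈ A 1) {M : ℕ} (hM : x ^ M = 0) :
    IsExp K p h A x (∑ k ∈ Finset.range M, (k.factorial : K)⁻¹ • x ^ k) := by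
  intro N
  have h1 : ∑ k ∈ Finset.range M, (k.factorial : K)⁻¹ • x ^ k
      = ∑ k ∈ Finset.range (N + M), (k.factorial : K)⁻¹ • x ^ k := by
    rw [add_comm, Finset.sum_range_add, left_eq_add]
    refine Finset.sum_eq_zero fun k _ => ?_
    rw [pow_add, hM, zero_mul, smul_zero]
  rw [h1, Finset.sum_range_add, add_sub_cancel_left]
  exact sum_mem fun k _ => hA.anti (expRate_mono hp le_rfl (Nat.le_add_right N k))
    (hA.inv_factorial_smul_pow_mem hx _)

end

section

variable {K : Type*} [Field K] [CharZero K] {p h : ℕ} [Fact p.Prime]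
  {P : ℤ → AddSubgroup K} (hP : IsPadicFiltration p h P) (hp : h < p - 1)

/-- The graph of the exponential function of a field. -/
def expGraph (hP : IsPadicFiltration p h P) (hp : h < p - 1) {m : ℤ} (hm : 1 ≤ m) :
    AddSubgroup (K × Additive Kˣ) where
  carrier := {q | q.1 ∈ P m ∧ IsExp K p h P q.1 (q.2.toMul : Kˣ)}
  zero_mem' := ⟨zero_mem _, by simpa using hP.isExp_zero hp⟩
  add_mem' := by
    rintro ⟨x, s⟩ ⟨y, t⟩ ⟨hx, hs⟩ ⟨hy, ht⟩
    exact ⟨add_mem hx hy, hP.isExp_add hp (hP.anti hm hx) (hP.anti hm hy) (Commute.all _ _) hs ht⟩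
  neg_mem' := by
    rintro ⟨x, s⟩ ⟨hx, hs⟩
    exact ⟨neg_mem hx, hP.isExp_neg hp (hP.anti hm hx) hs⟩

lemma mem_expGraph {m : ℤ} (hm : 1 ≤ m) {x : K} {s : Kˣ} :
    (x, Additive.ofMul s) ∈ hP.expGraph hp hm ↔ x ∈ P m ∧ IsExp K p h P x s := Iff.rfl

include hP hp

lemma isExp_zsmul {x : K} (hx : x ∈ P 1) {s : Kˣ} (hs : IsExp K p h P x s) (n : ℤ) :
    IsExp K p h P (n * x) (s ^ n : Kˣ) := by
  have h1 := zsmul_mem ((hP.mem_expGraph hp le_rfl).mpr ⟨hx, hs⟩) n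
  have h2 := h1.2
  simpa using h2

/-- Surjectivity of the exponential onto 1 + P m by successive approximation, using exp x ≡ 1 + x;
no logarithm series is required. -/
lemma exists_isExp_eq {m : ℤ} (hm : 1 ≤ m) {u : Kˣ} (hu : (u : K) - 1 ∈ P m) :
    ∃ y ∈ P m, IsExp K p h P y u := by
  have hex : ∀ x : K, ∃ s : Kˣ, x ∈ P 1 → IsExp K p h P x s := fun x => by
    by_cases hx : x ∈ P 1
    · obtain ⟨s, hs, -⟩ := hP.exists_unit_isExp K hp hx
      exact ⟨s, fun _ => hs⟩
    · exact ⟨1, fun h => absurd h hx⟩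
  choose e he using hex
  have he0 : ∀ {x}, x ∈ P 1 → (e x : K) ∈ P 0 := fun hx =>
    hP.zero_of_one_add zero_le_one (hP.isExp_sub_one_mem hp le_rfl hx (he _ hx))
  have hadd : ∀ {x y}, x ∈ P 1 → y ∈ P 1 → (e (x + y) : K) = e x * e y := fun hx hy =>
    hP.isExp_unique hp (he _ (add_mem hx hy))
      (hP.isExp_add hp hx hy (Commute.all _ _) (he _ hx) (he _ hy))
  have h0 : (e 0 : K) = 1 := hP.isExp_unique hp (he 0 (zero_mem _)) (hP.isExp_zero hp)
  obtain ⟨y, hy, hye⟩ := hP.exists_eq_of_approx (L := P) hP.anti hP.complete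
    (f := fun x => (e x : K)) (φ := id) (fun hx => hx) (by
      intro n hn a x ha hx
      have hx1 := hP.anti hn hx
      have h1 : (e (a + x) : K) - e a - x
          = e a * ((e x : K) - 1 - x) + ((e a : K) - 1) * x := by
        rw [hadd ha hx1]; ring
      rw [id, h1]
      refine add_mem (hP.mul_mem_zero_left (he0 ha) (hP.isExp_sub_mem hp hn hx (he _ hx1))) ?_
      rw [add_comm n]
      exact hP.mul_mem (hP.isExp_sub_one_mem hp le_rfl ha (he _ ha)) hx)
    hm (s := u) (by simpa [h0] using hu)
    (fun {n} hn y hy hs => ⟨_, hs, by simp⟩)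
  exact ⟨y, hy, by rw [hye]; exact he y (hP.anti hm hy)⟩

end

end IsPadicFiltration

lemma IsFracFiltration.isExp_of_diagonal {K : Type*} [Field K] [CharZero K] {V : Type*}
    [AddCommGroup V] [Module K V] {ι : Type*} {P : ℤ → AddSubgroup K} {p h : ℕ}
    (hP : IsFracFiltration p h P) {v : Basis ι K V} (c : ι → ℤ) {φ s : Module.End K V}
    {a e : ι → K} (hφ : ∀ j, φ (v j) = a j • v j) (hs : ∀ j, s (v j) = e j • v j)
    (he : ∀ j, IsExp K p h P (a j) (e j)) : IsExp K p h (endFil P v c) φ s := by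
  intro N
  refine hP.mem_endFil_of_diagonal c
    (a := fun j => e j - ∑ k ∈ Finset.range N, (k.factorial : K)⁻¹ • a j ^ k) (fun j => ?_)
    fun j => he j N
  have hpow : ∀ k, (φ ^ k) (v j) = a j ^ k • v j := by
    intro k
    induction k with
    | zero => simp
    | succ k ih => rw [pow_succ, Module.End.mul_apply, hφ, map_smul, ih, smul_smul, pow_succ']
  rw [LinearMap.sub_apply, hs, LinearMap.sum_apply, sub_smul, Finset.sum_smul]
  congr 1
  refine Finset.sum_congr rfl fun k _ => ?_
  rw [LinearMap.smul_apply, hpow, smul_smul, smul_eq_mul]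

end SpecialExponentials

/-! ## Moy-Prasad groups -/

section MoyPrasad

open LieAlgebra LieAlgebra.IsKilling LieModule Module

variable {K : Type*} [Field K] [CharZero K]
  {g : Type*} [LieRing g] [LieAlgebra K g] [FiniteDimensional K g] [LieAlgebra.IsSimple K g]
  {H : LieSubalgebra K g} [H.IsCartanSubalgebra] [IsTriangularizable K H g]
  (V : Type*) [AddCommGroup V] [Module K V] [FiniteDimensional K V] [LieRingModule g V]
  [LieModule K g V]

/-- The generators of `moyPrasad`, with respect to a filtration `P` of the field. -/
def moyPrasadGens (P : ℤ → AddSubgroup K) (X : H.root → g) (b : (rootSystem H).Base) (m : ℤ) :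
    Set (LinearMap.GeneralLinearGroup K V) :=
  {s | ∃ t : Multiplicative (charLattice H V) →* Kˣ, IsTorusElement V t s ∧
      ∀ χ, (t χ : K) - 1 ∈ P m} ∪
    {s | ∃ (α : H.root) (z : K), (s : Module.End K V) = rootElement V X α z ∧
      z ∈ P (m - b.height α)}

/-- Generating inside the Chevalley group or inside GL(V) makes no difference, since the inclusion
is injective. The rational bounds become integral ones after multiplication by h. -/
lemma mem_moyPrasad_iff (p : ℕ) [Fact p.Prime] [Algebra ℚ_[p] K] [FiniteDimensional ℚ_[p] K]
    [Algebra ℤ_[p] K] [IsScalarTower ℤ_[p] ℚ_[p] K]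
    (X : H.root → g) (b : (rootSystem H).Base) (i : ℕ) (s : chevalleyGroup V X) :
    s ∈ moyPrasad V p X b i ↔ (s : LinearMap.GeneralLinearGroup K V) ∈
      Subgroup.closure (moyPrasadGens V (fracPow p K (coxeterNumber b)) X b i) := by
  have hh : 0 < coxeterNumber b := Nat.succ_pos _
  have h1 : ∀ z : K, ValGE p z ((i : ℚ) / coxeterNumber b) ↔
      z ∈ fracPow p K (coxeterNumber b) i := fun z => by
    rw [← valGE_div_iff p hh, Int.cast_natCast]
  have h2 : ∀ (z : K) (α : H.root), ValGE p z ((i : ℚ) / coxeterNumber b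
      - (b.height α : ℚ) / coxeterNumber b) ↔
      z ∈ fracPow p K (coxeterNumber b) (i - b.height α) := fun z α => by
    rw [← valGE_div_iff p hh, ← sub_div]; push_cast; rfl
  have h3 : (moyPrasad V p X b i).map (chevalleyGroup V X).subtype =
      Subgroup.closure (moyPrasadGens V (fracPow p K (coxeterNumber b)) X b i) := by
    rw [moyPrasad, MonoidHom.map_closure]
    congr 1
    ext s
    simp only [moyPrasadGens, h1, h2]
    constructor
    · rintro ⟨s, hs, rfl⟩
      exact hs
    · intro hs
      have hmem : s ∈ chevalleyGroup V X := Subgroup.subset_closure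
        (hs.imp (fun ⟨t, ht, _⟩ => ⟨t, ht⟩) fun ⟨α, z, hz, _⟩ => ⟨α, z, hz⟩)
      exact ⟨⟨s, hmem⟩, hs, rfl⟩
  rw [← h3]
  exact (Subgroup.mem_map_iff_mem (chevalleyGroup V X).subtype_injective).symm

namespace IsIntegralWeightBasis

variable {V} {ι : Type*} [Finite ι] {X : H.root → g} {b : (rootSystem H).Base}
  {P : ℤ → AddSubgroup K} {v : Basis ι K V} {wt : ι → Module.Dual K H} {c : ι → ℤ}
  (hw : IsIntegralWeightBasis X b P v wt c) (hX : IsChevalleySystem X) {p h : ℕ}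
  (hP : IsFracFiltration p h P) (hV : IsOfSimplyConnectedType H V) [Fact p.Prime] (hp : h < p - 1)
include hP

omit [Fact p.Prime] in
lemma anti_moyPrasadGens : Antitone (moyPrasadGens V P X b) := by
  intro m n hmn s hs
  exact hs.imp (fun ⟨t, ht, ht'⟩ => ⟨t, ht, fun χ => hP.anti hmn (ht' χ)⟩)
    fun ⟨α, z, hz, hz'⟩ => ⟨α, z, hz, hP.anti (by omega) hz'⟩

include hw hX hp

lemma isExp_rootElement (α : H.root) {z : K} (hz : z ∈ P (1 - b.height α)) :
    IsExp K p h (endFil P v c) (z • toEnd K g V (X α)) (rootElement V X α z) := by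
  have hA := hP.isPadicFiltration_endFil (p := p) (h := h) v c
  have h1 : z • toEnd K g V (X α) ∈ endFil P v c 1 := by
    have := hP.smul_mem_endFil hz (hw.toEnd_root_mem hX hP α)
    rwa [sub_add_cancel] at this
  obtain ⟨β, hβ⟩ := exists_root_eq_neg α
  have h2 : (z • toEnd K g V (X α)) ^ (finrank K V + 1) = 0 := by
    -- A nilpotent operator on V has vanishing power with exponent dim V, so the truncation in
    -- `rootElement` omits no nonzero term.
    rw [_root_.smul_pow, pow_succ (toEnd K g V (X α)), LinearMap.ext (f := toEnd K g V (X α) ^ finrank K V) (g := 0)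
      fun u => ?_, zero_mul, smul_zero]
    obtain ⟨k, hk⟩ := (hX.isSl2Action V hβ).isNilpotent_e
    exact Module.End.ker_pow_le_ker_pow_finrank _ k (by rw [LinearMap.mem_ker, hk]; rfl)
  have h3 := hA.isExp_of_pow_eq_zero (K := K) hp h1 h2
  unfold rootElement
  rwa [map_smul]

include hV

lemma moyPrasadGens_subset {m : ℤ} (hm : 1 ≤ m) {s : LinearMap.GeneralLinearGroup K V}
    (hs : s ∈ moyPrasadGens V P X b m) :
    ∃ x ∈ LinearMap.range (hX.actionMap b V), x ∈ endFil P v c m ∧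
      IsExp K p h (endFil P v c) x s := by
  classical
  rcases hs with ⟨t, ht, htm⟩ | ⟨α, z, hs, hz⟩
  · have hK := hP.isPadicFiltration
    obtain ⟨ϖ, hϖ, hϖc⟩ := IsChevalleySystem.exists_fundamentalWeights (H := H) b
    have hVeq : charLattice H V = weightLattice H := hV
    rw [← hVeq] at hϖ
    have hy : ∀ i, ∃ y ∈ P m, IsExp K p h P y (t (Multiplicative.ofAdd ⟨ϖ i, hϖ i⟩)) := fun i =>
      hK.exists_isExp_eq hp hm (htm _)
    choose y hy hye using hy
    -- The fundamental weights generate X^*(T), so t is determined by its values on them. Their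
    -- logarithms y_i are the coordinates, in the simple coroots, of the logarithm x of t.
    let x : H := ∑ i, y i • (rootSystem H).coroot i
    have hx : hX.actionMap b V (Sum.elim 0 y) = toEnd K g V (x : g) := by
      rw [hX.actionMap_apply, Fintype.sum_sum_type]
      simp only [Sum.elim_inl, Pi.zero_apply, zero_smul, Finset.sum_const_zero, zero_add,
        Sum.elim_inr, IsChevalleySystem.basis_inr, x]
      rw [AddSubmonoidClass.coe_finsetSum, map_sum]
      refine Finset.sum_congr rfl fun i _ => ?_
      rw [← map_smul]
      rfl
    refine ⟨_, ⟨Sum.elim 0 y, rfl⟩, hw.actionMap_mem hX hP hV ?_, ?_⟩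
    · rintro (α | i)
      · exact zero_mem _
      · simpa using hy i
    · rw [hx]
      refine hP.isExp_of_diagonal c (fun j => hw.lie_apply x j)
        (fun j => ht ⟨wt j, hw.wt_mem_charLattice j⟩ _ (hw.mem_weightSpace j)) fun j => ?_
      have h1 := hw.wt_mem_charLattice j
      rw [hVeq] at h1
      choose n hn using fun i : b.support => h1 i
      have h2 : (⟨wt j, hw.wt_mem_charLattice j⟩ : charLattice H V)
          = ∑ i, n i • ⟨ϖ i, hϖ i⟩ := by
        refine Subtype.ext (b.toCoweightBasis.ext fun i => ?_)
        rw [b.toCoweightBasis_apply, AddSubmonoidClass.coe_finsetSum, LinearMap.sum_apply]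
        simp only [AddSubgroupClass.coe_zsmul, LinearMap.smul_apply, hϖc]
        simpa [Finset.sum_ite_eq'] using hn i
      -- With wt j = ∑ n_i ϖ_i, the value of wt j at x is ∑ n_i y_i and t(wt j) = ∏ t(ϖ_i)^{n_i}.
      -- These correspond under exp because the graph of exp is a subgroup.
      have h3 := sum_mem (S := hK.expGraph hp hm) (t := Finset.univ)
        (f := fun i => n i • (y i, Additive.ofMul (t (Multiplicative.ofAdd ⟨ϖ i, hϖ i⟩))))
        fun i _ => zsmul_mem ((hK.mem_expGraph hp hm).mpr ⟨hy i, hye i⟩) (n i)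
      have h4 := h3.2
      convert h4 using 1
      · rw [Prod.fst_sum, map_sum]
        refine Finset.sum_congr rfl fun i _ => ?_
        rw [map_smul, hn]
        simp [mul_comm]
      · rw [h2, ofAdd_sum, map_prod, Prod.snd_sum, toMul_sum]
        simp [ofAdd_zsmul]
  · have h1 := hw.isExp_rootElement hX hP hp α (hP.anti (by omega) hz)
    refine ⟨z • toEnd K g V (X α), ?_, ?_, by rwa [hs]⟩
    · rw [hX.range_actionMap]
      exact ⟨z • X α, by simp⟩
    · have := hP.smul_mem_endFil hz (hw.toEnd_root_mem hX hP α)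
      rwa [sub_add_cancel] at this

lemma closure_moyPrasadGens_le {m : ℤ} (hm : 1 ≤ m) : Subgroup.closure (moyPrasadGens V P X b m) ≤
    expGroup p h (endFil P v c) (LinearMap.range (hX.actionMap b V)) m :=
  Subgroup.closure_mono fun _ hs => hw.moyPrasadGens_subset hX hP hV hp hm hs

lemma mem_moyPrasadGens {m : ℤ} (hm : 1 ≤ m) {j : H.root ⊕ b.support} {z : K}
    (hz : z ∈ P (m - IsChevalleySystem.deg b j)) {s : LinearMap.GeneralLinearGroup K V}
    (hs : IsExp K p h (endFil P v c) (z • toEnd K g V (hX.basis b j)) s) :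
    s ∈ moyPrasadGens V P X b m := by
  have hA := hP.isPadicFiltration_endFil (p := p) (h := h) v c
  rcases j with α | i
  · rw [IsChevalleySystem.deg_inl] at hz
    rw [IsChevalleySystem.basis_inl] at hs
    exact Or.inr ⟨α, z, hA.isExp_unique hp hs
      (hw.isExp_rootElement hX hP hp α (hP.anti (by omega) hz)), hz⟩
  · rw [IsChevalleySystem.deg_inr, sub_zero] at hz
    rw [IsChevalleySystem.basis_inr] at hs
    left
    have hK := hP.isPadicFiltration
    have hz1 := hP.anti hm hz
    obtain ⟨u, hu, -⟩ := hK.exists_unit_isExp K hp hz1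
    have hVeq : charLattice H V = weightLattice H := hV
    have hn : ∀ μ : charLattice H V, ∃ n : ℤ,
        (μ : Module.Dual K H) ((rootSystem H).coroot i) = n := fun μ => by
      have h1 : (μ : Module.Dual K H) ∈ weightLattice H := hVeq ▸ μ.2
      exact h1 i
    choose n hn using hn
    let nn : charLattice H V →+ ℤ := AddMonoidHom.mk' n fun μ ν => by
      have h1 := hn (μ + ν)
      rw [AddSubgroup.coe_add, LinearMap.add_apply, hn, hn] at h1
      exact_mod_cast h1.symm
    -- This is the value at u = exp z of the cocharacter given by the i-th simple coroot, namely μ ↦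
    -- u^⟨μ, coroot⟩; the exponent is integral because μ lies in the weight lattice.
    let t : Multiplicative (charLattice H V) →* Kˣ := (zpowersHom Kˣ u).comp nn.toMultiplicative
    have ht : ∀ μ, t (Multiplicative.ofAdd μ) = u ^ n μ := fun μ => rfl
    have hdiag : ∀ j, (s : Module.End K V) (v j)
        = ((u ^ n ⟨wt j, hw.wt_mem_charLattice j⟩ : Kˣ) : K) • v j := by
      have h1 : IsExp K p h (endFil P v c) (z • toEnd K g V ((rootSystem H).coroot i : g))
          (v.constr K fun j => ((u ^ n ⟨wt j, hw.wt_mem_charLattice j⟩ : Kˣ) : K) • v j) := by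
        refine hP.isExp_of_diagonal c
          (a := fun j => n ⟨wt j, hw.wt_mem_charLattice j⟩ * z) (fun j => ?_)
          (fun j => by rw [Basis.constr_basis])
          fun j => hK.isExp_zsmul hp hz1 hu _
        rw [LinearMap.smul_apply, toEnd_apply_apply, hw.lie_apply, ← hn, smul_smul, mul_comm]
      intro j
      rw [hA.isExp_unique hp hs h1, Basis.constr_basis]
    refine ⟨t, fun μ x hx => ?_, fun χ => ?_⟩
    · rw [ht]
      refine hw.apply_eq_smul_of_mem_weightSpace (fun j hj => ?_) hx
      rw [hdiag]
      congr 4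
      exact Subtype.ext hj
    · have h1 : u ∈ congrUnits hK m.toNat := by
        have h2 := hK.isExp_sub_one_mem hp hm hz hu
        have h3 := hK.isExp_sub_one_mem hp hm (neg_mem hz) (hK.isExp_neg hp hz1 hu)
        refine ⟨?_, ?_⟩ <;> rwa [Int.toNat_of_nonneg (by omega)]
      have h2 := (zpow_mem h1 (n χ.toAdd)).1
      rw [Int.toNat_of_nonneg (by omega)] at h2
      exact h2

/-- The product, in a fixed order, of one-parameter elements with given logarithms. -/
lemma exists_orderedExp : ∃ e : (H.root ⊕ b.support → K) → LinearMap.GeneralLinearGroup K V,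
    (∀ {m : ℤ}, 1 ≤ m → ∀ {y}, y ∈ coordFil P (IsChevalleySystem.deg b) m →
      e y ∈ Subgroup.closure (moyPrasadGens V P X b m)) ∧ e 0 = 1 ∧
    ∀ {n : ℤ}, 1 ≤ n → ∀ {y x}, y ∈ coordFil P (IsChevalleySystem.deg b) 1 →
      x ∈ coordFil P (IsChevalleySystem.deg b) n →
      (e (y + x) : Module.End K V) - e y - hX.actionMap b V x ∈ endFil P v c (n + 1) := by
  have hA := hP.isPadicFiltration_endFil (p := p) (h := h) v c
  have hB : ∀ {m : ℤ} {j z}, z ∈ P (m - IsChevalleySystem.deg b j) →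
      z • toEnd K g V (hX.basis b j) ∈ endFil P v c m := fun {m j z} hz => by
    have := hP.smul_mem_endFil hz (hw.toEnd_basis_mem hX hP hV j)
    rwa [sub_add_cancel] at this
  -- E j z is the one-parameter element exp(z e_j); where the series is not known to converge it
  -- takes the default value 1.
  have hex : ∀ j (z : K), ∃ s : LinearMap.GeneralLinearGroup K V,
      z ∈ P (1 - IsChevalleySystem.deg b j) →
      IsExp K p h (endFil P v c) (z • toEnd K g V (hX.basis b j)) s := fun j z => by
    by_cases hz : z ∈ P (1 - IsChevalleySystem.deg b j)
    · obtain ⟨s, hs, -⟩ := hA.exists_unit_isExp K hp (hB hz)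
      exact ⟨s, fun _ => hs⟩
    · exact ⟨1, fun h => absurd h hz⟩
  choose E hE using hex
  have hE1 : ∀ {j z}, z ∈ P (1 - IsChevalleySystem.deg b j) →
      (E j z : Module.End K V) - 1 ∈ endFil P v c 1 := fun {j z} hz =>
    hA.isExp_sub_one_mem hp le_rfl (hB hz) (hE j z hz)
  have hEadd : ∀ {n : ℤ}, 1 ≤ n → ∀ {j z w}, z ∈ P (1 - IsChevalleySystem.deg b j) →
      w ∈ P (n - IsChevalleySystem.deg b j) →
      (E j (z + w) : Module.End K V) - E j z - w • toEnd K g V (hX.basis b j)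
        ∈ endFil P v c (n + 1) := by
    intro n hn j z w hz hw
    have hw1 := hP.anti (show 1 - IsChevalleySystem.deg b j ≤ n - IsChevalleySystem.deg b j by omega) hw
    have h1 : (E j (z + w) : Module.End K V) = E j z * E j w := by
      refine hA.isExp_unique hp (hE j _ (add_mem hz hw1)) ?_
      rw [add_smul]
      exact hA.isExp_add hp (hB hz) (hB hw1)
        (((Commute.refl _).smul_left _).smul_right _) (hE j z hz) (hE j w hw1)
    have h2 : (E j (z + w) : Module.End K V) - E j z - w • toEnd K g V (hX.basis b j)
        = E j z * ((E j w : Module.End K V) - 1 - w • toEnd K g V (hX.basis b j))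
          + ((E j z : Module.End K V) - 1) * (w • toEnd K g V (hX.basis b j)) := by
      rw [h1]; simp only [mul_sub, sub_mul, mul_one, one_mul]; abel
    rw [h2]
    refine add_mem (hA.mul_mem_zero_left (hA.zero_of_one_add zero_le_one (hE1 hz))
      (hA.isExp_sub_mem hp hn (hB hw) (hE j w hw1))) ?_
    rw [add_comm n]
    exact hA.mul_mem (hE1 hz) (hB hw)
  have hlist : ∀ (l : List (H.root ⊕ b.support)) {y},
      y ∈ coordFil P (IsChevalleySystem.deg b) 1 →
      (((l.map fun j => E j (y j)).prod : LinearMap.GeneralLinearGroup K V) : Module.End K V) - 1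
        ∈ endFil P v c 1 := by
    intro l y hy
    induction l with
    | nil => simp
    | cons j l ih =>
      rw [List.map_cons, List.prod_cons, Units.val_mul]
      have h1 : ∀ a r : Module.End K V, a * r - 1 = (a - 1) * r + (r - 1) := fun a r => by
        noncomm_ring
      rw [h1]
      exact add_mem (hA.mul_mem_zero_right (hE1 (hy j)) (hA.zero_of_one_add zero_le_one ih)) ih
  refine ⟨fun y => (Finset.univ.toList.map fun j => E j (y j)).prod, ?_, ?_, ?_⟩
  · intro m hm y hy
    refine list_prod_mem fun s hs => ?_
    obtain ⟨j, -, rfl⟩ := List.mem_map.mp hs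
    exact Subgroup.subset_closure (hw.mem_moyPrasadGens hX hP hV hp hm (hy j)
      (hE j _ (hP.anti (by omega) (hy j))))
  · refine List.prod_eq_one fun s hs => ?_
    obtain ⟨j, -, rfl⟩ := List.mem_map.mp hs
    have h1 := hE j 0 (zero_mem _)
    rw [zero_smul] at h1
    exact Units.ext (hA.isExp_unique hp h1 (hA.isExp_zero hp))
  · intro n hn y x hy hx
    have hyx := add_mem hy (hP.anti_coordFil _ hn hx)
    rw [hX.actionMap_apply, ← Finset.sum_map_toList]
    dsimp only
    generalize (Finset.univ : Finset (H.root ⊕ b.support)).toList = l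
    induction l with
    | nil => simp
    | cons j l ih =>
      rw [List.map_cons, List.map_cons, List.map_cons, List.prod_cons, List.prod_cons,
        List.sum_cons, Units.val_mul, Units.val_mul]
      -- The first-order product rule: a changes by about d and the rest r by about e. The terms d
      -- (r' - 1) and (a - 1) e gain a degree because r' and a are congruent to 1.
      have h1 : ∀ a a' r r' d e : Module.End K V, a' * r' - a * r - (d + e) =
          (a' - a - d) * r' + d * (r' - 1) + a * (r' - r - e) + (a - 1) * e := by
        intros; noncomm_ring
      rw [h1]
      have hr := hlist l hyx
      refine add_mem (add_mem (add_mem (hA.mul_mem_zero_right (hEadd hn (hy j) (hx j))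
        (hA.zero_of_one_add zero_le_one hr)) (hA.mul_mem (hB (hx j)) hr))
        (hA.mul_mem_zero_left (hA.zero_of_one_add zero_le_one (hE1 (hy j))) ih)) ?_
      rw [add_comm n]
      refine hA.mul_mem (hE1 (hy j)) (list_sum_mem fun s hs => ?_)
      obtain ⟨j, -, rfl⟩ := List.mem_map.mp hs
      exact hB (hx j)

/-- The leading term of an element of a Moy-Prasad group. -/
lemma exists_coord_of_mem (h0 : 0 < h) {N : ℕ} (hN : 1 ≤ N) {s : LinearMap.GeneralLinearGroup K V}
    (hs : s ∈ Subgroup.closure (moyPrasadGens V P X b 1))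
    (hsN : (s : Module.End K V) - 1 ∈ endFil P v c N) :
    ∃ y ∈ coordFil P (IsChevalleySystem.deg b) N,
      (s : Module.End K V) - 1 - hX.actionMap b V y ∈ endFil P v c (N + 1) := by
  have hA := hP.isPadicFiltration_endFil (p := p) (h := h) v c
  obtain ⟨_, ⟨y, rfl⟩, hy, hsy⟩ := hA.exists_sub_mem_of_mem_expGroup (K := K) hp
    (hX.lie_mem_range_actionMap b) hN (hw.closure_moyPrasadGens_le hX hP hV hp le_rfl hs) hsN
  exact ⟨y, hw.mem_coordFil_of_actionMap_mem hX hP hV (by omega) Fact.out hy, hsy⟩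

lemma closure_le_congrUnits {m : ℕ} (hm : 1 ≤ m) : Subgroup.closure (moyPrasadGens V P X b m) ≤
    congrUnits (hP.isPadicFiltration_endFil v c) m :=
  (hw.closure_moyPrasadGens_le hX hP hV hp (by exact_mod_cast hm)).trans
    (IsPadicFiltration.expGroup_le_congrUnits _ hp _ hm)

/-- The Moy-Prasad filtration is the congruence filtration of the first Moy-Prasad group. -/
theorem mem_closure_iff (h0 : 0 < h) {N : ℕ} (hN : 1 ≤ N) {s : LinearMap.GeneralLinearGroup K V} :
    s ∈ Subgroup.closure (moyPrasadGens V P X b N) ↔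
      s ∈ Subgroup.closure (moyPrasadGens V P X b 1) ∧
      (s : Module.End K V) - 1 ∈ endFil P v c N := by
  have hA := hP.isPadicFiltration_endFil (p := p) (h := h) v c
  have hN' : (1 : ℤ) ≤ N := by exact_mod_cast hN
  refine ⟨fun hs => ⟨Subgroup.closure_mono (anti_moyPrasadGens hP hN') hs,
    (hw.closure_le_congrUnits hX hP hV hp hN hs).1⟩, fun ⟨hs, hsN⟩ => ?_⟩
  obtain ⟨e, he, he0, headd⟩ := hw.exists_orderedExp hX hP hV hp
  have he1 : ∀ {y}, y ∈ coordFil P (IsChevalleySystem.deg b) N →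
      e y ∈ Subgroup.closure (moyPrasadGens V P X b 1) := fun hy =>
    Subgroup.closure_mono (anti_moyPrasadGens hP hN') (he hN' hy)
  -- Approximate s by ordered products `e y` with y of degree at least N. The quotient (e y)⁻¹ s
  -- again lies in the first group, so its leading term has coordinates x in g, and replacing y by y
  -- + x improves the approximation. In the limit s = e y, which visibly lies in the N-th group.
  obtain ⟨y, hy, hsy⟩ := hA.exists_eq_of_approx
    (L := coordFil P (IsChevalleySystem.deg b)) (hP.anti_coordFil _) (hP.complete_coordFil _)
    (f := fun y => (e y : Module.End K V)) (φ := hX.actionMap b V)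
    (fun hx => hw.actionMap_mem hX hP hV hx) headd hN' (s := s) (by simpa [he0] using hsN) (by
      intro n hn y hy hsy
      obtain ⟨n, rfl⟩ := Int.eq_ofNat_of_zero_le (show 0 ≤ n by omega)
      have hU := hA.congrUnits_anti (Nat.zero_le 1)
        (hw.closure_le_congrUnits hX hP hV hp le_rfl (he1 hy))
      obtain ⟨x, hx, hxs⟩ := hw.exists_coord_of_mem hX hP hV hp h0 (N := n) (by omega)
        (mul_mem (inv_mem (he1 hy)) hs) (hA.inv_mul_sub_one_mem hU hsy)
      refine ⟨x, hx, ?_⟩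
      have h1 : (s : Module.End K V) - e y - hX.actionMap b V x
          = e y * ((((e y)⁻¹ * s : LinearMap.GeneralLinearGroup K V) : Module.End K V) - 1
            - hX.actionMap b V x) + ((e y : Module.End K V) - 1) * hX.actionMap b V x := by
        have h2 : (e y : Module.End K V) *
            (((e y)⁻¹ * s : LinearMap.GeneralLinearGroup K V) : Module.End K V) = s := by
          rw [← Units.val_mul, mul_inv_cancel_left]
        simp only [mul_sub, sub_mul, h2, mul_one, one_mul]
        abel
      rw [h1]
      refine add_mem (hA.mul_mem_zero_left (hA.zero_of_one_add le_rfl (by exact_mod_cast hU.1))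
        hxs) ?_
      rw [add_comm (n : ℤ)]
      exact hA.mul_mem (by exact_mod_cast
        (hw.closure_le_congrUnits hX hP hV hp le_rfl (he1 hy)).1) (hw.actionMap_mem hX hP hV hx))
  have : s = e y := Units.ext hsy
  rw [this]
  exact he hN' hy

/-- Every leading term occurs in the Moy-Prasad groups. -/
lemma exists_mem_of_coord {N : ℕ} (hN : 1 ≤ N) {y : H.root ⊕ b.support → K}
    (hy : y ∈ coordFil P (IsChevalleySystem.deg b) N) :
    ∃ s ∈ Subgroup.closure (moyPrasadGens V P X b N),
      (s : Module.End K V) - 1 - hX.actionMap b V y ∈ endFil P v c (N + 1) := by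
  have hN' : (1 : ℤ) ≤ N := by exact_mod_cast hN
  obtain ⟨e, he, he0, headd⟩ := hw.exists_orderedExp hX hP hV hp
  refine ⟨e y, he hN' hy, ?_⟩
  have := headd hN' (zero_mem _) hy
  rwa [zero_add, he0] at this

end IsIntegralWeightBasis

end MoyPrasad

/-! ## Isomorphisms from the reduction of the graded Lie algebra -/

section GrModEps

attribute [local instance] evalZeroAlgebra

namespace IsPValuedFiltration

variable {Γ : Type*} [Group Γ] {p h : ℕ} {F : ℕ → Subgroup Γ} (hF : IsPValuedFiltration p h F)

/-- Unlike the induction principle `Gr.induction`, this keeps the summands in distinct degrees,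
which is needed to separate their coordinates in `mem_range_grEps`. -/
lemma Gr.exists_eq_sum (a : hF.Gr) :
    ∃ (S : Finset ℕ+) (x : ∀ i : ℕ+, F i), a = ∑ i ∈ S, hF.symb i (x i) := by
  classical
  have h1 : ∀ (i : ℕ+) (y : hF.Piece i), ∃ x : F i, DirectSum.of hF.Piece i y = hF.symb i x := by
    intro i y
    obtain ⟨x, hx⟩ := QuotientGroup.mk_surjective (Additive.toMul y)
    refine ⟨x, congrArg _ ?_⟩
    exact hx.symm
  choose r hr using h1
  let a' : ⨁ i, hF.Piece i := a
  refine ⟨DFinsupp.support a', fun i => r i (a' i), ?_⟩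
  have h2 : a' = ∑ i ∈ DFinsupp.support a', DirectSum.of hF.Piece i (a' i) :=
    (DirectSum.sum_support_of a').symm
  have h3 : ∑ i ∈ DFinsupp.support a', DirectSum.of hF.Piece i (a' i)
      = ∑ i ∈ DFinsupp.support a', (hF.symb i (r i (a' i)) : ⨁ i, hF.Piece i) :=
    Finset.sum_congr rfl fun i _ => hr i (a' i)
  exact h2.trans h3

/-- A homomorphism from `gr` onto a Lie algebra `L`, with kernel the image of `ε`, identifies
`gr ⊗ 𝔽_p` with `L`. -/
theorem nonempty_grModEps_lieEquiv [Fact p.Prime] {L : Type*} [LieRing L] [LieAlgebra (ZMod p) L]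
    (f : hF.Gr →+ L) (hlie : ∀ a b, f ⁅a, b⁆ = ⁅f a, f b⁆) (heps : ∀ a, f (hF.grEps a) = 0)
    (hsurj : Function.Surjective f) (hker : ∀ a, f a = 0 → ∃ a', a = hF.grEps a') :
    Nonempty (hF.GrModEps ≃ₗ⁅ZMod p⁆ L) := by
  have hz : ∀ (c : ZMod p) a, f (c • a) = c • f a := fun c a => (f.toZModLinearMap p).map_smul c a
  have hX : ∀ a, f ((X : (ZMod p)[X]) • a) = 0 := fun a => by
    rw [poly_smul_def, aeval_X]
    exact heps a
  -- As f kills the image of ε, a polynomial acts through its constant term. This is the balancing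
  -- condition that lets f descend to the tensor product.
  have hpoly : ∀ (q : (ZMod p)[X]) a, f (q • a) = q.eval 0 • f a := by
    intro q a
    have h1 : q • a = (X : (ZMod p)[X]) • (q.divX • a) + (C (q.coeff 0) : (ZMod p)[X]) • a := by
      rw [smul_smul, ← add_smul, mul_comm, divX_mul_X_add]
    have h2 : (C (q.coeff 0) : (ZMod p)[X]) • a = q.coeff 0 • a := by
      rw [poly_smul_def, aeval_C, Module.algebraMap_end_apply]
    rw [h1, map_add, hX, zero_add, h2, hz, coeff_zero_eq_eval_zero]
  have hsm : ∀ (q : (ZMod p)[X]) (c : ZMod p), q • c = q.eval 0 * c := fun q c => rfl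
  let T : (ZMod p ⊗[(ZMod p)[X]] hF.Gr) →+ L := TensorProduct.liftAddHom
    ((AddMonoidHom.flip ((smulAddHom (ZMod p) L).flip.comp f)))
    (fun q c a => by
      change (q • c) • f a = c • f (q • a)
      rw [hpoly, hsm, mul_comm, mul_smul])
  have hT : ∀ c a, T (c ⊗ₜ a) = c • f a := fun c a => rfl
  have hrep : ∀ t : ZMod p ⊗[(ZMod p)[X]] hF.Gr, ∃ a, t = 1 ⊗ₜ a := by
    intro t
    induction t using TensorProduct.induction_on with
    | zero => exact ⟨0, by rw [TensorProduct.tmul_zero]⟩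
    | tmul c a =>
      refine ⟨(C c : (ZMod p)[X]) • a, ?_⟩
      rw [← TensorProduct.smul_tmul, hsm, eval_C, mul_one]
    | add s t hs ht =>
      obtain ⟨a, rfl⟩ := hs
      obtain ⟨b, rfl⟩ := ht
      exact ⟨a + b, by rw [TensorProduct.tmul_add]⟩
  have hTlie : ∀ s t : ZMod p ⊗[(ZMod p)[X]] hF.Gr, T ⁅s, t⁆ = ⁅T s, T t⁆ := by
    intro s t
    obtain ⟨a, rfl⟩ := hrep s
    obtain ⟨b, rfl⟩ := hrep t
    rw [LieAlgebra.ExtendScalars.bracket_tmul, hT, hT, hT, hlie, mul_one, one_smul, one_smul,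
      one_smul]
  have hbij : Function.Bijective T := by
    refine ⟨(injective_iff_map_eq_zero T).mpr fun t ht => ?_, fun l => ?_⟩
    · obtain ⟨a, rfl⟩ := hrep t
      rw [hT, one_smul] at ht
      obtain ⟨a', rfl⟩ := hker a ht
      have h1 : hF.grEps a' = (X : (ZMod p)[X]) • a' := by
        rw [poly_smul_def, aeval_X]; rfl
      rw [h1, ← TensorProduct.smul_tmul, hsm, eval_X, zero_mul, TensorProduct.zero_tmul]
    · obtain ⟨a, rfl⟩ := hsurj l
      exact ⟨1 ⊗ₜ a, by rw [hT, one_smul]⟩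
  let T' : hF.GrModEps →+ L := T
  let T'' : hF.GrModEps →ₗ⁅ZMod p⁆ L :=
    { T'.toZModLinearMap p with map_lie' := fun {s t} => hTlie s t }
  exact ⟨LieEquiv.ofBijective T'' hbij⟩

end IsPValuedFiltration

end GrModEps

/-! ## Residues -/

section Residues

/-- `res n` is the reduction of `P (n * h) = p ^ n 𝒪` modulo `p ^ (n + 1) 𝒪`. -/
structure IsResidueMap {K k : Type*} [Field K] [CommRing k] (h : ℕ) (P : ℤ → AddSubgroup K)
    (res : ℤ → K → k) : Prop where
  map_add : ∀ {n : ℤ} {x y}, x ∈ P (n * h) → y ∈ P (n * h) → res n (x + y) = res n x + res n y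
  eq_zero_iff : ∀ {n : ℤ} {x}, x ∈ P (n * h) → (res n x = 0 ↔ x ∈ P (n * h + 1))
  map_mul : ∀ {m n : ℤ} {x y}, x ∈ P (m * h) → y ∈ P (n * h) →
    res (m + n) (x * y) = res m x * res n y
  exists_eq : ∀ (n : ℤ) (c : k), ∃ x ∈ P (n * h), res n x = c
  map_intCast_mul : ∀ {n : ℤ} (C : ℤ) {x}, x ∈ P (n * h) → res n (C * x) = C * res n x
  mem_succ : ∀ {m : ℤ} {x}, ¬ (h : ℤ) ∣ m → x ∈ P m → x ∈ P (m + 1)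

/-! ### Reduction modulo p on the powers of p in K. -/

section

variable (p : ℕ) [Fact p.Prime] (K : Type*) [Field K] [CharZero K] [Algebra ℚ_[p] K]
  [FiniteDimensional ℚ_[p] K] [Algebra ℤ_[p] K] [IsScalarTower ℤ_[p] ℚ_[p] K]

open Classical in
/-- The class modulo `p` of `p ^ (-n) * x`. -/
noncomputable def residue (n : ℤ) (x : K) : ResField p K :=
  if h : ∃ a : integralClosure ℤ_[p] K, x = (p : K) ^ n * a then Ideal.Quotient.mk _ h.choose else 0

lemma residue_eq (n : ℤ) (a : integralClosure ℤ_[p] K) :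
    residue p K n ((p : K) ^ n * a) = Ideal.Quotient.mk _ a := by
  have h : ∃ a' : integralClosure ℤ_[p] K, (p : K) ^ n * (a : K) = (p : K) ^ n * a' := ⟨a, rfl⟩
  rw [residue, dif_pos h]
  congr 1
  have h1 := mul_left_cancel₀ (zpow_ne_zero n (natCast_prime_ne_zero p)) h.choose_spec
  exact Subtype.ext h1.symm

lemma isResidueMap_residue {h : ℕ} (hh : 0 < h) :
    IsResidueMap h (fracPow p K h) (residue p K) where
  map_add := by
    intro n x y hx hy
    obtain ⟨a, ha, rfl⟩ := (mem_fracPow_mul_iff p hh).mp hx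
    obtain ⟨a', ha', rfl⟩ := (mem_fracPow_mul_iff p hh).mp hy
    rw [← mul_add]
    have h1 := residue_eq p K n ⟨a, ha⟩
    have h2 := residue_eq p K n ⟨a', ha'⟩
    have h3 := residue_eq p K n (⟨a, ha⟩ + ⟨a', ha'⟩)
    rw [map_add] at h3
    exact h3.trans (congrArg₂ _ h1.symm h2.symm)
  eq_zero_iff := by
    intro n x hx
    obtain ⟨a, ha, rfl⟩ := (mem_fracPow_mul_iff p hh).mp hx
    have h1 := residue_eq p K n ⟨a, ha⟩
    dsimp only at h1
    rw [h1, Ideal.Quotient.eq_zero_iff_mem, Ideal.mem_span_singleton', mem_fracPow_iff p hh]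
    have hp0 : (p : K) ≠ 0 := natCast_prime_ne_zero p
    constructor
    · rintro ⟨c, hc⟩
      have hc' : (c : K) * p = a := by simpa using congrArg Subtype.val hc
      refine ⟨n + 1, by rw [add_mul]; omega, c, c.2, ?_⟩
      rw [← hc', zpow_add_one₀ hp0]; ring
    · rintro ⟨m, hm, c, hc, hac⟩
      have hnm : n < m := by
        by_contra! hle
        have := mul_le_mul_of_nonneg_right hle (Int.natCast_nonneg h)
        omega
      obtain ⟨q, rfl⟩ := Int.exists_add_of_le (Int.add_one_le_of_lt hnm)
      have h2 : a = p * ((p : K) ^ q * c) := by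
        refine mul_left_cancel₀ (zpow_ne_zero n hp0) ?_
        rw [hac, zpow_add₀ hp0, zpow_add₀ hp0, zpow_one, zpow_natCast]
        ring
      refine ⟨⟨(p : K) ^ q * c, mul_mem (pow_mem (natCast_mem _ p) _) hc⟩, Subtype.ext ?_⟩
      change (p : K) ^ q * c * ((p : integralClosure ℤ_[p] K) : K) = a
      rw [h2, mul_comm]
      rfl
  map_mul := by
    intro m n x y hx hy
    obtain ⟨a, ha, rfl⟩ := (mem_fracPow_mul_iff p hh).mp hx
    obtain ⟨a', ha', rfl⟩ := (mem_fracPow_mul_iff p hh).mp hy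
    have h1 := residue_eq p K m ⟨a, ha⟩
    have h2 := residue_eq p K n ⟨a', ha'⟩
    have h3 := residue_eq p K (m + n) (⟨a, ha⟩ * ⟨a', ha'⟩)
    rw [map_mul, ← h1, ← h2] at h3
    rw [← h3, zpow_add₀ (natCast_prime_ne_zero p)]
    congr 1
    simp only [MulMemClass.coe_mul]
    ring
  exists_eq := by
    intro n c
    obtain ⟨a, rfl⟩ := Ideal.Quotient.mk_surjective c
    exact ⟨(p : K) ^ n * a, (mem_fracPow_mul_iff p hh).mpr ⟨a, a.2, rfl⟩, residue_eq p K n a⟩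
  map_intCast_mul := by
    intro n C x hx
    obtain ⟨a, ha, rfl⟩ := (mem_fracPow_mul_iff p hh).mp hx
    have h1 := residue_eq p K n ⟨a, ha⟩
    have h3 := residue_eq p K n (C * ⟨a, ha⟩)
    rw [map_mul, ← h1, map_intCast] at h3
    rw [← h3]
    congr 1
    simp only [MulMemClass.coe_mul, SubringClass.coe_intCast]
    ring
  mem_succ := by
    intro m x hm hx
    obtain ⟨n, hn, a, ha, rfl⟩ := (mem_fracPow_iff p hh).mp hx
    refine (mem_fracPow_iff p hh).mpr ⟨n, ?_, a, ha, rfl⟩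
    have : m ≠ n * h := fun h0 => hm ⟨n, by rw [h0, mul_comm]⟩
    omega

end

namespace IsResidueMap

variable {K k : Type*} [Field K] [CommRing k] {p h : ℕ} {P : ℤ → AddSubgroup K} {res : ℤ → K → k}
  (hR : IsResidueMap h P res)
include hR

lemma map_zero (n : ℤ) : res n 0 = 0 := by
  have := hR.map_add (n := n) (zero_mem _) (zero_mem _)
  simpa using this

lemma map_sum {ι : Type*} (s : Finset ι) {n : ℤ} {x : ι → K} (hx : ∀ i ∈ s, x i ∈ P (n * h)) :
    res n (∑ i ∈ s, x i) = ∑ i ∈ s, res n (x i) := by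
  classical
  induction s using Finset.induction_on with
  | empty => simpa using hR.map_zero n
  | insert i s hi ih =>
    rw [Finset.sum_insert hi, Finset.sum_insert hi, hR.map_add (hx i (Finset.mem_insert_self i s))
      (sum_mem fun j hj => hx j (Finset.mem_insert_of_mem hj)),
      ih fun j hj => hx j (Finset.mem_insert_of_mem hj)]

end IsResidueMap

/-- The exponent `n ∈ {0, 1}` for which `1 ≤ d + n * h ≤ h`. -/
def shiftExp (d : ℤ) : ℤ := if 0 < d then 0 else 1

/-- The `i`-th homogeneous component of the reduction of a coordinate vector. -/
noncomputable def leadCoord {K k J : Type*} [CommRing k] (h : ℕ) (res : ℤ → K → k) (d : J → ℤ)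
    (i : ℤ) (y : J → K) : J → k :=
  fun j => if d j + shiftExp (d j) * h = i then res (shiftExp (d j)) (y j) else 0

/-! ### Leading coordinates and their brackets. -/

section LeadCoord

variable {K k J : Type*} [Field K] [CommRing k] {p h : ℕ} {P : ℤ → AddSubgroup K} {res : ℤ → K → k}
  {d : J → ℤ}

lemma shiftExp_mul_bounds {e : ℤ} (h1 : -(h : ℤ) < e) (h2 : e < h) :
    1 ≤ e + shiftExp e * h ∧ e + shiftExp e * h ≤ h := by
  unfold shiftExp
  split_ifs <;> omega

/-- An interval of h consecutive integers meets each residue class modulo h exactly once. -/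
lemma eq_shiftExp {e i n : ℤ} (h1 : -(h : ℤ) < e) (h2 : e < h) (hi : 1 ≤ i) (hi' : i ≤ h)
    (hn : i - e = n * h) : n = shiftExp e := by
  obtain ⟨h3, h4⟩ := shiftExp_mul_bounds h1 h2
  have h5 : i - (e + shiftExp e * h) = (n - shiftExp e) * h := by rw [sub_mul, ← hn]; ring
  by_contra hne
  have h6 : (h : ℤ) ∣ i - (e + shiftExp e * h) := ⟨n - shiftExp e, by rw [h5, mul_comm]⟩
  have h7 := Int.eq_zero_of_abs_lt_dvd h6 (by rw [abs_lt]; constructor <;> omega)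
  rw [h7] at h5
  rcases mul_eq_zero.mp h5.symm with h8 | h8 <;> omega

variable (hd : ∀ j, -(h : ℤ) < d j ∧ d j < h)
include hd

lemma leadCoord_eq_zero_of_lt {i : ℤ} (hi : (h : ℤ) < i) (y : J → K) :
    leadCoord h res d i y = 0 := by
  ext j
  have := (shiftExp_mul_bounds (hd j).1 (hd j).2).2
  rw [leadCoord, if_neg (by omega), Pi.zero_apply]

variable (hR : IsResidueMap h P res)
include hR

omit hd in
lemma leadCoord_add {i : ℤ} {y y' : J → K} (hy : y ∈ coordFil P d i) (hy' : y' ∈ coordFil P d i) :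
    leadCoord h res d i (y + y') = leadCoord h res d i y + leadCoord h res d i y' := by
  ext j
  simp only [leadCoord, Pi.add_apply]
  split_ifs with hj
  · have h1 := hy j
    have h2 := hy' j
    rw [← hj, add_sub_cancel_left] at h1 h2
    exact hR.map_add h1 h2
  · rw [add_zero]

omit hd in
lemma leadCoord_eq_zero {i : ℤ} (hP : Antitone P) {y : J → K} (hy : y ∈ coordFil P d (i + 1)) :
    leadCoord h res d i y = 0 := by
  ext j
  rw [leadCoord, Pi.zero_apply]
  split_ifs with hj
  · have h1 := hy j
    rw [← hj, add_sub_right_comm, add_sub_cancel_left] at h1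
    exact (hR.eq_zero_iff (hP (by omega) h1)).mpr h1
  · rfl

/-- A coordinate whose required degree i - d j is not divisible by h lies one step deeper
automatically, as values of h v are multiples of h. In the other coordinates, vanishing of the
residue says the same. -/
lemma mem_of_leadCoord_eq_zero {i : ℤ} (hi : 1 ≤ i) (hi' : i ≤ h) {y : J → K}
    (hy : y ∈ coordFil P d i) (h0 : leadCoord h res d i y = 0) : y ∈ coordFil P d (i + 1) := by
  intro j
  have h1 := hy j
  rw [add_sub_right_comm]
  by_cases hdvd : (h : ℤ) ∣ i - d j
  · obtain ⟨n, hn⟩ := hdvd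
    rw [mul_comm] at hn
    have h2 := eq_shiftExp (hd j).1 (hd j).2 hi hi' hn
    have h3 := congrFun h0 j
    rw [leadCoord, if_pos (by rw [← h2, ← hn]; ring), Pi.zero_apply, ← h2] at h3
    rw [hn] at h1 ⊢
    exact (hR.eq_zero_iff h1).mp h3
  · exact hR.mem_succ hdvd h1

omit hd in
lemma exists_leadCoord_eq_single [DecidableEq J] (j : J) (c : k) :
    ∃ y ∈ coordFil P d (d j + shiftExp (d j) * h),
      leadCoord h res d (d j + shiftExp (d j) * h) y = Pi.single j c := by
  obtain ⟨x, hx, hxc⟩ := hR.exists_eq (shiftExp (d j)) c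
  refine ⟨Pi.single j x, fun l => ?_, ?_⟩
  · rcases eq_or_ne l j with rfl | hl
    · rwa [Pi.single_eq_same, add_sub_cancel_left]
    · rw [Pi.single_eq_of_ne hl]; exact zero_mem _
  · ext l
    rw [leadCoord]
    rcases eq_or_ne l j with rfl | hl
    · rw [if_pos rfl, Pi.single_eq_same, Pi.single_eq_same, hxc]
    · rw [Pi.single_eq_of_ne hl, Pi.single_eq_of_ne hl, hR.map_zero, ite_self]

open Classical in
/-- The reduction of a bracket with integral, graded structure constants. -/
lemma leadCoord_bracket [Fintype J] (hP : IsFracFiltration p h P) {C : J → J → J → ℤ}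
    (hC : ∀ a b l, C a b l ≠ 0 → d l = d a + d b) {i i' : ℤ} (hi : 1 ≤ i) (hi' : 1 ≤ i')
    {y y' : J → K} (hy : y ∈ coordFil P d i) (hy' : y' ∈ coordFil P d i') :
    leadCoord h res d (i + i') (fun l => ∑ a, ∑ b, (C a b l : K) * (y a * y' b)) = fun l =>
      ∑ a, ∑ b, if shiftExp (d l) = shiftExp (d a) + shiftExp (d b) then
        (C a b l : k) * (leadCoord h res d i y a * leadCoord h res d i' y' b) else 0 := by
  ext l
  rw [leadCoord]
  split_ifs with hl
  · have hmem : ∀ a b, (C a b l : K) * (y a * y' b) ∈ P (shiftExp (d l) * h) := by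
      intro a b
      by_cases h0 : C a b l = 0
      · rw [h0, Int.cast_zero, zero_mul]; exact zero_mem _
      · have h1 := hP.mul_mem (hP.zsmul_one_mem (C a b l)) (hP.mul_mem (hy a) (hy' b))
        have h2 := hC a b l h0
        rwa [show 0 + (i - d a + (i' - d b)) = shiftExp (d l) * h by linarith] at h1
    rw [hR.map_sum _ fun a _ => sum_mem fun b _ => hmem a b]
    refine Finset.sum_congr rfl fun a _ => ?_
    rw [hR.map_sum _ fun b _ => hmem a b]
    refine Finset.sum_congr rfl fun b _ => ?_
    by_cases h0 : C a b l = 0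
    · rw [h0, Int.cast_zero, zero_mul, hR.map_zero]
      simp
    have hdl := hC a b l h0
    have hya := hy a
    have hyb := hy' b
    have hyab : y a * y' b ∈ P (shiftExp (d l) * h) := by
      have h1 := hP.mul_mem hya hyb
      rwa [show i - d a + (i' - d b) = shiftExp (d l) * h by linarith] at h1
    rw [hR.map_intCast_mul _ hyab]
    have hih : i + i' ≤ h := hl ▸ (shiftExp_mul_bounds (hd l).1 (hd l).2).2
    -- If one of the two required degrees is not a multiple of h, that factor lies one step deeper
    -- and the product reduces to zero.
    have hgap : ¬ ((h : ℤ) ∣ i - d a ∧ (h : ℤ) ∣ i' - d b) → res (shiftExp (d l)) (y a * y' b) = 0 := by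
      intro hnd
      refine (hR.eq_zero_iff hyab).mpr ?_
      rw [not_and_or] at hnd
      rcases hnd with h1 | h1
      · have h2 := hP.mul_mem (hR.mem_succ h1 hya) hyb
        rwa [show i - d a + 1 + (i' - d b) = shiftExp (d l) * h + 1 by linarith] at h2
      · have h2 := hP.mul_mem hya (hR.mem_succ h1 hyb)
        rwa [show i - d a + (i' - d b + 1) = shiftExp (d l) * h + 1 by linarith] at h2
    by_cases hdv : (h : ℤ) ∣ i - d a ∧ (h : ℤ) ∣ i' - d b
    · obtain ⟨⟨n, hn⟩, ⟨n', hn'⟩⟩ := hdv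
      rw [mul_comm] at hn hn'
      have h1 := eq_shiftExp (hd a).1 (hd a).2 hi (by omega) hn
      have h2 := eq_shiftExp (hd b).1 (hd b).2 hi' (by omega) hn'
      rw [hn, h1] at hya
      rw [hn', h2] at hyb
      have h3 : shiftExp (d l) = shiftExp (d a) + shiftExp (d b) := by
        -- Comparing total degrees, i + i' = d a + d b + shiftExp (d l) h = d a + d b + (shiftExp (d
        -- a) + shiftExp (d b)) h, so the exponents add.
        have h4 : (shiftExp (d l) - (shiftExp (d a) + shiftExp (d b))) * h = 0 := by
          rw [h1] at hn; rw [h2] at hn'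
          linarith
        rcases mul_eq_zero.mp h4 with h5 | h5 <;> omega
      rw [if_pos h3, h3, hR.map_mul hya hyb, leadCoord, if_pos (by rw [← h1, ← hn]; ring),
        leadCoord, if_pos (by rw [← h2, ← hn']; ring)]
    · rw [hgap hdv, mul_zero]
      split_ifs with h3
      · symm
        rw [leadCoord, leadCoord]
        by_cases ha : d a + shiftExp (d a) * h = i
        · by_cases hb : d b + shiftExp (d b) * h = i'
          · exact absurd ⟨⟨shiftExp (d a), by linarith⟩, ⟨shiftExp (d b), by linarith⟩⟩ hdv
          · rw [if_neg hb, mul_zero, mul_zero]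
        · rw [if_neg ha, zero_mul, mul_zero]
      · rfl
  · symm
    refine Finset.sum_eq_zero fun a _ => Finset.sum_eq_zero fun b _ => ?_
    split_ifs with h3
    · by_cases h0 : C a b l = 0
      · rw [h0, Int.cast_zero, zero_mul]
      · have hdl := hC a b l h0
        rw [leadCoord, leadCoord]
        by_cases ha : d a + shiftExp (d a) * h = i
        · by_cases hb : d b + shiftExp (d b) * h = i'
          · refine absurd ?_ hl
            rw [h3, hdl, ← ha, ← hb]; ring
          · rw [if_neg hb, mul_zero, mul_zero]
        · rw [if_neg ha, zero_mul, mul_zero]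
    · rfl

end LeadCoord

end Residues

/-! ## Coordinates on the semidirect product -/

section SemidirectCoordinates

open Module

variable {k L J : Type*} [CommRing k] [LieRing L] [LieAlgebra k L] [Fintype J]
  (β : Basis J k L) {C : J → J → J → ℤ} {d : J → ℤ}

/-- The part of positive degree of a coordinate vector. -/
def posPartCoord (d : J → ℤ) : (J → k) →ₗ[k] (J → k) where
  toFun w j := if 0 < d j then w j else 0
  map_add' w w' := by ext j; simp only [Pi.add_apply]; split_ifs <;> simp
  map_smul' c w := by ext j; simp

lemma posPartCoord_apply (d : J → ℤ) (w : J → k) (j : J) :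
    posPartCoord d w j = if 0 < d j then w j else 0 := rfl

lemma repr_lie_eq_sum (hβ : ∀ i j, ⁅β i, β j⁆ = ∑ l, C i j l • β l) (w w' : J → k) (l : J) :
    β.repr ⁅β.equivFun.symm w, β.equivFun.symm w'⁆ l = ∑ a, ∑ b, (C a b l : k) * (w a * w' b) := by
  classical
  simp only [β.equivFun_symm_apply]
  rw [sum_lie_sum]
  simp only [smul_lie, lie_smul, hβ, map_sum, Finsupp.coe_finsetSum, Finset.sum_apply, map_smul,
    Finsupp.smul_apply, map_zsmul, β.repr_self, smul_eq_mul]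
  refine Finset.sum_congr rfl fun a _ => Finset.sum_congr rfl fun b _ => ?_
  simp [Finsupp.single_apply, ← Int.cast_smul_eq_zsmul k]
  ring

variable {N : LieSubalgebra k L} (hN : ∀ x, x ∈ N ↔ ∀ j, d j ≤ 0 → β.repr x j = 0)

/-- Coordinates on `N ⋉ (L / N)`, for a subalgebra `N` spanned by the members of a basis of
positive degree. -/
noncomputable def semidirectOfCoord : (J → k) →+ LieSemidirect k N (L ⧸ N.toLieSubmodule) where
  toFun w := ⟨LieSubmodule.Quotient.mk' N.toLieSubmodule (β.equivFun.symm w),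
    ⟨β.equivFun.symm (posPartCoord d w), (hN _).mpr fun j hj => by
      rw [← β.equivFun_apply, LinearEquiv.apply_symm_apply, posPartCoord_apply, if_neg hj.not_gt]⟩⟩
  map_zero' := by
    ext
    · simp; rfl
    · simp
  map_add' w w' := by
    ext
    · change LieSubmodule.Quotient.mk' N.toLieSubmodule _ = LieSubmodule.Quotient.mk' N.toLieSubmodule _
        + LieSubmodule.Quotient.mk' N.toLieSubmodule _
      rw [map_add, map_add]
    · change β.equivFun.symm _ = β.equivFun.symm _ + β.equivFun.symm _
      rw [map_add, map_add]

lemma semidirectOfCoord_injective : Function.Injective (semidirectOfCoord β hN) := by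
  refine (injective_iff_map_eq_zero _).mpr fun w hw => ?_
  have h1 : LieSubmodule.Quotient.mk' N.toLieSubmodule (β.equivFun.symm w) = 0 :=
    congrArg LieAlgebra.SemiDirectSum.left hw
  have h2 : β.equivFun.symm (posPartCoord d w) = 0 :=
    congrArg (fun x => (x.right : L)) hw
  rw [LieSubmodule.Quotient.mk_eq_zero, LieSubalgebra.mem_toLieSubmodule, hN] at h1
  rw [LinearEquiv.map_eq_zero_iff] at h2
  ext j
  by_cases hj : 0 < d j
  · simpa [posPartCoord_apply, hj] using congrFun h2 j
  · have h3 := h1 j (not_lt.mp hj)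
    rwa [← β.equivFun_apply, LinearEquiv.apply_symm_apply] at h3

lemma semidirectOfCoord_surjective : Function.Surjective (semidirectOfCoord β hN) := by
  intro x
  obtain ⟨m, hm⟩ := LieSubmodule.Quotient.surjective_mk' N.toLieSubmodule x.left
  refine ⟨fun j => if 0 < d j then β.repr x.right j else β.repr m j, ?_⟩
  ext
  · refine Eq.trans ?_ hm
    change LieSubmodule.Quotient.mk' N.toLieSubmodule _ = _
    rw [← sub_eq_zero, ← map_sub, LieSubmodule.Quotient.mk_eq_zero,
      LieSubalgebra.mem_toLieSubmodule, hN]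
    intro j hj
    rw [map_sub, Finsupp.sub_apply, ← β.equivFun_apply, LinearEquiv.apply_symm_apply,
      if_neg hj.not_gt, sub_self]
  · change β.equivFun.symm _ = (x.right : L)
    rw [LinearEquiv.symm_apply_eq]
    ext j
    rw [posPartCoord_apply, β.equivFun_apply]
    split_ifs with hj
    · rfl
    · exact ((hN _).mp x.right.2 j (not_lt.mp hj)).symm

-- Exponent 0 marks the part in N and exponent 1 the part in L/N. The condition on exponents keeps
-- the brackets of N with N and of N with L/N and discards those of L/N with itself. Terms with both
-- degrees positive occur twice in the component in L/N, but they land in N and so vanish there.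
open Classical in
lemma lie_semidirectOfCoord (hβ : ∀ i j, ⁅β i, β j⁆ = ∑ l, C i j l • β l)
    (hC : ∀ i j l, C i j l ≠ 0 → d l = d i + d j) (w w' : J → k) :
    ⁅semidirectOfCoord β hN w, semidirectOfCoord β hN w'⁆ = semidirectOfCoord β hN fun l =>
      ∑ a, ∑ b, if shiftExp (d l) = shiftExp (d a) + shiftExp (d b) then
        (C a b l : k) * (w a * w' b) else 0 := by
  ext
  · change (0 : L ⧸ N.toLieSubmodule) +
      LieSubmodule.Quotient.mk' N.toLieSubmodule
        ⁅β.equivFun.symm (posPartCoord d w), β.equivFun.symm w'⁆ -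
      LieSubmodule.Quotient.mk' N.toLieSubmodule
        ⁅β.equivFun.symm (posPartCoord d w'), β.equivFun.symm w⁆ =
      LieSubmodule.Quotient.mk' N.toLieSubmodule _
    rw [zero_add, ← map_sub, ← sub_eq_zero, ← map_sub, LieSubmodule.Quotient.mk_eq_zero,
      LieSubalgebra.mem_toLieSubmodule, hN]
    intro l hl
    rw [← lie_skew (β.equivFun.symm (posPartCoord d w')), sub_neg_eq_add, map_sub, map_add, Finsupp.sub_apply, Finsupp.add_apply,
      repr_lie_eq_sum β hβ, repr_lie_eq_sum β hβ, ← β.equivFun_apply, LinearEquiv.apply_symm_apply,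
      ← Finset.sum_add_distrib, ← Finset.sum_sub_distrib]
    refine Finset.sum_eq_zero fun a _ => ?_
    rw [← Finset.sum_add_distrib, ← Finset.sum_sub_distrib]
    refine Finset.sum_eq_zero fun b _ => ?_
    by_cases h0 : C a b l = 0
    · simp [h0]
    have h1 := hC a b l h0
    simp only [posPartCoord_apply, shiftExp, if_neg hl.not_gt]
    by_cases ha : 0 < d a <;> by_cases hb : 0 < d b
    · omega
    all_goals simp [ha, hb]
  · change ⁅β.equivFun.symm (posPartCoord d w), β.equivFun.symm (posPartCoord d w')⁆ =
      β.equivFun.symm (posPartCoord d _)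
    refine β.repr.injective (Finsupp.ext fun l => ?_)
    rw [repr_lie_eq_sum β hβ, ← β.equivFun_apply, LinearEquiv.apply_symm_apply, posPartCoord_apply]
    split_ifs with hl
    · refine Finset.sum_congr rfl fun a _ => Finset.sum_congr rfl fun b _ => ?_
      simp only [posPartCoord_apply, shiftExp, if_pos hl]
      by_cases ha : 0 < d a <;> by_cases hb : 0 < d b <;> simp [ha, hb]
    · refine Finset.sum_eq_zero fun a _ => Finset.sum_eq_zero fun b _ => ?_
      by_cases h0 : C a b l = 0
      · simp [h0]
      have h1 := hC a b l h0
      simp only [posPartCoord_apply]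
      by_cases ha : 0 < d a <;> by_cases hb : 0 < d b
      · omega
      all_goals simp [ha, hb]

end SemidirectCoordinates

/-! ## The Chevalley basis over a ring -/

section OverRing

open LieAlgebra LieAlgebra.IsKilling LieModule Module

variable {K : Type*} [Field K] [CharZero K]
  {g : Type*} [LieRing g] [LieAlgebra K g] [FiniteDimensional K g] [LieAlgebra.IsSimple K g]
  {H : LieSubalgebra K g} [H.IsCartanSubalgebra] [IsTriangularizable K H g]

namespace IsChevalleySystem

variable {X : H.root → g} (hX : IsChevalleySystem X) (b : (rootSystem H).Base)

lemma linearIndependent_int_basis : LinearIndependent ℤ (hX.basis b) :=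
  (hX.basis b).linearIndependent.restrict_scalars (R := ℤ) (K := K) (by
    intro m n hmn
    simpa using hmn)

/-- The Chevalley basis of the integral form. -/
noncomputable def intBasis : Basis (H.root ⊕ b.support) ℤ hX.intForm :=
  (Basis.span (hX.linearIndependent_int_basis b)).map
    (LinearEquiv.ofEq _ hX.intForm.toSubmodule (hX.span_int_eq b).symm)

@[simp] lemma coe_intBasis (j : H.root ⊕ b.support) : (hX.intBasis b j : g) = hX.basis b j := by
  rw [intBasis, Basis.map_apply]
  exact congrArg Subtype.val (Basis.span_apply (hX.linearIndependent_int_basis b) j)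

variable (k : Type*) [CommRing k]

/-- The Chevalley basis of `g_k`. -/
noncomputable def overRingBasis : Basis (H.root ⊕ b.support) k (hX.overRing k) :=
  Algebra.TensorProduct.basis k (hX.intBasis b)

lemma overRingBasis_apply (j : H.root ⊕ b.support) :
    hX.overRingBasis b k j = 1 ⊗ₜ hX.intBasis b j :=
  Algebra.TensorProduct.basis_apply _ _

lemma lie_overRingBasis {C : H.root ⊕ b.support → H.root ⊕ b.support → H.root ⊕ b.support → ℤ}
    (hC : ∀ i j, ⁅hX.basis b i, hX.basis b j⁆ = ∑ l, C i j l • hX.basis b l)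
    (i j : H.root ⊕ b.support) :
    ⁅hX.overRingBasis b k i, hX.overRingBasis b k j⁆ = ∑ l, C i j l • hX.overRingBasis b k l := by
  have h1 : ⁅hX.intBasis b i, hX.intBasis b j⁆ = ∑ l, C i j l • hX.intBasis b l := by
    refine Subtype.ext ?_
    rw [LieSubalgebra.coe_bracket, coe_intBasis, coe_intBasis, hC]
    change _ = hX.intForm.toSubmodule.subtype _
    rw [map_sum]
    refine Finset.sum_congr rfl fun l _ => ?_
    rw [map_zsmul]
    exact congrArg _ (hX.coe_intBasis b l).symm
  simp only [overRingBasis_apply]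
  rw [LieAlgebra.ExtendScalars.bracket_tmul, h1, mul_one, TensorProduct.tmul_sum]
  refine Finset.sum_congr rfl fun l _ => ?_
  rw [TensorProduct.tmul_smul]

lemma mem_nilradical_iff (x : hX.overRing k) :
    x ∈ hX.nilradical b k ↔ ∀ j, deg b j ≤ 0 → (hX.overRingBasis b k).repr x j = 0 := by
  constructor
  · intro hx j hj
    change x ∈ (hX.intNilradical b).toSubmodule.baseChange k at hx
    rw [Submodule.baseChange_eq_span] at hx
    induction hx using Submodule.span_induction with
    | zero => simp
    | add x y _ _ hx hy => rw [map_add, Finsupp.add_apply, hx, hy, add_zero]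
    | smul c x _ hx => rw [map_smul, Finsupp.smul_apply, hx, smul_zero]
    | mem x hx =>
      obtain ⟨n, hn, rfl⟩ := hx
      change (Algebra.TensorProduct.basis k (hX.intBasis b)).repr (1 ⊗ₜ n) j = 0
      rw [Algebra.TensorProduct.basis_repr_tmul, Finsupp.smul_apply, Finsupp.mapRange_apply]
      have h1 : ∀ y ∈ Submodule.span ℤ (X '' {α | 0 < b.height α}),
          (hX.basis b).repr y j = 0 := by
        intro y hy
        induction hy using Submodule.span_induction with
        | zero => simp
        | add x y _ _ hx hy => rw [map_add, Finsupp.add_apply, hx, hy, add_zero]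
        | smul c x _ hx => rw [map_zsmul, Finsupp.smul_apply, hx, smul_zero]
        | mem x hx =>
          obtain ⟨α, hα, rfl⟩ := hx
          rw [← hX.basis_inl b, Basis.repr_self, Finsupp.single_eq_of_ne]
          rintro rfl
          exact hj.not_gt hα
      have h2 := h1 _ hn
      have h3 : (n : g) = ∑ l, (hX.intBasis b).repr n l • hX.basis b l := by
        conv_lhs => rw [← (hX.intBasis b).sum_repr n]
        change hX.intForm.toSubmodule.subtype _ = _
        rw [map_sum]
        refine Finset.sum_congr rfl fun l _ => ?_
        rw [map_zsmul]
        exact congrArg _ (hX.coe_intBasis b l)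
      change (hX.basis b).repr (n : g) j = 0 at h2
      rw [h3] at h2
      classical
      simp only [← Int.cast_smul_eq_zsmul K, Basis.repr_sum_self] at h2
      rw [Int.cast_eq_zero.mp h2, map_zero, smul_zero]
  · intro hx
    rw [← (hX.overRingBasis b k).sum_repr x]
    refine sum_mem fun j _ => ?_
    by_cases hj : deg b j ≤ 0
    · rw [hx j hj, zero_smul]; exact zero_mem _
    · refine (hX.nilradical b k).smul_mem _ ?_
      rcases j with α | i
      · change _ ∈ (hX.intNilradical b).toSubmodule.baseChange k
        rw [overRingBasis_apply]
        refine Submodule.tmul_mem_baseChange_of_mem 1 ?_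
        change (hX.intBasis b (Sum.inl α) : g) ∈ Submodule.span ℤ (X '' {α | 0 < b.height α})
        rw [coe_intBasis, basis_inl]
        exact Submodule.subset_span ⟨α, not_le.mp hj, rfl⟩
      · simp at hj

open Classical in
/-- Coordinates on `n_k ⋉ (g_k / n_k)` given by the Chevalley basis. -/
theorem exists_nilSemidirect_coord
    {C : H.root ⊕ b.support → H.root ⊕ b.support → H.root ⊕ b.support → ℤ}
    (hC : ∀ i j, ⁅hX.basis b i, hX.basis b j⁆ = ∑ l, C i j l • hX.basis b l)
    (hC' : ∀ i j l, C i j l ≠ 0 → deg b l = deg b i + deg b j) :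
    ∃ Ψ : (H.root ⊕ b.support → k) →+ hX.nilSemidirect b k, Function.Bijective Ψ ∧
      ∀ w w', ⁅Ψ w, Ψ w'⁆ = Ψ fun l => ∑ i, ∑ j,
        if shiftExp (deg b l) = shiftExp (deg b i) + shiftExp (deg b j) then
          (C i j l : k) * (w i * w' j) else 0 :=
  have hN := hX.mem_nilradical_iff b k
  ⟨semidirectOfCoord _ hN, ⟨semidirectOfCoord_injective _ hN, semidirectOfCoord_surjective _ hN⟩,
    lie_semidirectOfCoord _ hN (hX.lie_overRingBasis b k hC) hC'⟩

end IsChevalleySystem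

end OverRing

/-! ## Leading coordinates -/

section LeadingCoordinates

open scoped commutatorElement

/-- The element `s` of a filtered ring is congruent to `1 + φ y` to first order in degree `i`. -/
structure IsLeadingCoord {E K J : Type*} [Ring E] [Field K] (A : ℤ → AddSubgroup E)
    (P : ℤ → AddSubgroup K) (d : J → ℤ) (φ : (J → K) →+ E) (i : ℤ) (s : E) (y : J → K) : Prop where
  mem : y ∈ coordFil P d i
  sub_mem : s - 1 - φ y ∈ A (i + 1)

/-- The filtered group `F` is embedded in the units of a filtered ring `E` as an open subgroup of
a group with Lie algebra `φ (J → K)`, where the coordinates on the latter have degrees `d` and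
structure constants `C`. -/
structure HasLeadingCoords {E Γ K J : Type*} [Ring E] [Group Γ] [Field K] [Fintype J] {p h : ℕ}
    {A : ℤ → AddSubgroup E} (hA : IsPadicFiltration p h A) (P : ℤ → AddSubgroup K) (d : J → ℤ)
    (C : J → J → J → ℤ) (φ : (J → K) →+ E) (ρ : Γ →* Eˣ) (F : ℕ → Subgroup Γ) : Prop where
  bounds : ∀ j, -(h : ℤ) < d j ∧ d j < h
  deg_eq : ∀ i j l, C i j l ≠ 0 → d l = d i + d j
  map_mem_iff : ∀ {m : ℤ} {y : J → K}, φ y ∈ A m ↔ y ∈ coordFil P d m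
  map_lie : ∀ y y' : J → K,
    φ y * φ y' - φ y' * φ y = φ fun l => ∑ a, ∑ b, (C a b l : K) * (y a * y' b)
  mem_congrUnits : ∀ {i x}, 1 ≤ i → x ∈ F i → ρ x ∈ congrUnits hA i
  mem_iff : ∀ {i x}, 1 ≤ i → (x ∈ F i ↔ x ∈ F 1 ∧ (ρ x : E) - 1 ∈ A i)
  exists_coord : ∀ {i x}, 1 ≤ i → x ∈ F i → ∃ y, IsLeadingCoord A P d φ i (ρ x : E) y
  exists_mem : ∀ {i : ℕ} {y}, 1 ≤ i → y ∈ coordFil P d i →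
    ∃ x ∈ F i, IsLeadingCoord A P d φ i (ρ x : E) y

namespace HasLeadingCoords

variable {E Γ K J k : Type*} [Ring E] [Group Γ] [Field K] [Fintype J] [CommRing k] {p h : ℕ}
  [Fact p.Prime]
  {A : ℤ → AddSubgroup E} {hA : IsPadicFiltration p h A} {P : ℤ → AddSubgroup K} {d : J → ℤ}
  {C : J → J → J → ℤ} {φ : (J → K) →+ E} {ρ : Γ →* Eˣ} {F : ℕ → Subgroup Γ}
  (hL : HasLeadingCoords hA P d C φ ρ F)
include hL

lemma sub_one_mem {i : ℤ} {s : E} {y : J → K} (hs : IsLeadingCoord A P d φ i s y) : s - 1 ∈ A i := by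
  have h1 := add_mem (hA.anti (by omega) hs.sub_mem) (hL.map_mem_iff.mpr hs.mem)
  rwa [sub_add_cancel] at h1

lemma mul {i : ℤ} (hi : 1 ≤ i) {s t : E} {y z : J → K} (hs : IsLeadingCoord A P d φ i s y)
    (ht : IsLeadingCoord A P d φ i t z) : IsLeadingCoord A P d φ i (s * t) (y + z) where
  mem := add_mem hs.mem ht.mem
  sub_mem := by
    have h1 : s * t - 1 - φ (y + z) = (s - 1 - φ y) + (t - 1 - φ z) + (s - 1) * (t - 1) := by
      rw [map_add]; noncomm_ring
    rw [h1]
    exact add_mem (add_mem hs.sub_mem ht.sub_mem)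
      (hA.anti (by omega) (hA.mul_mem (hL.sub_one_mem hs) (hL.sub_one_mem ht)))

lemma sub_mem_coordFil {i : ℤ} {s : E} {y z : J → K} (hs : IsLeadingCoord A P d φ i s y)
    (ht : IsLeadingCoord A P d φ i s z) : y - z ∈ coordFil P d (i + 1) := by
  rw [← hL.map_mem_iff, map_sub]
  have h1 := sub_mem ht.sub_mem hs.sub_mem
  rwa [sub_sub_sub_cancel_left] at h1

lemma mem_coordFil_succ {i : ℤ} {s : E} {y : J → K} (hs : IsLeadingCoord A P d φ i s y)
    (h1 : s - 1 ∈ A (i + 1)) : y ∈ coordFil P d (i + 1) := by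
  rw [← hL.map_mem_iff]
  have h2 := sub_mem h1 hs.sub_mem
  rwa [sub_sub_cancel] at h2

/-- Since s^p - 1 ≡ p (s - 1) one step beyond degree i + h, taking p-th powers multiplies the
leading coordinates by p. -/
lemma pow (hp : h < p - 1) {i : ℤ} (hi : 1 ≤ i) {s : E} {y : J → K}
    (hs : IsLeadingCoord A P d φ i s y) : IsLeadingCoord A P d φ (i + h) (s ^ p) (p • y) := by
  have h1 : s ^ p - 1 - φ (p • y) ∈ A (i + h + 1) := by
    have h2 : s ^ p - 1 - φ (p • y) = (s ^ p - 1 - p * (s - 1)) + p * (s - 1 - φ y) := by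
      rw [map_nsmul, nsmul_eq_mul, mul_sub (p : E) (s - 1)]
      abel
    rw [h2]
    refine add_mem (hA.pow_sub_mem hp hi (hL.sub_one_mem hs)) ?_
    rw [add_right_comm]
    exact hA.prime_mul_mem hs.sub_mem
  refine ⟨?_, h1⟩
  rw [← hL.map_mem_iff, map_nsmul, nsmul_eq_mul]
  exact hA.prime_mul_mem (hL.map_mem_iff.mpr hs.mem)

lemma commutator {i j : ℕ} (hi : 1 ≤ i) (hj : 1 ≤ j) {s t : Γ} {y z : J → K} (hs : s ∈ F i)
    (ht : t ∈ F j) (hsy : IsLeadingCoord A P d φ i (ρ s : E) y)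
    (htz : IsLeadingCoord A P d φ j (ρ t : E) z) :
    IsLeadingCoord A P d φ (i + j) (ρ ⁅s, t⁆ : E)
      (fun l => ∑ a, ∑ b, (C a b l : K) * (y a * z b)) := by
  have h1 : ((ρ ⁅s, t⁆ : Eˣ) : E) - 1 - φ (fun l => ∑ a, ∑ b, (C a b l : K) * (y a * z b))
      ∈ A (i + j + 1) := by
    have h2 := hA.commutator_sub_mem hi hj (hL.mem_congrUnits hi hs) (hL.mem_congrUnits hj ht)
    have h3 : ∀ u v : E, u * v - v * u - (φ y * φ z - φ z * φ y)
        = (u - φ y) * v + φ y * (v - φ z) - ((v - φ z) * u + φ z * (u - φ y)) := by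
      intro u v; noncomm_ring
    have h4 := h3 (ρ s - 1) (ρ t - 1)
    rw [← hL.map_lie, map_commutatorElement, ← sub_add_sub_cancel _ (((ρ s : E) - 1) * (ρ t - 1) -
      (ρ t - 1) * (ρ s - 1)), h4]
    have hy := hL.map_mem_iff.mpr hsy.mem
    have hz := hL.map_mem_iff.mpr htz.mem
    refine add_mem h2 (sub_mem (add_mem ?_ ?_) (add_mem ?_ ?_))
    · exact hA.anti (by omega) (hA.mul_mem hsy.sub_mem (hL.sub_one_mem htz))
    · exact hA.anti (by omega) (hA.mul_mem hy htz.sub_mem)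
    · exact hA.anti (by omega) (hA.mul_mem htz.sub_mem (hL.sub_one_mem hsy))
    · exact hA.anti (by omega) (hA.mul_mem hz hsy.sub_mem)
  refine ⟨?_, h1⟩
  rw [← hL.map_mem_iff, ← hL.map_lie]
  have hy := hL.map_mem_iff.mpr hsy.mem
  have hz := hL.map_mem_iff.mpr htz.mem
  exact sub_mem (hA.mul_mem hy hz) (by rw [add_comm]; exact hA.mul_mem hz hy)

variable {res : ℤ → K → k}

/-- The reduction of the leading coordinates of an element of `F i`. -/
noncomputable def leadFun (res : ℤ → K → k) (i : ℕ+) (x : F i) : J → k :=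
  leadCoord h res d i (hL.exists_coord i.pos x.2).choose

variable (hR : IsResidueMap h P res) (hP : IsFracFiltration p h P)
include hR hP

/-- Two leading coordinates of the same element differ by a vector of degree i + 1, which the
reduction does not see; hence the choice in `leadFun` is immaterial. -/
lemma leadFun_eq {i : ℕ+} {x : F i} {y : J → K}
    (hy : IsLeadingCoord A P d φ (i : ℕ) (ρ (x : Γ) : E) y) :
    hL.leadFun res i x = leadCoord h res d i y := by
  have h1 := (hL.exists_coord i.pos x.2).choose_spec
  have h2 := hL.sub_mem_coordFil h1 hy
  have h3 := leadCoord_add hR (hP.anti_coordFil d (by omega) h2) hy.mem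
  rw [sub_add_cancel, leadCoord_eq_zero hR hP.anti h2, zero_add] at h3
  exact h3

variable (hF : IsPValuedFiltration p h F)

/-- The reduction of the leading coordinates, on the associated graded. -/
noncomputable def coordMap : hF.Gr →+ (J → k) :=
  hF.liftGr (hL.leadFun res)
    (fun i x y => by
      obtain ⟨a, ha⟩ := hL.exists_coord i.pos x.2
      obtain ⟨b, hb⟩ := hL.exists_coord i.pos y.2
      have hab : IsLeadingCoord A P d φ (i : ℕ) (ρ ((x * y : F i) : Γ) : E) (a + b) := by
        have := hL.mul (by exact_mod_cast i.pos) ha hb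
        simpa using this
      rw [hL.leadFun_eq hR hP ha, hL.leadFun_eq hR hP hb, hL.leadFun_eq hR hP hab]
      exact leadCoord_add hR ha.mem hb.mem)
    (fun i x hx => by
      obtain ⟨a, ha⟩ := hL.exists_coord i.pos x.2
      rw [hL.leadFun_eq hR hP ha]
      refine leadCoord_eq_zero hR hP.anti (hL.mem_coordFil_succ ha ?_)
      exact_mod_cast ((hL.mem_iff (by omega)).mp hx).2)

lemma coordMap_symb {i : ℕ+} {n : ℤ} (hn : (i : ℕ) = n) {x : F i} {y : J → K}
    (hy : IsLeadingCoord A P d φ n (ρ (x : Γ) : E) y) :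
    hL.coordMap hR hP hF (hF.symb i x) = leadCoord h res d n y := by
  subst hn
  rw [coordMap, IsPValuedFiltration.liftGr_symb, hL.leadFun_eq hR hP hy]

open Classical in
lemma lie_coordMap {L : Type*} [LieRing L] (Ψ : (J → k) →+ L)
    (hΨ : ∀ w w', ⁅Ψ w, Ψ w'⁆ = Ψ fun l => ∑ a, ∑ b,
      if shiftExp (d l) = shiftExp (d a) + shiftExp (d b) then
        (C a b l : k) * (w a * w' b) else 0) (u v : hF.Gr) :
    Ψ (hL.coordMap hR hP hF ⁅u, v⁆) = ⁅Ψ (hL.coordMap hR hP hF u), Ψ (hL.coordMap hR hP hF v)⁆ := by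
  induction u using IsPValuedFiltration.Gr.induction with
  | zero => rw [hF.gr_zero_lie, map_zero, map_zero, zero_lie]
  | add a b ha hb => rw [hF.gr_add_lie, map_add, map_add, ha, hb, map_add, map_add, add_lie]
  | symb i x =>
    induction v using IsPValuedFiltration.Gr.induction with
    | zero => rw [hF.gr_lie_zero, map_zero, map_zero, lie_zero]
    | add a b ha hb => rw [hF.gr_lie_add, map_add, map_add, ha, hb, map_add, map_add, lie_add]
    | symb j x' =>
      obtain ⟨y, hy⟩ := hL.exists_coord i.pos x.2
      obtain ⟨y', hy'⟩ := hL.exists_coord j.pos x'.2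
      have h1 := hL.commutator i.pos j.pos x.2 x'.2 hy hy'
      rw [hF.bracket_symb, hL.coordMap_symb hR hP hF rfl hy, hL.coordMap_symb hR hP hF rfl hy', hΨ,
        hL.coordMap_symb hR hP hF (by rw [PNat.add_coe, Nat.cast_add]) h1,
        ← leadCoord_bracket hL.bounds hR hP hL.deg_eq (by exact_mod_cast i.pos)
          (by exact_mod_cast j.pos) hy.mem hy'.mem]

/-- The operator ε raises degrees by h, and in degrees above h the reduced leading coordinate is
zero by definition of the exponents. -/
lemma coordMap_grEps (u : hF.Gr) : hL.coordMap hR hP hF (hF.grEps u) = 0 := by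
  induction u using IsPValuedFiltration.Gr.induction with
  | zero => rw [map_zero, map_zero]
  | add a b ha hb => rw [map_add, map_add, ha, hb, add_zero]
  | symb i x =>
    obtain ⟨y, hy⟩ := hL.exists_coord i.pos x.2
    have h1 := hL.pow hF.lt (by exact_mod_cast i.pos) hy
    rw [← Units.val_pow_eq_pow_val, ← map_pow] at h1
    rw [hF.grEps_symb, hL.coordMap_symb hR hP hF (by rw [PNat.add_coe, Nat.cast_add, hF.step_coe])
      (x := hF.ppow x) h1]
    refine leadCoord_eq_zero_of_lt hL.bounds ?_ _
    have := i.pos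
    omega

lemma coordMap_surjective : Function.Surjective (hL.coordMap hR hP hF) := by
  classical
  intro w
  have h1 : ∀ (j : J) (c : k), Pi.single j c ∈ (hL.coordMap hR hP hF).range := by
    intro j c
    obtain ⟨y, hy, hyc⟩ := exists_leadCoord_eq_single hR (d := d) j c
    obtain ⟨n, hn⟩ := Int.eq_ofNat_of_zero_le
      (zero_le_one.trans (shiftExp_mul_bounds (hL.bounds j).1 (hL.bounds j).2).1)
    have hn1 := (shiftExp_mul_bounds (hL.bounds j).1 (hL.bounds j).2).1
    rw [hn] at hy hyc hn1
    have hn2 : 1 ≤ n := by exact_mod_cast hn1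
    lift n to ℕ+ using hn2
    obtain ⟨x, hx, hxy⟩ := hL.exists_mem n.pos hy
    refine ⟨hF.symb n ⟨x, hx⟩, ?_⟩
    rw [hL.coordMap_symb hR hP hF (x := ⟨x, hx⟩) rfl hxy]
    exact hyc
  have h2 : w = ∑ j, Pi.single j (w j) := (Finset.univ_sum_single w).symm
  have h3 : w ∈ (hL.coordMap hR hP hF).range := by
    rw [h2]
    exact sum_mem fun j _ => h1 j (w j)
  exact h3

/-- In degrees up to h, vanishing of the reduction means that x lies one step deeper, so its symbol
is zero. In degrees above h, the vector y/p is the leading coordinate of some s in degree i - h, and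
s^p has the same leading coordinate y as x. -/
lemma symb_mem_range_grEps [CharZero K] {i : ℕ+} {x : F i} {y : J → K}
    (hy : IsLeadingCoord A P d φ (i : ℕ) (ρ (x : Γ) : E) y) (h0 : leadCoord h res d i y = 0) :
    hF.symb i x ∈ hF.grEps.range := by
  have hx1 := hF.mem_one i x.2
  by_cases hi : (i : ℕ) ≤ h
  · have h1 := mem_of_leadCoord_eq_zero hL.bounds hR (by exact_mod_cast i.pos)
      (by exact_mod_cast hi) hy.mem h0
    have h2 := add_mem hy.sub_mem (hL.map_mem_iff.mpr h1)
    rw [sub_add_cancel] at h2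
    rw [hF.symb_eq_zero i ((hL.mem_iff (by omega)).mpr ⟨hx1, by exact_mod_cast h2⟩)]
    exact zero_mem _
  · obtain ⟨i', rfl⟩ : ∃ i', i = i' + hF.step :=
      ⟨i - hF.step, (PNat.sub_add_of_lt (not_le.mp hi)).symm⟩
    have hp0 : (p : K) ≠ 0 := Nat.cast_ne_zero.mpr (Fact.out : p.Prime).ne_zero
    replace hy : IsLeadingCoord A P d φ ((i' : ℕ) + h : ℤ) (ρ (x : Γ) : E) y := by
      convert hy using 1
      rw [PNat.add_coe, hF.step_coe, Nat.cast_add]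
    have h1 : (p : K)⁻¹ • y ∈ coordFil P d (i' : ℕ) := by
      intro j
      refine hP.prime_mul_mem_iff.mp ?_
      have h2 := hy.mem j
      rw [Pi.smul_apply, smul_eq_mul, mul_inv_cancel_left₀ hp0]
      rwa [add_sub_right_comm] at h2
    obtain ⟨s, hs, hsy⟩ := hL.exists_mem i'.pos h1
    have h2 := hL.pow hF.lt (by exact_mod_cast i'.pos) hsy
    have h3 : p • (p : K)⁻¹ • y = y := by
      rw [← Nat.cast_smul_eq_nsmul K, smul_inv_smul₀ hp0]
    rw [h3] at h2
    refine ⟨hF.symb i' ⟨s, hs⟩, ?_⟩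
    rw [hF.grEps_symb]
    symm
    refine hF.symb_eq_of_mem _ ?_
    refine (hL.mem_iff (by omega)).mpr ⟨mul_mem (inv_mem hx1)
      (hF.anti (by have := i'.pos; omega) (hF.pow_mem i'.pos hs)), ?_⟩
    rw [map_mul, map_inv]
    refine hA.inv_mul_sub_one_mem (hA.congrUnits_anti (Nat.zero_le 1)
      (hL.mem_congrUnits le_rfl hx1)) ?_
    have h4 := sub_mem h2.sub_mem hy.sub_mem
    rw [sub_sub_sub_cancel_right, sub_sub_sub_cancel_right] at h4
    rw [IsPValuedFiltration.ppow, map_pow, Units.val_pow_eq_pow_val]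
    exact_mod_cast h4

lemma mem_range_grEps [CharZero K] {u : hF.Gr} (hu : hL.coordMap hR hP hF u = 0) :
    u ∈ hF.grEps.range := by
  obtain ⟨S, x, rfl⟩ := IsPValuedFiltration.Gr.exists_eq_sum hF u
  choose y hy using fun i : ℕ+ => hL.exists_coord i.pos (x i).2
  rw [map_sum, Finset.sum_congr rfl fun i _ => hL.coordMap_symb hR hP hF rfl (hy i)] at hu
  refine sum_mem fun i hi => hL.symb_mem_range_grEps hR hP hF (hy i) ?_
  ext j
  -- The j-th coordinate is nonzero in the single degree d j + shiftExp (d j) h only, so vanishing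
  -- of the sum forces vanishing of each homogeneous component.
  by_cases hj : d j + shiftExp (d j) * h = (i : ℕ)
  · have h1 := congrFun hu j
    rwa [Finset.sum_apply, Finset.sum_eq_single_of_mem i hi] at h1
    intro i' _ hne
    refine if_neg fun h2 => hne (PNat.eq ?_)
    exact_mod_cast h2.symm.trans hj
  · exact if_neg hj

open Classical in
/-- The reduction of the associated graded modulo `ε` is the Lie algebra of the reductions of the
leading coordinates. -/
theorem nonempty_lieEquiv [CharZero K] {L : Type*} [LieRing L] [LieAlgebra (ZMod p) L]
    (Ψ : (J → k) →+ L) (hΨ : ∀ w w', ⁅Ψ w, Ψ w'⁆ = Ψ fun l => ∑ a, ∑ b,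
      if shiftExp (d l) = shiftExp (d a) + shiftExp (d b) then
        (C a b l : k) * (w a * w' b) else 0) (hbij : Function.Bijective Ψ) :
    Nonempty (hF.GrModEps ≃ₗ⁅ZMod p⁆ L) := by
  refine hF.nonempty_grModEps_lieEquiv (Ψ.comp (hL.coordMap hR hP hF))
    (hL.lie_coordMap hR hP hF Ψ hΨ) (fun a => ?_)
    (hbij.2.comp (hL.coordMap_surjective hR hP hF)) fun a ha => ?_
  · rw [AddMonoidHom.comp_apply, hL.coordMap_grEps hR hP hF, map_zero]
  · obtain ⟨a', rfl⟩ := hL.mem_range_grEps hR hP hF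
      ((map_eq_zero_iff Ψ hbij.1).mp ha)
    exact ⟨a', rfl⟩

end HasLeadingCoords

end LeadingCoordinates

/-! ## Moy-Prasad filtrations -/

section MoyPrasad

attribute [local instance 100] LieRing.ofAssociativeRing

open LieAlgebra LieAlgebra.IsKilling LieModule Module

variable {p : ℕ} [Fact p.Prime] {K : Type*} [Field K] [CharZero K] [Algebra ℚ_[p] K]
  [FiniteDimensional ℚ_[p] K] [Algebra ℤ_[p] K] [IsScalarTower ℤ_[p] ℚ_[p] K]
  {g : Type*} [LieRing g] [LieAlgebra K g] [FiniteDimensional K g] [LieAlgebra.IsSimple K g]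
  {H : LieSubalgebra K g} [H.IsCartanSubalgebra] [IsTriangularizable K H g]
  {b : (rootSystem H).Base} {X : H.root → g} (hX : IsChevalleySystem X)
  {V : Type*} [AddCommGroup V] [Module K V] [FiniteDimensional K V] [LieRingModule g V]
  [LieModule K g V]

lemma coxeterNumber_pos (b : (rootSystem H).Base) : 0 < coxeterNumber b := Nat.succ_pos _

lemma moyPrasadGens_subset_chevalleyGroup (P : ℤ → AddSubgroup K) (m : ℤ) :
    Subgroup.closure (moyPrasadGens V P X b m) ≤ chevalleyGroup V X :=
  Subgroup.closure_mono fun _ hs =>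
    hs.imp (fun ⟨t, ht, _⟩ => ⟨t, ht⟩) fun ⟨α, z, hs, _⟩ => ⟨α, z, hs⟩

-- Ramification index one makes 𝒪_K principal, and simple connectedness makes the weights of V
-- integral on coroots; the degrees come from `exists_degreeFun`.
include hX in
lemma exists_isIntegralWeightBasis (he : IsUnramifiedOverQp p K)
    (hV : IsOfSimplyConnectedType H V) (b : (rootSystem H).Base) :
    ∃ (n : ℕ) (v : Basis (Fin n) K V) (wt : Fin n → Module.Dual K H) (c : Fin n → ℤ),
      IsIntegralWeightBasis X b (fracPow p K (coxeterNumber b)) v wt c := by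
  have := he.isPrincipalIdealRing
  obtain ⟨n, v, wt, hwt, hv⟩ := hX.exists_integral_weightBasis (integralClosure ℤ_[p] K) (V := V)
    (fun μ hμ => by
      rw [← show charLattice H V = weightLattice H from hV]
      exact AddSubgroup.subset_closure hμ) b
  obtain ⟨c, hc⟩ := exists_degreeFun b
  refine ⟨n, v, wt, fun i => c (wt i), hwt, fun α i j => ?_, fun α i j hij => ?_⟩
  · obtain ⟨a, ha⟩ := hv α i j
    have h1 : v.repr ⁅X α, v j⁆ i ∈ fracPow p K (coxeterNumber b) (0 * coxeterNumber b) :=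
      (mem_fracPow_mul_iff p (coxeterNumber_pos b)).mpr
        ⟨(a : K), a.2, by rw [zpow_zero, one_mul, ha]; rfl⟩
    rwa [zero_mul] at h1
  · rw [hij, hc]

namespace IsIntegralWeightBasis

variable {ι : Type*} [Finite ι] {v : Basis ι K V} {wt : ι → Module.Dual K H} {c : ι → ℤ}
  (hw : IsIntegralWeightBasis X b (fracPow p K (coxeterNumber b)) v wt c)
  (hP : IsFracFiltration p (coxeterNumber b) (fracPow p K (coxeterNumber b)))
  (hV : IsOfSimplyConnectedType H V) (hp : coxeterNumber b < p - 1)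
include hw hX hP hV hp

lemma mem_moyPrasad_iff_of_one_le {i : ℕ} (hi : 1 ≤ i) {x : chevalleyGroup V X} :
    x ∈ moyPrasad V p X b i ↔ x ∈ moyPrasad V p X b 1 ∧
      ((x : LinearMap.GeneralLinearGroup K V) : Module.End K V) - 1 ∈
        endFil (fracPow p K (coxeterNumber b)) v c i := by
  rw [mem_moyPrasad_iff, mem_moyPrasad_iff, Nat.cast_one]
  exact hw.mem_closure_iff hX hP hV hp (coxeterNumber_pos b) hi

lemma mem_congrUnits_of_mem_moyPrasad {i : ℕ} (hi : 1 ≤ i) {x : chevalleyGroup V X}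
    (hx : x ∈ moyPrasad V p X b i) : (x : LinearMap.GeneralLinearGroup K V) ∈
      congrUnits (hP.isPadicFiltration_endFil v c) i :=
  hw.closure_le_congrUnits hX hP hV hp hi ((mem_moyPrasad_iff V p X b i x).mp hx)

theorem isPValuedFiltration_moyPrasad :
    IsPValuedFiltration p (coxeterNumber b) (moyPrasad V p X b) := by
  refine (hP.isPadicFiltration_endFil v c).isPValuedFiltration (coxeterNumber_pos b) hp
    (chevalleyGroup V X).subtype Subtype.val_injective (fun i j hij x hx => ?_)
    (fun x hx => hw.mem_congrUnits_of_mem_moyPrasad hX hP hV hp le_rfl hx)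
    fun hi => hw.mem_moyPrasad_iff_of_one_le hX hP hV hp hi
  rw [mem_moyPrasad_iff] at hx ⊢
  exact Subgroup.closure_mono (anti_moyPrasadGens hP (by exact_mod_cast hij)) hx

theorem hasLeadingCoords {C : H.root ⊕ b.support → H.root ⊕ b.support → H.root ⊕ b.support → ℤ}
    (hC : ∀ i j, ⁅hX.basis b i, hX.basis b j⁆ = ∑ l, C i j l • hX.basis b l)
    (hC' : ∀ i j l, C i j l ≠ 0 → IsChevalleySystem.deg b l =
      IsChevalleySystem.deg b i + IsChevalleySystem.deg b j) :
    HasLeadingCoords (hP.isPadicFiltration_endFil v c) (fracPow p K (coxeterNumber b))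
      (IsChevalleySystem.deg b) C (hX.actionMap b V).toAddMonoidHom (chevalleyGroup V X).subtype
      (moyPrasad V p X b) where
  bounds j := ⟨IsChevalleySystem.neg_lt_deg b j, IsChevalleySystem.deg_lt b j⟩
  deg_eq := hC'
  map_mem_iff := ⟨hw.mem_coordFil_of_actionMap_mem hX hP hV
    (by have := coxeterNumber_pos b; omega) Fact.out, hw.actionMap_mem hX hP hV⟩
  map_lie y y' := by
    change toEnd K g V ((hX.basis b).equivFun.symm y) * toEnd K g V ((hX.basis b).equivFun.symm y') -
      toEnd K g V ((hX.basis b).equivFun.symm y') * toEnd K g V ((hX.basis b).equivFun.symm y) =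
      toEnd K g V ((hX.basis b).equivFun.symm _)
    refine (LieHom.map_lie (toEnd K g V) _ _).symm.trans (congrArg (toEnd K g V) ?_)
    rw [LinearEquiv.eq_symm_apply]
    ext l
    exact repr_lie_eq_sum (hX.basis b) hC y y' l
  mem_congrUnits hi hx := hw.mem_congrUnits_of_mem_moyPrasad hX hP hV hp hi hx
  mem_iff hi := hw.mem_moyPrasad_iff_of_one_le hX hP hV hp hi
  exists_coord {i x} hi hx := by
    have h1 := (hw.mem_moyPrasad_iff_of_one_le hX hP hV hp hi).mp hx
    rw [mem_moyPrasad_iff, Nat.cast_one] at h1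
    obtain ⟨y, hy, hxy⟩ := hw.exists_coord_of_mem hX hP hV hp (coxeterNumber_pos b) hi h1.1 h1.2
    exact ⟨y, hy, hxy⟩
  exists_mem {i y} hi hy := by
    obtain ⟨s, hs, hsy⟩ := hw.exists_mem_of_coord hX hP hV hp hi hy
    exact ⟨⟨s, moyPrasadGens_subset_chevalleyGroup _ _ hs⟩, (mem_moyPrasad_iff V p X b i _).mpr hs,
      hy, hsy⟩

end IsIntegralWeightBasis

end MoyPrasad

theorem mainTheorem4
    (p : ℕ) [Fact p.Prime]
    -- a finite extension `K / ℚ_p` with `e = 1`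
    (K : Type*) [Field K] [CharZero K] [Algebra ℚ_[p] K] [FiniteDimensional ℚ_[p] K]
    [Algebra ℤ_[p] K] [IsScalarTower ℤ_[p] ℚ_[p] K] (he : IsUnramifiedOverQp p K)
    -- a split simple Lie algebra over `K`, with a base of its roots and a Chevalley system
    (g : Type*) [LieRing g] [LieAlgebra K g] [FiniteDimensional K g] [LieAlgebra.IsSimple K g]
    (H : LieSubalgebra K g) [H.IsCartanSubalgebra] [LieModule.IsTriangularizable K H g]
    (b : (LieAlgebra.IsKilling.rootSystem H).Base)
    (X : H.root → g) (hX : IsChevalleySystem X)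
    -- a representation `V` that defines the simply connected group `G` with Lie algebra `g`
    (V : Type*) [AddCommGroup V] [Module K V] [FiniteDimensional K V]
    [LieRingModule g V] [LieModule K g V] (hV : IsOfSimplyConnectedType H V)
    (hp : coxeterNumber b < p - 1) :
    ∃ hF : IsPValuedFiltration p (coxeterNumber b) (moyPrasad V p X b),
      Nonempty (hF.GrModEps ≃ₗ⁅ZMod p⁆
        RestrictScalars (ZMod p) (ResField p K) (hX.nilSemidirect b (ResField p K))) := by
  have hP : IsFracFiltration p (coxeterNumber b) (fracPow p K (coxeterNumber b)) :=
    he.isFracFiltration (coxeterNumber_pos b)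
  obtain ⟨n, v, wt, c, hw⟩ := exists_isIntegralWeightBasis hX he hV b
  obtain ⟨C, hC, hC'⟩ := hX.exists_structureConstants b
  have hF := hw.isPValuedFiltration_moyPrasad hX hP hV hp
  have hL := hw.hasLeadingCoords hX hP hV hp hC hC'
  obtain ⟨Ψ, hbij, hΨ⟩ := hX.exists_nilSemidirect_coord b (ResField p K) hC hC'
  -- Additivity of `Ψ` suffices here, as additive maps between vector spaces over 𝔽_p are linear.
  exact ⟨hF, hL.nonempty_lieEquiv (isResidueMap_residue p K (coxeterNumber_pos b)) hP hF
    (L := RestrictScalars (ZMod p) (ResField p K) (hX.nilSemidirect b (ResField p K))) Ψ hΨ hbij⟩
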